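/- Let $\varepsilon^2>0$, $\sigma>0$, $\alpha,\gamma,\chi\ge 0$ and $y\in\mathbb R^2$. Let $\mathbf C_y:\mathbb R^2\to\mathbb R^2$ be bounded, uniformly continuous and of class $C^1$, with bounded and uniformly continuous first partial derivatives. Let $X=\mathbb R\times L^1(\mathbb R^2)\times L^1(\mathbb R^2)$, $X_+=\mathbb R_+\times L^1_+(\mathbb R^2)\times L^1_+(\mathbb R^2)$ and $g(x)=\frac1{2\pi\sigma^2}e^{-|x|^2/(2\sigma^2)}$. Let $A$ be the infinitesimal generator of the diffusion semigroup on $L^1(\mathbb R^2)$ given by $$v\mapsto \int_{\mathbb R^2}\frac{1}{4\pi\varepsilon^2t}e^{-\frac{|x-z|^2}{4\varepsilon^2t}}v(z)\,dz\quad (t>0),$$ and by the identity for $t=0$. Let $B_y$ be the infinitesimal generator of the convection semigroup on $L^1(\mathbb R^2)$ given by $$v\mapsto \exp\Big(-\int_0^t(\nabla\cdot\mathbf C_y)(\Pi_y(-s)x)\,ds\Big)\,v(\Pi_y(-t)x)\quad (t\ge 0),$$ where $\Pi_y$ is the flow of $\mathbf C_y$, that is, $\partial_t\Pi_y(t)z=\mathbf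 C_y(\Pi_y(t)z)$ and $\Pi_y(0)z=z$. Define $$\mathcal A_y(u,v,w)=\big(-\gamma u,\ (A+B_y)v-\alpha v,\ \alpha v-\chi w\big),\qquad \mathcal C_y(u,v,w)=\Big(\chi\int_{\mathbb R^2}w(x)\,dx,\ \gamma\, g(\cdot-y)\,u,\ 0\Big),$$ where $\mathcal A_y$ has the domain $\mathbb R\times D(A+B_y)\times L^1(\mathbb R^2)$ with $D(A+B_y)=D(A)\cap D(B_y)$ $(=D(A))$. **Theorem 4.2 (Positivity).** The operator $\mathcal A_y+\mathcal C_y$ of the full return-to-home system is the infinitesimal generator of a strongly continuous semigroup $\{T_{\mathcal A_y+\mathcal C_y}(t)\}_{t\ge 0}$ of bounded linear operators on $X$, and this semigroup is positive: $$T_{\mathcal A_y+\mathcal C_y}(t)\,X_+\subset X_+\qquad\text{for all } t\ge 0 .$$ -/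

import Mathlib

open MeasureTheory Filter Topology

noncomputable section

namespace ReturnHome

/-- The plane `ℝ²` with its Euclidean norm. -/
abbrev Plane := EuclideanSpace ℝ (Fin 2)

/-- The real Banach space `L¹(ℝ²)` (classes of functions modulo Lebesgue-a.e. equality). -/
abbrev L1 := Lp ℝ 1 (volume : Measure Plane)

/-- The state space `X = ℝ × L¹(ℝ²) × L¹(ℝ²)`. Mathlib's product norm is equivalent to the sum norm
`|u| + ‖v‖ + ‖w‖`, so it gives the same limits. -/
abbrev State := ℝ × L1 × L1

/-- The positive cone `X₊ = ℝ₊ × L¹₊(ℝ²) × L¹₊(ℝ²)`; the order on `L¹` is the a.e. order. -/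
def positiveCone : Set State := {p | 0 ≤ p.1 ∧ 0 ≤ p.2.1 ∧ 0 ≤ p.2.2}

/-! ### Strongly continuous semigroups and their generators -/

section Semigroup

variable {E : Type*} [NormedAddCommGroup E] [NormedSpace ℝ E]

/-- `(T t)_{t ≥ 0}` is a strongly continuous semigroup of bounded linear operators on `E`.
Values of `T` at negative times are irrelevant. -/
structure IsC0Semigroup (T : ℝ → E →L[ℝ] E) : Prop where
  map_zero : T 0 = ContinuousLinearMap.id ℝ E
  map_add : ∀ s t : ℝ, 0 ≤ s → 0 ≤ t → T (s + t) = (T s).comp (T t)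
  continuousOn_orbit : ∀ x : E, ContinuousOn (fun t => T t x) (Set.Ici 0)

/-- The graph of the infinitesimal generator of a family `(S t)_{t ≥ 0}`: the pairs `(x, z)` with
`(S t x - x) / t → z` as `t ↘ 0`. -/
def generatorGraph (S : ℝ → E → E) : Set (E × E) :=
  {p | Tendsto (fun t : ℝ => t⁻¹ • (S t p.1 - p.1)) (𝓝[>] 0) (𝓝 p.2)}

end Semigroup

open Classical in
/-- The class in `L¹(ℝ²)` of an integrable function (and `0` if the function is not integrable). -/
def toL1 (f : Plane → ℝ) : L1 := if hf : Integrable f volume then hf.toL1 f else 0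

/-! ### Diffusion -/

/-- The heat kernel `K(t,x) = exp(-|x|² / (4 ε² t)) / (4 π ε² t)` on `ℝ²`. -/
def heatKernel (ε t : ℝ) (x : Plane) : ℝ :=
  1 / (4 * Real.pi * ε ^ 2 * t) * Real.exp (-‖x‖ ^ 2 / (4 * ε ^ 2 * t))

open Classical in
/-- The diffusion semigroup on `L¹(ℝ²)`: convolution with `K(t,·)` for `t > 0`, and the identity at
`t = 0`. -/
def diffusion (ε t : ℝ) (v : L1) : L1 :=
  if t = 0 then v else toL1 fun x => ∫ z, heatKernel ε t (x - z) * v z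

/-! ### Convection -/

/-- The assumptions on the velocity field: bounded, uniformly continuous, `C¹`, and with bounded,
uniformly continuous first partial derivatives. -/
structure IsVelocityField (C : Plane → Plane) : Prop where
  uniformContinuous : UniformContinuous C
  bounded : ∃ M : ℝ, ∀ x, ‖C x‖ ≤ M
  contDiff : ContDiff ℝ 1 C
  partial_bounded : ∀ i : Fin 2, ∃ M : ℝ, ∀ x, ‖fderiv ℝ C x (EuclideanSpace.single i 1)‖ ≤ M
  partial_uniformContinuous : ∀ i : Fin 2,
    UniformContinuous fun x => fderiv ℝ C x (EuclideanSpace.single i 1)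

/-- The divergence `∂₁ C₁ + ∂₂ C₂`. -/
def divergence (C : Plane → Plane) (x : Plane) : ℝ :=
  ∑ i : Fin 2, fderiv ℝ C x (EuclideanSpace.single i 1) i

open Classical in
/-- The flow `Π(t)z` of `C`: the value at time `t` of the solution on all of `ℝ` of `γ' = C(γ)`,
`γ(0) = z`. This solution exists and is unique when `C` is a bounded Lipschitz field. -/
def flow (C : Plane → Plane) (t : ℝ) (z : Plane) : Plane :=
  if h : ∃ c : ℝ → Plane, c 0 = z ∧ ∀ s, HasDerivAt c (C (c s)) s then h.choose t else z

/-- The convection semigroup on `L¹(ℝ²)`: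
`(T(t)v)(x) = exp(-∫₀ᵗ (div C)(Π(-s)x) ds) v(Π(-t)x)`. -/
def convection (C : Plane → Plane) (t : ℝ) (v : L1) : L1 :=
  toL1 fun x => Real.exp (-∫ s in (0 : ℝ)..t, divergence C (flow C (-s) x)) * v (flow C (-t) x)

/-! ### The full system -/

/-- The graph of `A + B`, where `A` generates the diffusion semigroup and `B` generates the
convection semigroup. -/
def travelGraph (ε : ℝ) (C : Plane → Plane) : Set (L1 × L1) :=
  {p | ∃ a b : L1, (p.1, a) ∈ generatorGraph (diffusion ε) ∧
    (p.1, b) ∈ generatorGraph (convection C) ∧ p.2 = a + b}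

/-- The graph of the operator `(u, v, w) ↦ (-γ u, (A + B) v - α v, α v - χ w)`, with no condition
on `u` and `w` in its domain. -/
def uncoupledGraph (ε α γ χ : ℝ) (C : Plane → Plane) : Set (State × State) :=
  {p | ∃ f : L1, (p.1.2.1, f) ∈ travelGraph ε C ∧
    p.2 = (-γ * p.1.1, f - α • p.1.2.1, α • p.1.2.1 - χ • p.1.2.2)}

/-- The centred Gaussian density `g` on `ℝ²` with standard deviation `σ`. -/
def gaussian (σ : ℝ) (x : Plane) : ℝ :=
  1 / (2 * Real.pi * σ ^ 2) * Real.exp (-‖x‖ ^ 2 / (2 * σ ^ 2))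

/-- The coupling operator `(u, v, w) ↦ (χ ∫ w, γ g(· - y) u, 0)`. -/
def coupling (σ γ χ : ℝ) (y : Plane) (p : State) : State :=
  (χ * ∫ x, p.2.2 x, (γ * p.1) • toL1 fun x => gaussian σ (x - y), 0)

/-- The graph of the operator of the full return-to-home system with home location `y`: the sum of
the uncoupled operator and the coupling operator. -/
def returnHomeGraph (ε σ α γ χ : ℝ) (y : Plane) (C : Plane → Plane) : Set (State × State) :=
  {p | ∃ q : State, (p.1, q) ∈ uncoupledGraph ε α γ χ C ∧ p.2 = q + coupling σ γ χ y p.1}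

end ReturnHome

end

/-! Write `G` for the operator of the full system, given by its graph, `N` for the sum norm `|u| +
‖v‖ + ‖w‖` and `m` for the total mass `u + ∫ v + ∫ w`. The proof rests on three facts.

Dissipativity (`sumNorm_dissipative`): `N x ≤ N (x - h G x)` for `h > 0`. Diffusion and convection
are contraction semigroups on `L¹`, and each loss rate `γ`, `α`, `χ` in one component pays for the
gain it causes in another.

Range (`coupledGraph_range`): `l - G` is onto for large `l`. If `R` is the resolvent of the
diffusion generator `A` at `l`, then `B R` has norm at most a constant times `1/l + l^(-1/2)`,
because a first derivative of the heat kernel at time `t` has `L¹` norm of order `t^(-1/2)`, whose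
Laplace transform is of order `l^(-1/2)` (`exists_relative_bound`). Hence `D(A) ⊆ D(B)`, and a
Neumann series absorbs `B` and all the bounded terms at once. With density of the domain, the
Hille–Yosida theorem in the form `exists_semigroup_of_dissipative` gives the semigroup.

Conservation (`totalMass_coupledGraph`): `m` vanishes on the range of `G`, since diffusion and
convection preserve integrals and the coupling only moves mass between components.

Positivity follows without positive resolvents or product formulas: a state lies in the positive
cone exactly when `N x ≤ m x` (`mem_positiveCone_iff`), and `N - m` does not increase along orbits.
The argument applies to any semigroup with the given generator, so it needs no uniqueness theorem
for semigroups.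

The analytic groundwork is Liouville's formula for the flow, which makes convection an isometric,
integral-preserving semigroup by change of variables, and explicit Gaussian estimates for diffusion.
-/

noncomputable section

namespace ReturnHome

/-! ### Strongly continuous semigroups and their generators -/

section Abstract

variable {E : Type*} [NormedAddCommGroup E] [NormedSpace ℝ E]

theorem continuous_of_le_add_mul_norm {E : Type*} [NormedAddCommGroup E] {p : E → ℝ} {K : ℝ}
    (hp : ∀ x y, p x ≤ p y + K * ‖x - y‖) : Continuous p := by
  have hK : ∀ x y, dist (p x) (p y) ≤ K.toNNReal * dist x y := by
    intro x y
    rw [Real.dist_eq, dist_eq_norm, abs_le]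
    have h1 := hp x y
    have h2 := hp y x
    rw [norm_sub_rev y x] at h2
    have h3 : K * ‖x - y‖ ≤ K.toNNReal * ‖x - y‖ :=
      mul_le_mul_of_nonneg_right (Real.le_coe_toNNReal K) (norm_nonneg _)
    constructor <;> linarith
  exact (LipschitzWith.of_dist_le_mul hK).continuous

/-- A Lipschitz functional does not increase along a path whose right derivative is dissipative
with respect to it. -/
theorem functional_le_of_dissipative_path {p : E → ℝ} {K : ℝ}
    (hp : ∀ x y, p x ≤ p y + K * ‖x - y‖) {u u' : ℝ → E} (hu : ContinuousOn u (Set.Ici 0))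
    (hu' : ∀ t, 0 ≤ t → HasDerivWithinAt u (u' t) (Set.Ici t) t)
    (hc : ∀ t, 0 ≤ t → ContinuousWithinAt u' (Set.Ici t) t)
    (hd : ∀ t, 0 ≤ t → ∀ h : ℝ, 0 < h → p (u t) ≤ p (u t - h • u' t)) {t : ℝ} (ht : 0 ≤ t) :
    p (u t) ≤ p (u 0) := by
  have hpc : Continuous p := continuous_of_le_add_mul_norm hp
  refine image_le_of_liminf_slope_right_le_deriv_boundary (f := fun t => p (u t)) (a := 0) (b := t)
    (B := fun _ => p (u 0)) (B' := fun _ => 0)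
    (hpc.comp_continuousOn (hu.mono Set.Icc_subset_Ici_self)) le_rfl continuousOn_const
    (fun x _ => hasDerivWithinAt_const _ _ _) ?_ ⟨ht, le_rfl⟩
  intro x hx r hr
  apply Eventually.frequently
  have h1 : Tendsto (slope u x) (𝓝[>] x) (𝓝 (u' x)) := by
    have := hasDerivWithinAt_iff_tendsto_slope.1 (hu' x hx.1)
    rwa [Set.Ici_sdiff_left] at this
  have h2 : Tendsto u' (𝓝[>] x) (𝓝 (u' x)) :=
    (hc x hx.1).tendsto.mono_left (nhdsWithin_mono _ Set.Ioi_subset_Ici_self)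
  have h3 : Tendsto (fun z => K * ‖slope u x z - u' z‖) (𝓝[>] x) (𝓝 0) := by
    simpa using ((h1.sub h2).norm).const_mul K
  filter_upwards [h3.eventually (gt_mem_nhds hr), self_mem_nhdsWithin] with z hz hxz
  refine lt_of_le_of_lt ?_ hz
  have hpos : 0 < z - x := sub_pos.2 hxz
  -- Dissipativity is used at the later time `z`, as one implicit Euler step back: `u z - (z - x) •
  -- u' z` misses `u x` by `(z - x)` times a vector tending to 0, by right continuity of `u'`.
  have h4 := hd z (hx.1.trans (le_of_lt hxz)) (z - x) hpos
  have h5 := hp (u z - (z - x) • u' z) (u x)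
  have h6 : u z - (z - x) • u' z - u x = (z - x) • (slope u x z - u' z) := by
    rw [smul_sub, slope_def_module, smul_smul, mul_inv_cancel₀ hpos.ne', one_smul]
    abel
  rw [h6, norm_smul, Real.norm_of_nonneg hpos.le] at h5
  rw [slope_def_field, div_le_iff₀ hpos]
  linarith

namespace IsC0Semigroup

variable {T : ℝ → E →L[ℝ] E}

theorem add_apply (hT : IsC0Semigroup T) {s t : ℝ} (hs : 0 ≤ s) (ht : 0 ≤ t) (x : E) :
    T (s + t) x = T s (T t x) := by
  rw [hT.map_add s t hs ht]; rfl

theorem zero_apply (hT : IsC0Semigroup T) (x : E) : T 0 x = x := by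
  rw [hT.map_zero]; rfl

/-- Orbits starting in the domain of the generator are differentiable from the right. -/
theorem hasDerivWithinAt_orbit (hT : IsC0Semigroup T) {x z : E}
    (h : (x, z) ∈ generatorGraph (fun t p => T t p)) {t : ℝ} (ht : 0 ≤ t) :
    HasDerivWithinAt (fun s => T s x) (T t z) (Set.Ici t) t := by
  rw [hasDerivWithinAt_iff_tendsto_slope, Set.Ici_sdiff_left]
  have h1 : Tendsto (fun s : ℝ => s - t) (𝓝[>] t) (𝓝[>] 0) := by
    refine tendsto_nhdsWithin_iff.2 ⟨?_, ?_⟩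
    · have : Tendsto (fun s : ℝ => s - t) (𝓝 t) (𝓝 (t - t)) := by
        exact (continuous_id.sub continuous_const).tendsto t
      rw [sub_self] at this
      exact this.mono_left nhdsWithin_le_nhds
    · filter_upwards [self_mem_nhdsWithin] with s hs using sub_pos.2 (Set.mem_Ioi.1 hs)
  have h2 := (((T t).continuous.tendsto z).comp (Tendsto.comp h h1))
  refine h2.congr' ?_
  filter_upwards [self_mem_nhdsWithin] with s hs
  have hs' : 0 ≤ s - t := (sub_pos.2 (Set.mem_Ioi.1 hs)).le
  simp only [Function.comp_apply, slope_def_module, map_smul, map_sub]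
  rw [← hT.add_apply ht hs', add_sub_cancel]

theorem apply_mem_generatorGraph (hT : IsC0Semigroup T) {x z : E}
    (h : (x, z) ∈ generatorGraph (fun t p => T t p)) {t : ℝ} (ht : 0 ≤ t) :
    (T t x, T t z) ∈ generatorGraph (fun t p => T t p) := by
  have h2 := (((T t).continuous.tendsto z).comp h)
  refine Tendsto.congr' ?_ h2
  filter_upwards [self_mem_nhdsWithin] with s hs
  have hs' : (0 : ℝ) ≤ s := le_of_lt hs
  simp only [Function.comp_apply, map_smul, map_sub]
  rw [← hT.add_apply ht hs', ← hT.add_apply hs' ht, add_comm]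

theorem orbit_intervalIntegrable (hT : IsC0Semigroup T) (z : E) {h : ℝ} (hh : 0 ≤ h) :
    IntervalIntegrable (fun s => T s z) volume 0 h := by
  apply ContinuousOn.intervalIntegrable
  rw [Set.uIcc_of_le hh]
  exact (hT.continuousOn_orbit z).mono Set.Icc_subset_Ici_self

theorem sub_eq_integral [CompleteSpace E] (hT : IsC0Semigroup T) {x z : E}
    (h : (x, z) ∈ generatorGraph (fun t p => T t p)) {t : ℝ} (ht : 0 ≤ t) :
    T t x - x = ∫ s in (0 : ℝ)..t, T s z := by
  rw [intervalIntegral.integral_eq_sub_of_hasDeriv_right_of_le ht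
    (f := fun s => T s x) (f' := fun s => T s z), hT.zero_apply]
  · exact (hT.continuousOn_orbit x).mono Set.Icc_subset_Ici_self
  · intro s hs
    exact (hT.hasDerivWithinAt_orbit h hs.1.le).mono Set.Ioi_subset_Ici_self
  · exact hT.orbit_intervalIntegrable z ht

/-- Together with `sub_eq_integral` this describes the generator by integral identities, which
survive limits where difference quotients do not. -/
theorem mem_generatorGraph_of_sub_eq_integral [CompleteSpace E] (hT : IsC0Semigroup T) {x z : E}
    (h : ∀ t, 0 ≤ t → T t x - x = ∫ s in (0 : ℝ)..t, T s z) :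
    (x, z) ∈ generatorGraph (fun t p => T t p) := by
  have h0 : HasDerivWithinAt (fun t => ∫ s in (0 : ℝ)..t, T s z) (T 0 z) (Set.Ici 0) 0 := by
    refine intervalIntegral.integral_hasDerivWithinAt_right (by simp) (t := Set.Ioi 0) ?_ ?_
    · refine ⟨Set.Ioi 0, self_mem_nhdsWithin, ?_⟩
      exact ((hT.continuousOn_orbit z).mono Set.Ioi_subset_Ici_self).aestronglyMeasurable
        measurableSet_Ioi
    · exact ((hT.continuousOn_orbit z) 0 Set.self_mem_Ici).mono Set.Ioi_subset_Ici_self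
  rw [hasDerivWithinAt_iff_tendsto_slope, Set.Ici_sdiff_left, hT.zero_apply] at h0
  refine Tendsto.congr' ?_ h0
  filter_upwards [self_mem_nhdsWithin] with t ht
  simp [slope_def_module, h t (le_of_lt ht)]

/-- The generator of a bounded semigroup is closed. -/
theorem isClosed_generatorGraph [CompleteSpace E] (hT : IsC0Semigroup T) {M : ℝ}
    (hM : ∀ t, 0 ≤ t → ∀ x, ‖T t x‖ ≤ M * ‖x‖) :
    IsClosed (generatorGraph (fun t p => T t p)) := by
  have key : generatorGraph (fun t p => T t p) =
      ⋂ t : Set.Ici (0 : ℝ), {q : E × E | T t q.1 - q.1 = ∫ s in (0 : ℝ)..t, T s q.2} := by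
    ext ⟨x, z⟩
    simp only [Set.mem_iInter, Set.mem_ofPred_eq, Subtype.forall, Set.mem_Ici]
    exact ⟨fun h t ht => hT.sub_eq_integral h ht, hT.mem_generatorGraph_of_sub_eq_integral⟩
  rw [key]
  refine isClosed_iInter fun ⟨t, ht⟩ => isClosed_eq (by fun_prop) ?_
  have hlip : Continuous fun z : E => ∫ s in (0 : ℝ)..t, T s z := by
    have hK : ∀ x y : E, dist (∫ s in (0 : ℝ)..t, T s x) (∫ s in (0 : ℝ)..t, T s y) ≤
        (M * t).toNNReal * dist x y := by
      intro x y
      rw [dist_eq_norm, dist_eq_norm, ← intervalIntegral.integral_sub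
        (hT.orbit_intervalIntegrable x ht) (hT.orbit_intervalIntegrable y ht)]
      have := intervalIntegral.norm_integral_le_of_norm_le_const (a := 0) (b := t)
        (f := fun s => T s x - T s y) (C := M * ‖x - y‖) (fun s hs => by
          rw [Set.uIoc_of_le ht] at hs
          rw [← map_sub]
          exact hM s hs.1.le _)
      refine this.trans ?_
      rw [sub_zero, abs_of_nonneg ht, mul_right_comm]
      exact mul_le_mul_of_nonneg_right (Real.le_coe_toNNReal _) (norm_nonneg _)
    exact (LipschitzWith.of_dist_le_mul hK).continuous
  exact hlip.comp continuous_snd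

end IsC0Semigroup

theorem generatorGraph_add_mem {T : ℝ → E →L[ℝ] E} {p q : E × E}
    (hp : p ∈ generatorGraph (fun t x => T t x)) (hq : q ∈ generatorGraph (fun t x => T t x)) :
    p + q ∈ generatorGraph (fun t x => T t x) := by
  refine (Tendsto.add hp hq).congr fun t => ?_
  simp only [Prod.fst_add, map_add, ← smul_add]
  congr 1
  abel

theorem generatorGraph_smul_mem {T : ℝ → E →L[ℝ] E} {p : E × E} (c : ℝ)
    (hp : p ∈ generatorGraph (fun t x => T t x)) :
    c • p ∈ generatorGraph (fun t x => T t x) := by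
  refine (Tendsto.const_smul hp c).congr fun t => ?_
  simp only [Prod.smul_fst, map_smul, ← smul_sub]
  rw [smul_comm]

theorem generatorGraph_unique {S : ℝ → E → E} {x y z : E} (hy : (x, y) ∈ generatorGraph S)
    (hz : (x, z) ∈ generatorGraph S) : y = z :=
  tendsto_nhds_unique hy hz

theorem generatorGraph_congr {S S' : ℝ → E → E} (h : ∀ t, 0 < t → S t = S' t) :
    generatorGraph S = generatorGraph S' := by
  ext p
  refine tendsto_congr' ?_
  filter_upwards [self_mem_nhdsWithin] with t ht
  rw [h t ht]

/-- A bounded semigroup is strongly continuous as soon as the orbits of a dense set of points are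
right continuous at time zero. -/
theorem isC0Semigroup_of_bounded {T : ℝ → E →L[ℝ] E}
    (h0 : T 0 = ContinuousLinearMap.id ℝ E)
    (hadd : ∀ s t : ℝ, 0 ≤ s → 0 ≤ t → T (s + t) = (T s).comp (T t)) {M : ℝ} (hM : 0 ≤ M)
    (hle : ∀ t, 0 ≤ t → ∀ x, ‖T t x‖ ≤ M * ‖x‖) {D : Set E} (hD : Dense D)
    (hc : ∀ x ∈ D, Tendsto (fun t => T t x) (𝓝[>] 0) (𝓝 x)) : IsC0Semigroup T := by
  have hright : ∀ x, ∀ ε > 0, ∃ δ > 0, ∀ t, 0 ≤ t → t < δ → ‖T t x - x‖ < ε := by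
    intro x ε hε
    obtain ⟨y, hyD, hxy⟩ := Metric.dense_iff.1 hD x (ε / (2 * (M + 1))) (by positivity)
    rw [Metric.mem_ball, dist_eq_norm] at hyD
    obtain ⟨δ, hδ, h1⟩ := Metric.tendsto_nhdsWithin_nhds.1 (hc y hxy) (ε / 2) (by positivity)
    refine ⟨δ, hδ, fun t ht htδ => ?_⟩
    have h2 : ‖T t y - y‖ < ε / 2 := by
      rcases ht.eq_or_lt with rfl | ht'
      · simp only [h0, ContinuousLinearMap.id_apply, sub_self, norm_zero]; positivity
      · rw [← dist_eq_norm]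
        exact h1 ht' (by simpa [abs_of_pos ht'] using htδ)
    have h3 : T t x - x = T t (x - y) + (T t y - y) + (y - x) := by rw [map_sub]; abel
    have h4 := hle t ht (x - y)
    rw [norm_sub_rev x y] at h4
    have h5 : (M + 1) * ‖y - x‖ < ε / 2 := by
      have h6 := mul_lt_mul_of_pos_left hyD (show 0 < M + 1 by positivity)
      have h7 : (M + 1) * (ε / (2 * (M + 1))) = ε / 2 := by field_simp
      linarith
    calc ‖T t x - x‖ ≤ ‖T t (x - y)‖ + ‖T t y - y‖ + ‖y - x‖ := by rw [h3]; exact norm_add₃_le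
      _ < ε := by linarith
  refine ⟨h0, hadd, fun x => Metric.continuousOn_iff.2 fun s hs ε hε => ?_⟩
  obtain ⟨δ, hδ, h1⟩ := hright x (ε / (M + 1)) (by positivity)
  -- Factoring out `T a` for the smaller time `a` reduces both left and right continuity to right
  -- continuity at zero, at the cost of the factor `M`.
  have aux : ∀ a b : ℝ, 0 ≤ a → a ≤ b → b - a < δ → ‖T b x - T a x‖ < ε := by
    intro a b ha hab hba
    have h2 : T b x = T a (T (b - a) x) := by
      have := hadd a (b - a) ha (by linarith)
      rw [add_sub_cancel] at this
      rw [this]; rfl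
    rw [h2, ← map_sub]
    have h3 := h1 (b - a) (by linarith) hba
    rw [lt_div_iff₀ (by positivity)] at h3
    refine (hle a ha _).trans_lt ?_
    linarith [norm_nonneg (T (b - a) x - x)]
  refine ⟨δ, hδ, fun t ht hts => ?_⟩
  rw [Real.dist_eq, abs_lt] at hts
  rw [dist_eq_norm]
  rcases le_total s t with h | h
  · exact aux s t hs h (by linarith)
  · rw [norm_sub_rev]
    exact aux t s ht h (by linarith)

end Abstract

/-! ### The resolvent of a contraction semigroup as a Laplace transform -/

section Resolvent

variable {E : Type*} [NormedAddCommGroup E] [NormedSpace ℝ E]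

namespace IsC0Semigroup

variable {T : ℝ → E →L[ℝ] E}

theorem resolvent_integrableOn (hT : IsC0Semigroup T) (hle : ∀ t, 0 ≤ t → ∀ x, ‖T t x‖ ≤ ‖x‖)
    {l : ℝ} (hl : 0 < l) (f : E) :
    IntegrableOn (fun t => Real.exp (-(l * t)) • T t f) (Set.Ioi 0) := by
  have h1 : IntegrableOn (fun t => Real.exp (-l * t) * ‖f‖) (Set.Ioi 0) :=
    (integrableOn_exp_mul_Ioi (neg_lt_zero.2 hl) 0).mul_const _
  refine Integrable.mono' h1 ?_ ?_
  · refine ContinuousOn.aestronglyMeasurable ?_ measurableSet_Ioi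
    refine ContinuousOn.smul (by fun_prop) ?_
    exact (hT.continuousOn_orbit f).mono Set.Ioi_subset_Ici_self
  · filter_upwards [ae_restrict_mem measurableSet_Ioi] with t ht
    rw [norm_smul, Real.norm_of_nonneg (Real.exp_pos _).le, ← neg_mul]
    exact mul_le_mul_of_nonneg_left (hle t (le_of_lt ht) f) (Real.exp_pos _).le

/-- The Laplace transform of a contraction semigroup inverts `l - A`. -/
theorem resolvent_mem_generatorGraph [CompleteSpace E] (hT : IsC0Semigroup T)
    (hle : ∀ t, 0 ≤ t → ∀ x, ‖T t x‖ ≤ ‖x‖) {l : ℝ} (hl : 0 < l) (f : E) :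
    (∫ t in Set.Ioi (0 : ℝ), Real.exp (-(l * t)) • T t f,
      l • (∫ t in Set.Ioi (0 : ℝ), Real.exp (-(l * t)) • T t f) - f) ∈
        generatorGraph (fun t p => T t p) := by
  set φ : ℝ → E := fun t => Real.exp (-(l * t)) • T t f with hφ
  have hint : IntegrableOn φ (Set.Ioi 0) := hT.resolvent_integrableOn hle hl f
  set R : E := ∫ t in Set.Ioi (0 : ℝ), φ t with hR
  -- Applying `T h` shifts the Laplace integral. The right derivative at `h = 0` of the resulting
  -- closed expression is `l • R - f`.
  have hshift : ∀ h, 0 < h → T h R = Real.exp (l * h) • (R - ∫ t in (0 : ℝ)..h, φ t) := by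
    intro h hh
    have hii : IntervalIntegrable φ volume 0 h :=
      (intervalIntegrable_iff_integrableOn_Ioc_of_le hh.le).2 (hint.mono_set Set.Ioc_subset_Ioi_self)
    have h1 : R - ∫ t in (0 : ℝ)..h, φ t = ∫ t in Set.Ioi h, φ t := by
      rw [hR, sub_eq_iff_eq_add, add_comm]
      exact (intervalIntegral.integral_interval_add_Ioi hint
        (hint.mono_set (Set.Ioi_subset_Ioi hh.le))).symm
    rw [h1, hR, ← ContinuousLinearMap.integral_comp_comm _ hint, ← integral_smul]
    have h2 : ∫ t in Set.Ioi (0 : ℝ), Real.exp (l * h) • φ (t + h) =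
        ∫ t in Set.Ioi h, Real.exp (l * h) • φ t := by
      have := (measurePreserving_add_right (volume : Measure ℝ) h).setIntegral_preimage_emb
        (measurableEmbedding_addRight h) (fun t => Real.exp (l * h) • φ t) (Set.Ioi h)
      simpa using this
    rw [← h2]
    refine setIntegral_congr_fun measurableSet_Ioi fun t ht => ?_
    have ht' : (0 : ℝ) ≤ t := le_of_lt ht
    simp only [hφ, map_smul, smul_smul, ← Real.exp_add]
    rw [add_comm t h, hT.add_apply hh.le ht']
    congr 2
    ring
  have hd1 : Tendsto (fun h => h⁻¹ * (Real.exp (l * h) - 1)) (𝓝[>] 0) (𝓝 l) := by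
    have h1 : HasDerivAt (fun h => Real.exp (l * h)) (Real.exp (l * 0) * (l * 1)) 0 :=
      (((hasDerivAt_id (0 : ℝ)).const_mul l)).exp
    have h2 := (hasDerivAt_iff_tendsto_slope.1 h1).mono_left
      (nhdsWithin_mono _ fun x hx => (Set.mem_Ioi.1 hx).ne')
    simpa [slope_fun_def, Function.comp_def] using h2
  have hd2 : Tendsto (fun h => h⁻¹ • ∫ t in (0 : ℝ)..h, φ t) (𝓝[>] 0) (𝓝 f) := by
    have hφc : ContinuousWithinAt φ (Set.Ioi 0) 0 := by
      refine ContinuousWithinAt.smul (by fun_prop) ?_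
      exact ((hT.continuousOn_orbit f) 0 Set.self_mem_Ici).mono Set.Ioi_subset_Ici_self
    have h0 : HasDerivWithinAt (fun t => ∫ s in (0 : ℝ)..t, φ s) (φ 0) (Set.Ici 0) 0 := by
      refine intervalIntegral.integral_hasDerivWithinAt_right (by simp) (t := Set.Ioi 0) ?_ hφc
      exact ⟨Set.Ioi 0, self_mem_nhdsWithin, hint.aestronglyMeasurable⟩
    rw [hasDerivWithinAt_iff_tendsto_slope, Set.Ici_sdiff_left] at h0
    simpa [slope_fun_def, hφ, hT.zero_apply] using h0
  have hd3 : Tendsto (fun h => Real.exp (l * h)) (𝓝[>] 0) (𝓝 1) := by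
    have : Tendsto (fun h => Real.exp (l * h)) (𝓝 0) (𝓝 (Real.exp (l * 0))) :=
      Continuous.tendsto (by fun_prop) 0
    rw [mul_zero, Real.exp_zero] at this
    exact this.mono_left nhdsWithin_le_nhds
  have := (hd1.smul_const R).sub (hd3.smul hd2)
  rw [one_smul] at this
  refine Tendsto.congr' ?_ this
  filter_upwards [self_mem_nhdsWithin] with h hh
  rw [hshift h hh]
  module

theorem norm_laplace_le
    (hle : ∀ t, 0 ≤ t → ∀ x, ‖T t x‖ ≤ ‖x‖) {l : ℝ} (hl : 0 < l) (f : E) :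
    ‖∫ t in Set.Ioi (0 : ℝ), Real.exp (-(l * t)) • T t f‖ ≤ l⁻¹ * ‖f‖ := by
  have h1 : IntegrableOn (fun t => Real.exp (-l * t) * ‖f‖) (Set.Ioi 0) :=
    (integrableOn_exp_mul_Ioi (neg_lt_zero.2 hl) 0).mul_const _
  refine (norm_integral_le_of_norm_le h1 ?_).trans_eq ?_
  · filter_upwards [ae_restrict_mem measurableSet_Ioi] with t ht
    rw [norm_smul, Real.norm_of_nonneg (Real.exp_pos _).le, ← neg_mul]
    exact mul_le_mul_of_nonneg_left (hle t (le_of_lt ht) f) (Real.exp_pos _).le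
  · rw [integral_mul_const, integral_exp_mul_Ioi (neg_lt_zero.2 hl)]
    simp [neg_div_neg_eq]

/-- The resolvent of a contraction semigroup as a bounded operator. -/
theorem exists_resolvent [CompleteSpace E] (hT : IsC0Semigroup T)
    (hle : ∀ t, 0 ≤ t → ∀ x, ‖T t x‖ ≤ ‖x‖) {l : ℝ} (hl : 0 < l) :
    ∃ R : E →L[ℝ] E, (∀ f, R f = ∫ t in Set.Ioi (0 : ℝ), Real.exp (-(l * t)) • T t f) ∧
      (∀ f, (R f, l • R f - f) ∈ generatorGraph (fun t p => T t p)) ∧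
      ∀ f, ‖R f‖ ≤ l⁻¹ * ‖f‖ := by
  refine ⟨LinearMap.mkContinuous
    { toFun := fun f => ∫ t in Set.Ioi (0 : ℝ), Real.exp (-(l * t)) • T t f
      map_add' := fun f g => ?_
      map_smul' := fun c f => ?_ } l⁻¹ (norm_laplace_le hle hl), fun f => rfl,
    hT.resolvent_mem_generatorGraph hle hl, norm_laplace_le hle hl⟩
  · rw [← integral_add (hT.resolvent_integrableOn hle hl f) (hT.resolvent_integrableOn hle hl g)]
    exact integral_congr_ae (Eventually.of_forall fun t => by
      change Real.exp (-(l * t)) • T t (f + g) = _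
      rw [_root_.map_add, smul_add])
  · change ∫ t in Set.Ioi (0 : ℝ), Real.exp (-(l * t)) • T t (c • f) =
      c • ∫ t in Set.Ioi (0 : ℝ), Real.exp (-(l * t)) • T t f
    rw [← integral_smul]
    exact integral_congr_ae (Eventually.of_forall fun t => by
      change Real.exp (-(l * t)) • T t (c • f) = c • Real.exp (-(l * t)) • T t f
      rw [map_smul, smul_comm])

/-- The domain of the generator of a contraction semigroup is dense. -/
theorem dense_domain [CompleteSpace E] (hT : IsC0Semigroup T)
    (hle : ∀ t, 0 ≤ t → ∀ x, ‖T t x‖ ≤ ‖x‖) :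
    Dense {x : E | ∃ z, (x, z) ∈ generatorGraph (fun t p => T t p)} := by
  intro f
  -- The vectors `λ R(λ) f` lie in the domain. After the substitution `s = λ t` they are averages of
  -- `T (s / λ) f` against `exp (-s)`, so they tend to `f` by dominated convergence.
  have hlim : Tendsto (fun n : ℕ => (n + 1 : ℝ) •
      ∫ t in Set.Ioi (0 : ℝ), Real.exp (-((n + 1 : ℝ) * t)) • T t f) atTop (𝓝 f) := by
    have h1 : ∀ n : ℕ, (n + 1 : ℝ) • ∫ t in Set.Ioi (0 : ℝ), Real.exp (-((n + 1 : ℝ) * t)) • T t f =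
        ∫ s in Set.Ioi (0 : ℝ), Real.exp (-s) • T ((n + 1 : ℝ)⁻¹ * s) f := by
      intro n
      have hn : (0 : ℝ) < n + 1 := by positivity
      have h2 := integral_comp_mul_left_Ioi (fun s => Real.exp (-s) • T ((n + 1 : ℝ)⁻¹ * s) f) 0 hn
      simp only [mul_zero, inv_mul_cancel_left₀ hn.ne'] at h2
      rw [h2, smul_smul, mul_inv_cancel₀ hn.ne', one_smul]
    have h3 : ∫ s in Set.Ioi (0 : ℝ), Real.exp (-s) • f = f := by
      rw [integral_smul_const, integral_exp_neg_Ioi_zero, one_smul]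
    suffices h : Tendsto (fun n : ℕ => ∫ s in Set.Ioi (0 : ℝ), Real.exp (-s) •
        T ((n + 1 : ℝ)⁻¹ * s) f) atTop (𝓝 (∫ s in Set.Ioi (0 : ℝ), Real.exp (-s) • f)) by
      rw [h3] at h
      exact h.congr fun n => (h1 n).symm
    refine tendsto_integral_of_dominated_convergence (fun s => Real.exp (-s) * ‖f‖) ?_ ?_ ?_ ?_
    · intro n
      refine ContinuousOn.aestronglyMeasurable ?_ measurableSet_Ioi
      refine ContinuousOn.smul (by fun_prop) ?_
      refine (hT.continuousOn_orbit f).comp (by fun_prop) fun s hs => ?_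
      have : (0 : ℝ) < s := hs
      exact Set.mem_Ici.2 (by positivity)
    · have := (integrableOn_exp_mul_Ioi (a := -1) (by norm_num) 0).mul_const ‖f‖
      simp only [neg_one_mul] at this
      exact this
    · intro n
      filter_upwards [ae_restrict_mem measurableSet_Ioi] with s hs
      have : (0 : ℝ) < s := hs
      rw [norm_smul, Real.norm_of_nonneg (Real.exp_pos _).le]
      exact mul_le_mul_of_nonneg_left (hle _ (by positivity) f) (Real.exp_pos _).le
    · filter_upwards [ae_restrict_mem measurableSet_Ioi] with s hs
      have hs0 : (0 : ℝ) < s := hs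
      refine Tendsto.const_smul ?_ _
      have h4 : Tendsto (fun n : ℕ => ((n : ℝ) + 1)⁻¹ * s) atTop (𝓝[Set.Ici 0] 0) := by
        refine tendsto_nhdsWithin_iff.2 ⟨?_, Eventually.of_forall fun n => ?_⟩
        · have := (tendsto_one_div_add_atTop_nhds_zero_nat (𝕜 := ℝ)).mul_const s
          simpa using this
        · exact Set.mem_Ici.2 (by positivity)
      have h5 := (hT.continuousOn_orbit f 0 Set.self_mem_Ici).tendsto.comp h4
      rwa [hT.zero_apply] at h5
  refine mem_closure_of_tendsto hlim (Eventually.of_forall fun n => ?_)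
  have hn : (0 : ℝ) < n + 1 := by positivity
  have h6 := generatorGraph_smul_mem (n + 1 : ℝ) (hT.resolvent_mem_generatorGraph hle hn f)
  rw [Prod.smul_mk] at h6
  exact ⟨_, h6⟩

end IsC0Semigroup

end Resolvent

/-! ### The Hille–Yosida theorem for dissipative graphs -/

section HilleYosida

variable {E : Type*} [NormedAddCommGroup E] [NormedSpace ℝ E]

theorem seminorm_le_add_of_le {N : Seminorm ℝ E} {K : ℝ} (hK : ∀ x, N x ≤ K * ‖x‖) (x y : E) :
    N x ≤ N y + K * ‖x - y‖ := by
  have h := map_add_le_add N y (x - y)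
  rw [add_sub_cancel] at h
  linarith [hK (x - y)]

theorem hasDerivAt_exp_smul_apply [CompleteSpace E] (L : E →L[ℝ] E) (x : E) (t : ℝ) :
    HasDerivAt (fun s : ℝ => NormedSpace.exp (s • L) x) (L (NormedSpace.exp (t • L) x)) t := by
  have h := hasDerivAt_exp_smul_const' (𝕂 := ℝ) L t
  have h2 := h.clm_apply (hasDerivAt_const t x)
  simpa using h2

/-- The exponential of a dissipative bounded operator contracts the seminorm. -/
theorem seminorm_exp_le [CompleteSpace E] {N : Seminorm ℝ E} {K : ℝ} (hK : ∀ x, N x ≤ K * ‖x‖)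
    {L : E →L[ℝ] E} (hL : ∀ x, ∀ h : ℝ, 0 < h → N x ≤ N (x - h • L x)) {t : ℝ} (ht : 0 ≤ t)
    (x : E) : N (NormedSpace.exp (t • L) x) ≤ N x := by
  have hd := hasDerivAt_exp_smul_apply L x
  have hcont : Continuous fun s : ℝ => NormedSpace.exp (s • L) x :=
    continuous_iff_continuousAt.2 fun s => (hd s).continuousAt
  have := functional_le_of_dissipative_path (p := N) (seminorm_le_add_of_le hK)
    (u := fun s : ℝ => NormedSpace.exp (s • L) x)
    (u' := fun s : ℝ => L (NormedSpace.exp (s • L) x)) hcont.continuousOn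
    (fun s _ => (hd s).hasDerivWithinAt)
    (fun s _ => (L.continuous.comp hcont).continuousWithinAt)
    (fun s _ h hh => hL _ h hh) ht
  simpa using this

/-- The path `s ↦ exp ((t - s) L) exp (s L') x` joins the two exponentials, and by commutativity its
derivative contains only the difference `L' x - L x`. This compares two Yosida approximations. -/
theorem norm_exp_sub_exp_le [CompleteSpace E] {L L' : E →L[ℝ] E} (hcomm : Commute L L') {M : ℝ}
    (hL : ∀ t : ℝ, 0 ≤ t → ∀ x, ‖NormedSpace.exp (t • L) x‖ ≤ M * ‖x‖)
    (hL' : ∀ t : ℝ, 0 ≤ t → ∀ x, ‖NormedSpace.exp (t • L') x‖ ≤ M * ‖x‖)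
    (hM : 0 ≤ M) {t : ℝ} (ht : 0 ≤ t) (x : E) :
    ‖NormedSpace.exp (t • L') x - NormedSpace.exp (t • L) x‖ ≤ t * (M * (M * ‖L' x - L x‖)) := by
  set F : ℝ → E := fun s => NormedSpace.exp ((t - s) • L) (NormedSpace.exp (s • L') x) with hF
  have hF' : ∀ s, HasDerivAt F
      (NormedSpace.exp ((t - s) • L) (NormedSpace.exp (s • L') (L' x - L x))) s := by
    intro s
    have h1 : HasDerivAt (fun s : ℝ => NormedSpace.exp ((t - s) • L))
        (-(NormedSpace.exp ((t - s) • L) * L)) s := by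
      have := (hasDerivAt_exp_smul_const (𝕂 := ℝ) L (t - s)).scomp s
        ((hasDerivAt_id s).const_sub t)
      simpa [Function.comp_def] using this
    have h2 : HasDerivAt (fun s : ℝ => NormedSpace.exp (s • L') x)
        ((NormedSpace.exp (s • L') * L') x) s := by
      have := (hasDerivAt_exp_smul_const (𝕂 := ℝ) L' s).clm_apply (hasDerivAt_const s x)
      simpa using this
    have h3 := h1.clm_apply h2
    refine h3.congr_deriv ?_
    have h4 : L * NormedSpace.exp (s • L') = NormedSpace.exp (s • L') * L :=
      ((hcomm.smul_right s).exp_right).eq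
    have h5 : L (NormedSpace.exp (s • L') x) = NormedSpace.exp (s • L') (L x) :=
      congrArg (fun A : E →L[ℝ] E => A x) h4
    simp only [neg_apply, mul_apply_eq_comp, h5,
      _root_.map_sub]
    abel
  have := norm_image_sub_le_of_norm_deriv_le_segment' (a := 0) (b := t) (f := F)
    (C := M * (M * ‖L' x - L x‖)) (fun s _ => (hF' s).hasDerivWithinAt) (fun s hs => by
      refine (hL _ (by linarith [hs.2]) _).trans ?_
      exact mul_le_mul_of_nonneg_left (hL' s hs.1 _) hM) t ⟨ht, le_rfl⟩
  simp only [hF, sub_self, zero_smul, sub_zero, NormedSpace.exp_zero,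
    one_apply_eq_self] at this
  rw [mul_comm t]
  exact this

/-- **Hille–Yosida**, for an operator (given by its graph) that is dissipative for a seminorm
equivalent to the norm. -/
theorem exists_semigroup_of_dissipative [CompleteSpace E] {G : Set (E × E)}
    (hadd : ∀ p ∈ G, ∀ q ∈ G, p + q ∈ G) (hsmul : ∀ a : ℝ, ∀ p ∈ G, a • p ∈ G)
    {N : Seminorm ℝ E} {c K : ℝ} (hc : 0 < c) (hcN : ∀ x, c * ‖x‖ ≤ N x)
    (hK : ∀ x, N x ≤ K * ‖x‖)
    (hdiss : ∀ x z, (x, z) ∈ G → ∀ h : ℝ, 0 < h → N x ≤ N (x - h • z))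
    {l₀ : ℝ} (hl₀ : 0 < l₀) (hrange : ∀ l, l₀ ≤ l → ∀ f, ∃ x z, (x, z) ∈ G ∧ l • x - z = f)
    (hdense : Dense {x | ∃ z, (x, z) ∈ G}) :
    ∃ T : ℝ → E →L[ℝ] E, IsC0Semigroup T ∧ generatorGraph (fun t x => T t x) = G := by
  have hN0 : ∀ x, N x ≤ 0 → x = 0 := by
    intro x hx
    have := hcN x
    have h1 : ‖x‖ ≤ 0 := by
      by_contra h
      push Not at h
      have := mul_pos hc h
      linarith
    exact norm_le_zero_iff.1 h1
  -- Dissipativity with step `1 / l` is the resolvent estimate. It makes `l - G` injective, so the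
  -- range condition yields a bounded inverse.
  have hresN : ∀ l, 0 < l → ∀ x z, (x, z) ∈ G → l * N x ≤ N (l • x - z) := by
    intro l hl x z hxz
    have h1 := hdiss x z hxz l⁻¹ (inv_pos.2 hl)
    have h2 : l • x - z = l • (x - l⁻¹ • z) := by
      rw [smul_sub, smul_smul, mul_inv_cancel₀ hl.ne', one_smul]
    rw [h2, map_smul_eq_mul, Real.norm_of_nonneg hl.le]
    exact mul_le_mul_of_nonneg_left h1 hl.le
  have hK0 : ∀ x : E, 0 ≤ K * ‖x‖ := fun x => (apply_nonneg N x).trans (hK x)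
  have hR : ∀ l, l₀ ≤ l → ∃ R : E →L[ℝ] E, (∀ f, (R f, l • R f - f) ∈ G) ∧
      (∀ x z, (x, z) ∈ G → R (l • x - z) = x) ∧ ∀ f, l * N (R f) ≤ N f := by
    intro l hl
    have hlpos : 0 < l := hl₀.trans_le hl
    have hex : ∀ f, ∃ x, (x, l • x - f) ∈ G := by
      intro f
      obtain ⟨x, z, hxz, rfl⟩ := hrange l hl f
      exact ⟨x, by rwa [sub_sub_cancel]⟩
    have huniq : ∀ f x y, (x, l • x - f) ∈ G → (y, l • y - f) ∈ G → x = y := by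
      intro f x y hx hy
      have h1 := hadd _ hx _ (hsmul (-1) _ hy)
      rw [Prod.smul_mk, Prod.mk_add_mk] at h1
      have h2 := hresN l hlpos _ _ h1
      have h3 : l • (x + (-1 : ℝ) • y) - (l • x - f + (-1 : ℝ) • (l • y - f)) = 0 := by
        module
      rw [h3, map_zero] at h2
      have h4 := hN0 _ (nonpos_of_mul_nonpos_right h2 hlpos)
      rwa [neg_smul, one_smul, ← sub_eq_add_neg, sub_eq_zero] at h4
    choose r hr using hex
    have hrN : ∀ f, l * N (r f) ≤ N f := by
      intro f
      have := hresN l hlpos _ _ (hr f)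
      rwa [sub_sub_cancel] at this
    refine ⟨LinearMap.mkContinuous
      { toFun := r
        map_add' := fun f g => huniq (f + g) _ _ (hr _) ?_
        map_smul' := fun a f => huniq (a • f) _ _ (hr _) ?_ } ((l * c)⁻¹ * K) ?_, hr, ?_, hrN⟩
    · have := hadd _ (hr f) _ (hr g)
      rw [Prod.mk_add_mk] at this
      convert this using 2
      module
    · have := hsmul a _ (hr f)
      rw [Prod.smul_mk] at this
      rw [smul_sub, ← smul_comm l a] at this
      exact this
    · intro f
      have h1 := hcN (r f)
      have h2 : (l * c) * ‖r f‖ ≤ K * ‖f‖ := by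
        calc (l * c) * ‖r f‖ = l * (c * ‖r f‖) := by ring
          _ ≤ l * N (r f) := mul_le_mul_of_nonneg_left h1 hlpos.le
          _ ≤ K * ‖f‖ := (hrN f).trans (hK f)
      change ‖r f‖ ≤ _
      rw [mul_assoc, ← div_eq_inv_mul, le_div_iff₀' (by positivity)]
      exact h2
    · intro x z hxz
      refine huniq (l • x - z) _ _ (hr _) ?_
      rwa [sub_sub_cancel]
  choose! R hRG hRinv hRN using hR
  -- Yosida approximations
  set lam : ℕ → ℝ := fun n => l₀ + n with hlam
  have hlam1 : ∀ n, l₀ ≤ lam n := fun n => by simp [hlam]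
  have hlam0 : ∀ n, 0 < lam n := fun n => hl₀.trans_le (hlam1 n)
  have hlamtop : Tendsto lam atTop atTop :=
    tendsto_atTop_add_const_left _ _ tendsto_natCast_atTop_atTop
  set L : ℕ → E →L[ℝ] E := fun n => lam n • (lam n • R (lam n) - 1) with hL
  have hLapply : ∀ n x, L n x = lam n • (lam n • R (lam n) x - x) := fun n x => rfl
  have hLG : ∀ n x z, (x, z) ∈ G → L n x = lam n • R (lam n) z := by
    intro n x z hxz
    have h1 := hRinv _ (hlam1 n) x z hxz
    rw [_root_.map_sub, _root_.map_smul] at h1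
    rw [hLapply]
    congr 1
    nth_rewrite 2 [← h1]
    abel
  -- The resolvent identity, with the indices in both orders, gives commutation after cancelling
  -- `lam m - lam n`.
  have hcommR : ∀ n m, Commute (R (lam n)) (R (lam m)) := by
    have key : ∀ n m f, R (lam n) f - R (lam m) f =
        (lam m - lam n) • R (lam n) (R (lam m) f) := by
      intro n m f
      have h1 := hRinv _ (hlam1 n) _ _ (hRG _ (hlam1 m) f)
      have h2 : lam n • R (lam m) f - (lam m • R (lam m) f - f) =
          f - (lam m - lam n) • R (lam m) f := by module
      rw [h2, _root_.map_sub, _root_.map_smul] at h1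
      exact sub_eq_iff_eq_add.2 (by rw [add_comm]; exact (sub_eq_iff_eq_add.1 h1))
    intro n m
    rcases eq_or_ne (lam n) (lam m) with h | h
    · rw [h]
    · ext f
      have h1 := key n m f
      have h2 := key m n f
      have h3 : (lam m - lam n) • R (lam n) (R (lam m) f) =
          (lam m - lam n) • R (lam m) (R (lam n) f) := by
        rw [← h1, ← neg_sub (lam n) (lam m), neg_smul, ← h2, neg_sub]
      exact smul_right_injective E (sub_ne_zero.2 h.symm) h3
  have hcommL : ∀ n m, Commute (L n) (L m) := by
    intro n m
    have h1 : Commute (lam n • R (lam n) - 1) (lam m • R (lam m) - 1) :=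
      (((hcommR n m).smul_left (lam n)).smul_right (lam m) |>.sub_left (Commute.one_left _)).sub_right
        (Commute.one_right _)
    exact (h1.smul_left (lam n)).smul_right (lam m)
  -- Since `λ R(λ)` contracts `N`, the term `h λ N (λ R(λ) x)` is at most `h λ N x` and cancels
  -- against the left side of the triangle inequality for `(1 + h λ) x`.
  have hLdiss : ∀ n x, ∀ h : ℝ, 0 < h → N x ≤ N (x - h • L n x) := by
    intro n x h hh
    have hl := hlam0 n
    have h1 : (1 + h * lam n) • x = (x - h • L n x) + (h * lam n) • (lam n • R (lam n) x) := by
      rw [hLapply]; module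
    have h2 : N ((1 + h * lam n) • x) ≤ N (x - h • L n x) +
        N ((h * lam n) • (lam n • R (lam n) x)) := by
      rw [h1]; exact map_add_le_add N _ _
    rw [map_smul_eq_mul, map_smul_eq_mul, map_smul_eq_mul, Real.norm_of_nonneg (by positivity),
      Real.norm_of_nonneg (by positivity), Real.norm_of_nonneg hl.le] at h2
    have h3 := mul_le_mul_of_nonneg_left (hRN _ (hlam1 n) x) (mul_pos hh hl).le
    linarith
  set M : ℝ := c⁻¹ * |K| with hM
  have hM0 : 0 ≤ M := by positivity
  have hNM : ∀ x y, N x ≤ N y → ‖x‖ ≤ M * ‖y‖ := by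
    intro x y h
    rw [hM, mul_assoc, ← div_eq_inv_mul, le_div_iff₀' hc]
    exact (hcN x).trans (h.trans ((hK y).trans
      (mul_le_mul_of_nonneg_right (le_abs_self K) (norm_nonneg _))))
  set S : ℕ → ℝ → E →L[ℝ] E := fun n t => NormedSpace.exp (t • L n) with hS
  have hSN : ∀ n t, 0 ≤ t → ∀ x, N (S n t x) ≤ N x := fun n t ht x =>
    seminorm_exp_le hK (hLdiss n) ht x
  have hSM : ∀ n t, 0 ≤ t → ∀ x, ‖S n t x‖ ≤ M * ‖x‖ := fun n t ht x =>
    hNM _ _ (hSN n t ht x)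
  -- On the domain, `λ R(λ) y - y = R(λ) z` is of order `1 / λ`. Density and the uniform bound `M`
  -- extend the convergence to every vector.
  have hRlim : ∀ x, Tendsto (fun n => lam n • R (lam n) x) atTop (𝓝 x) := by
    have hbound : ∀ n x, ‖lam n • R (lam n) x‖ ≤ M * ‖x‖ := by
      intro n x
      refine hNM _ _ ?_
      rw [map_smul_eq_mul, Real.norm_of_nonneg (hlam0 n).le]
      exact hRN _ (hlam1 n) x
    intro x
    rw [Metric.tendsto_atTop]
    intro ε hε
    obtain ⟨y, hyx, z, hyz⟩ := Metric.dense_iff.1 hdense x (ε / (2 * (M + 1))) (by positivity)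
    rw [Metric.mem_ball, dist_comm, dist_eq_norm] at hyx
    have h1 : Tendsto (fun n => (lam n)⁻¹ * (M * ‖z‖)) atTop (𝓝 0) := by
      simpa using (tendsto_inv_atTop_zero.comp hlamtop).mul_const (M * ‖z‖)
    obtain ⟨n₀, hn₀⟩ := eventually_atTop.1 (h1.eventually (gt_mem_nhds (half_pos hε)))
    refine ⟨n₀, fun n hn => ?_⟩
    have h2 : lam n • R (lam n) y - y = R (lam n) z := by
      have h1 := hRinv _ (hlam1 n) y z hyz
      rw [_root_.map_sub, _root_.map_smul] at h1
      nth_rewrite 2 [← h1]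
      abel
    have h3 : lam n • R (lam n) x - x =
        lam n • R (lam n) (x - y) + R (lam n) z + (y - x) := by
      rw [← h2, _root_.map_sub, smul_sub]; abel
    have h4 : ‖R (lam n) z‖ ≤ (lam n)⁻¹ * (M * ‖z‖) := by
      have := hbound n z
      rw [norm_smul, Real.norm_of_nonneg (hlam0 n).le] at this
      rwa [← div_eq_inv_mul, le_div_iff₀' (hlam0 n)]
    have h5 := hbound n (x - y)
    have h6 : (M + 1) * ‖x - y‖ < ε / 2 := by
      have := mul_lt_mul_of_pos_left hyx (show 0 < M + 1 by positivity)
      have h7 : (M + 1) * (ε / (2 * (M + 1))) = ε / 2 := by field_simp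
      linarith
    have h8 := hn₀ n hn
    have h9 : ‖y - x‖ = ‖x - y‖ := norm_sub_rev _ _
    rw [dist_eq_norm, h3]
    refine (norm_add₃_le).trans_lt ?_
    linarith
  have hLlim : ∀ x z, (x, z) ∈ G → Tendsto (fun n => L n x) atTop (𝓝 z) := by
    intro x z hxz
    exact (hRlim z).congr fun n => (hLG n x z hxz).symm
  have hcauchy : ∀ t, 0 ≤ t → ∀ x, CauchySeq fun n => S n t x := by
    intro t ht x
    rw [Metric.cauchySeq_iff']
    intro ε hε
    obtain ⟨y, hyx, z, hyz⟩ := Metric.dense_iff.1 hdense x (ε / (4 * (M + 1))) (by positivity)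
    rw [Metric.mem_ball, dist_comm, dist_eq_norm] at hyx
    have h0 := (hLlim y z hyz).cauchySeq
    rw [Metric.cauchySeq_iff'] at h0
    obtain ⟨n₀, hn₀⟩ := h0 (ε / (2 * (t * (M * M) + 1))) (by positivity)
    refine ⟨n₀, fun n hn => ?_⟩
    have h1 := norm_exp_sub_exp_le (hcommL n₀ n) (hSM n₀) (hSM n) hM0 ht y
    have h2 := hn₀ n hn
    rw [dist_eq_norm] at h2
    have h3 : t * (M * (M * ‖L n y - L n₀ y‖)) ≤ ε / 2 := by
      have h4 : (t * (M * M) + 1) * (ε / (2 * (t * (M * M) + 1))) = ε / 2 := by field_simp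
      have h5 := mul_lt_mul_of_pos_left h2 (show 0 < t * (M * M) + 1 by positivity)
      rw [h4] at h5
      nlinarith [norm_nonneg (L n y - L n₀ y)]
    have h6 : S n t x - S n₀ t x = S n t (x - y) + (S n t y - S n₀ t y) + S n₀ t (y - x) := by
      simp only [_root_.map_sub]; abel
    have h7 : (M + 1) * ‖x - y‖ < ε / 4 := by
      have := mul_lt_mul_of_pos_left hyx (show 0 < M + 1 by positivity)
      have h7 : (M + 1) * (ε / (4 * (M + 1))) = ε / 4 := by field_simp
      linarith
    have h8 := hSM n t ht (x - y)
    have h9 := hSM n₀ t ht (y - x)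
    rw [norm_sub_rev y x] at h9
    rw [dist_eq_norm, h6]
    refine (norm_add₃_le).trans_lt ?_
    have h10 : ‖S n t y - S n₀ t y‖ ≤ ε / 2 := h1.trans h3
    nlinarith [norm_nonneg (x - y)]
  have hTex : ∀ t, ∃ T : E →L[ℝ] E, 0 ≤ t → ∀ x, Tendsto (fun n => S n t x) atTop (𝓝 (T x)) := by
    intro t
    by_cases ht : 0 ≤ t
    · choose f hf using fun x => cauchySeq_tendsto_of_complete (hcauchy t ht x)
      exact ⟨continuousLinearMapOfTendsto (fun n => S n t) (tendsto_pi_nhds.2 hf), fun _ => hf⟩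
    · exact ⟨0, fun h => absurd h ht⟩
  choose T hT using hTex
  have hNcont : Continuous N := 
    continuous_of_le_add_mul_norm (seminorm_le_add_of_le hK)
  have hTN : ∀ t, 0 ≤ t → ∀ x, N (T t x) ≤ N x := fun t ht x =>
    le_of_tendsto ((hNcont.tendsto _).comp (hT t ht x)) (Eventually.of_forall fun n => hSN n t ht x)
  have hTM : ∀ t, 0 ≤ t → ∀ x, ‖T t x‖ ≤ M * ‖x‖ := fun t ht x => hNM _ _ (hTN t ht x)
  have hSint : ∀ n t, 0 ≤ t → ∀ x, S n t x - x = ∫ s in (0 : ℝ)..t, S n s (L n x) := by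
    intro n t ht x
    have hd : ∀ s : ℝ, HasDerivAt (fun s => S n s x) (S n s (L n x)) s := by
      intro s
      have := (hasDerivAt_exp_smul_const (𝕂 := ℝ) (L n) s).clm_apply (hasDerivAt_const s x)
      simpa using this
    have hcont : Continuous fun s => S n s (L n x) :=
      continuous_iff_continuousAt.2 fun s =>
        (hasDerivAt_exp_smul_apply (L n) (L n x) s).continuousAt
    rw [intervalIntegral.integral_eq_sub_of_hasDerivAt (fun s _ => hd s)
      (hcont.intervalIntegrable _ _)]
    simp [hS]
  have hT0 : T 0 = ContinuousLinearMap.id ℝ E := by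
    ext x
    refine tendsto_nhds_unique (hT 0 le_rfl x) ?_
    simp [hS]
  have hTadd : ∀ s t : ℝ, 0 ≤ s → 0 ≤ t → T (s + t) = (T s).comp (T t) := by
    intro s t hs ht
    ext x
    refine tendsto_nhds_unique (hT (s + t) (add_nonneg hs ht) x) ?_
    have h1 : ∀ n, S n (s + t) x = S n s (S n t x - T t x) + S n s (T t x) := by
      intro n
      have h2 : S n (s + t) = S n s * S n t := by
        let _ : NormedAlgebra ℚ (E →L[ℝ] E) := NormedAlgebra.restrictScalars ℚ ℝ (E →L[ℝ] E)
        simp only [hS, add_smul]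
        exact NormedSpace.exp_add_of_commute
          (((Commute.refl (L n)).smul_left s).smul_right t)
      rw [h2, _root_.map_sub, sub_add_cancel]
      rfl
    have h2 : Tendsto (fun n => S n s (S n t x - T t x)) atTop (𝓝 0) := by
      refine squeeze_zero_norm (fun n => hSM n s hs _) ?_
      have := ((hT t ht x).sub_const (T t x)).norm.const_mul M
      simpa using this
    have h3 := h2.add (hT s hs (T t x))
    rw [zero_add] at h3
    exact h3.congr fun n => (h1 n).symm
  have hTC0 : IsC0Semigroup T := by
    refine isC0Semigroup_of_bounded hT0 hTadd hM0 hTM hdense ?_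
    rintro x ⟨z, hxz⟩
    have h1 : ∀ t, 0 ≤ t → ‖T t x - x‖ ≤ M * ‖z‖ * t := by
      intro t ht
      refine le_of_tendsto_of_tendsto ((hT t ht x).sub_const x).norm
        (((hLlim x z hxz).norm.const_mul M).mul_const t) (Eventually.of_forall fun n => ?_)
      change ‖S n t x - x‖ ≤ _
      rw [hSint n t ht x]
      refine (intervalIntegral.norm_integral_le_of_norm_le_const (C := M * ‖L n x‖) ?_).trans_eq ?_
      · intro s hs
        rw [Set.uIoc_of_le ht] at hs
        exact hSM n s hs.1.le _
      · rw [sub_zero, abs_of_nonneg ht]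
    rw [tendsto_iff_norm_sub_tendsto_zero]
    have h2 : Tendsto (fun t : ℝ => M * ‖z‖ * t) (𝓝[>] 0) (𝓝 0) := by
      have : Tendsto (fun t : ℝ => M * ‖z‖ * t) (𝓝 0) (𝓝 (M * ‖z‖ * 0)) :=
        Continuous.tendsto (by fun_prop) 0
      rw [mul_zero] at this
      exact this.mono_left nhdsWithin_le_nhds
    refine squeeze_zero' (Eventually.of_forall fun _ => norm_nonneg _) ?_ h2
    filter_upwards [self_mem_nhdsWithin] with t ht using h1 t (le_of_lt ht)
  -- The limit is taken in the integrated equation of the approximations, which characterises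
  -- membership in the generator.
  have hsub : ∀ x z, (x, z) ∈ G → (x, z) ∈ generatorGraph (fun t x => T t x) := by
    intro x z hxz
    refine hTC0.mem_generatorGraph_of_sub_eq_integral fun t ht => ?_
    obtain ⟨B, hB⟩ := (hLlim x z hxz).norm.bddAbove_range
    refine tendsto_nhds_unique ((hT t ht x).sub_const x) ?_
    simp only [hSint _ t ht x]
    refine intervalIntegral.tendsto_integral_filter_of_dominated_convergence (fun _ => M * B)
      (Eventually.of_forall fun n => ?_) (Eventually.of_forall fun n => ?_) (by simp) ?_
    · exact (continuous_iff_continuousAt.2 fun s =>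
        (hasDerivAt_exp_smul_apply (L n) (L n x) s).continuousAt).aestronglyMeasurable
    · refine Eventually.of_forall fun s hs => ?_
      rw [Set.uIoc_of_le ht] at hs
      exact (hSM n s hs.1.le _).trans
        (mul_le_mul_of_nonneg_left (hB (Set.mem_range_self n)) hM0)
    · refine Eventually.of_forall fun s hs => ?_
      rw [Set.uIoc_of_le ht] at hs
      have h1 : Tendsto (fun n => S n s (L n x - z)) atTop (𝓝 0) := by
        refine squeeze_zero_norm (fun n => hSM n s hs.1.le _) ?_
        have := ((hLlim x z hxz).sub_const z).norm.const_mul M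
        simpa using this
      have h2 := h1.add (hT s hs.1.le z)
      rw [zero_add] at h2
      refine h2.congr fun n => ?_
      rw [_root_.map_sub, sub_add_cancel]
  refine ⟨T, hTC0, Set.Subset.antisymm ?_ fun ⟨x, z⟩ hxz => hsub x z hxz⟩
  rintro ⟨x, z⟩ hxz
  -- Maximality of `G`: surjectivity of `l₀ - G` supplies a point of `G` with the same image as `(x,
  -- z)`. The difference `y` satisfies `A y = l₀ y` for the generator `A` of `T`, and as `T`
  -- contracts `N` while `l₀ > 0`, it vanishes.
  obtain ⟨x', z', hx', hxz'⟩ := hrange l₀ le_rfl (l₀ • x - z)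
  have hy := generatorGraph_add_mem hxz (generatorGraph_smul_mem (-1) (hsub x' z' hx'))
  have hyz : z + (-1 : ℝ) • z' = l₀ • (x + (-1 : ℝ) • x') := by
    have : z' = l₀ • x' - (l₀ • x - z) := by rw [← hxz']; abel
    rw [this]; module
  rw [Prod.smul_mk, Prod.mk_add_mk, hyz] at hy
  set y : E := x + (-1 : ℝ) • x' with hydef
  have hy0 : y = 0 := by
    have h1 : Tendsto (fun t : ℝ => K * ‖t⁻¹ • (T t y - y) - l₀ • y‖) (𝓝[>] 0) (𝓝 0) := by
      have := (Tendsto.sub_const hy (l₀ • y)).norm.const_mul K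
      simpa using this
    refine hN0 y ?_
    have h2 : l₀ * N y ≤ 0 := by
      refine ge_of_tendsto h1 ?_
      filter_upwards [self_mem_nhdsWithin] with t ht
      have ht0 : (0 : ℝ) < t := ht
      have h3 := seminorm_le_add_of_le hK ((1 + t * l₀) • y) (T t y)
      have h4 : (1 + t * l₀) • y - T t y = -(t • (t⁻¹ • (T t y - y) - l₀ • y)) := by
        rw [smul_sub, smul_smul, mul_inv_cancel₀ ht0.ne']; module
      rw [h4, norm_neg, norm_smul, map_smul_eq_mul, Real.norm_of_nonneg (by positivity),
        Real.norm_of_nonneg ht0.le] at h3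
      have h5 := hTN t ht0.le y
      have h6 : t * (l₀ * N y) ≤ t * (K * ‖t⁻¹ • (T t y - y) - l₀ • y‖) := by linarith
      exact le_of_mul_le_mul_left h6 ht0
    exact nonpos_of_mul_nonpos_right h2 hl₀
  have hxx : x = x' := by
    rw [hydef, neg_smul, one_smul, ← sub_eq_add_neg, sub_eq_zero] at hy0
    exact hy0
  subst hxx
  rwa [generatorGraph_unique hxz (hsub _ _ hx')]

end HilleYosida

/-! ### The flow of the velocity field -/

section Flow

/-- A bounded Lipschitz vector field has global integral curves. -/
theorem exists_global_integralCurve {F : Type*} [NormedAddCommGroup F] [NormedSpace ℝ F]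
    [CompleteSpace F] {C : F → F} {K L : NNReal} (hK : LipschitzWith K C) (hL : ∀ x, ‖C x‖ ≤ L)
    (z : F) : ∃ c : ℝ → F, c 0 = z ∧ ∀ s, HasDerivAt c (C (c s)) s := by
  have hloc : ∀ n : ℕ, ∃ c : ℝ → F, c 0 = z ∧
      ∀ s ∈ Set.Ioo (-(n + 1 : ℝ)) (n + 1), HasDerivAt c (C (c s)) s := by
    intro n
    have hmem : (0 : ℝ) ∈ Set.Icc (-(n + 1 : ℝ)) (n + 1) := by
      constructor <;> linarith [n.cast_nonneg (α := ℝ)]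
    -- As `‖C‖ ≤ L` everywhere, a ball of radius `L (n + 1)` cannot be left within time `n + 1`;
    -- hence Picard–Lindelöf applies on intervals of any length.
    have hpl : IsPicardLindelof (fun _ => C) (⟨0, hmem⟩ : Set.Icc (-(n + 1 : ℝ)) (n + 1)) z
        (L * (n + 1)) 0 L K := by
      refine IsPicardLindelof.of_time_independent (fun x _ => hL x) hK.lipschitzOnWith ?_
      simp
    obtain ⟨c, hc0, hc⟩ := hpl.exists_eq_forall_mem_Icc_hasDerivWithinAt₀
    exact ⟨c, hc0, fun s hs => (hc s (Set.Ioo_subset_Icc_self hs)).hasDerivAt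
      (Icc_mem_nhds hs.1 hs.2)⟩
  choose a ha0 ha using hloc
  have hmono : ∀ m n : ℕ, m ≤ n → ∀ s ∈ Set.Ioo (-(m + 1 : ℝ)) (m + 1), a m s = a n s := by
    intro m n hmn
    have hmn' : (m : ℝ) ≤ n := Nat.cast_le.2 hmn
    refine ODE_solution_unique_of_mem_Ioo (v := fun _ => C) (s := fun _ => Set.univ) (K := K)
      (t₀ := 0) (fun t _ => hK.lipschitzOnWith) ?_
      (fun t ht => ⟨ha m t ht, trivial⟩) (fun t ht => ⟨ha n t ?_, trivial⟩) ?_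
    · constructor <;> linarith [m.cast_nonneg (α := ℝ)]
    · exact ⟨by linarith [ht.1], by linarith [ht.2]⟩
    · rw [ha0, ha0]
  have hfl : ∀ s : ℝ, s ∈ Set.Ioo (-((⌊|s|⌋₊ : ℝ) + 1)) ((⌊|s|⌋₊ : ℝ) + 1) := fun s =>
    abs_lt.1 (Nat.lt_floor_add_one |s|)
  -- The index depends on `t`, but with `m = ⌊|t|⌋₊ + 1` the glued curve agrees with the single
  -- local solution `a m` near `t`.
  refine ⟨fun t => a ⌊|t|⌋₊ t, ha0 _, fun t => ?_⟩
  set m : ℕ := ⌊|t|⌋₊ + 1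
  have ht : t ∈ Set.Ioo (-(m : ℝ)) m := by
    have := hfl t
    simpa [m] using this
  have hev : (fun t => a ⌊|t|⌋₊ t) =ᶠ[𝓝 t] a m := by
    filter_upwards [Ioo_mem_nhds ht.1 ht.2] with s hs
    refine hmono _ _ ?_ s (hfl s)
    have h1 : |s| < m := abs_lt.2 hs
    exact ((Nat.floor_lt (abs_nonneg s)).2 h1).le
  have h2 : a ⌊|t|⌋₊ t = a m t := hev.eq_of_nhds
  have h3 := ha m t ⟨by linarith [ht.1], by linarith [ht.2]⟩
  beta_reduce
  rw [h2]
  exact h3.congr_of_eventuallyEq hev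

theorem plane_eq_sum (v : Plane) :
    v = v 0 • EuclideanSpace.single (0 : Fin 2) (1 : ℝ) +
      v 1 • EuclideanSpace.single (1 : Fin 2) (1 : ℝ) := by
  ext i
  fin_cases i <;> simp

theorem abs_coord_le_norm (v : Plane) (i : Fin 2) : |v i| ≤ ‖v‖ := by
  simpa using PiLp.norm_apply_le v i

theorem norm_clm_le_of_single {L : Plane →L[ℝ] Plane} {a b : ℝ}
    (ha : ‖L (EuclideanSpace.single 0 1)‖ ≤ a) (hb : ‖L (EuclideanSpace.single 1 1)‖ ≤ b) :
    ‖L‖ ≤ a + b := by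
  have ha0 := (norm_nonneg _).trans ha
  have hb0 := (norm_nonneg _).trans hb
  refine L.opNorm_le_bound (by positivity) fun v => ?_
  conv_lhs => rw [plane_eq_sum v]
  rw [map_add, map_smul, map_smul]
  refine (norm_add_le _ _).trans ?_
  rw [norm_smul, norm_smul, Real.norm_eq_abs, Real.norm_eq_abs, add_mul, mul_comm a, mul_comm b]
  exact add_le_add (mul_le_mul (abs_coord_le_norm v 0) ha (norm_nonneg _) (norm_nonneg _))
    (mul_le_mul (abs_coord_le_norm v 1) hb (norm_nonneg _) (norm_nonneg _))

namespace IsVelocityField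

variable {C : Plane → Plane}

theorem neg (hC : IsVelocityField C) : IsVelocityField (fun x => -C x) where
  uniformContinuous := hC.uniformContinuous.neg
  bounded := by simpa using hC.bounded
  contDiff := hC.contDiff.neg
  partial_bounded i := by simpa [fderiv_fun_neg] using hC.partial_bounded i
  partial_uniformContinuous i := by
    simpa [fderiv_fun_neg] using (hC.partial_uniformContinuous i).neg

/-- The normalisation `1 ≤ K` keeps the Gronwall bounds with divisor `K` away from the degenerate
case `K = 0`. -/
theorem exists_norm_fderiv_le (hC : IsVelocityField C) :
    ∃ K : NNReal, 1 ≤ K ∧ ∀ x, ‖fderiv ℝ C x‖ ≤ K := by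
  obtain ⟨a, ha⟩ := hC.partial_bounded 0
  obtain ⟨b, hb⟩ := hC.partial_bounded 1
  refine ⟨max 1 (a + b).toNNReal, le_max_left _ _, fun x => ?_⟩
  refine (norm_clm_le_of_single (ha x) (hb x)).trans ((Real.le_coe_toNNReal _).trans ?_)
  exact_mod_cast le_max_right _ _

theorem lipschitzWith (hC : IsVelocityField C) {K : NNReal} (hK : ∀ x, ‖fderiv ℝ C x‖ ≤ K) :
    LipschitzWith K C :=
  lipschitzWith_of_nnnorm_fderiv_le (𝕜 := ℝ) (hC.contDiff.differentiable one_ne_zero)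
    fun x => by exact_mod_cast hK x

theorem continuous_fderiv (hC : IsVelocityField C) : Continuous (fderiv ℝ C) :=
  hC.contDiff.continuous_fderiv one_ne_zero

theorem continuous_divergence (hC : IsVelocityField C) : Continuous (divergence C) := by
  have := hC.continuous_fderiv
  unfold divergence
  fun_prop

theorem exists_abs_divergence_le (hC : IsVelocityField C) :
    ∃ M : ℝ, 0 ≤ M ∧ ∀ x, |divergence C x| ≤ M := by
  obtain ⟨K, hK1, hK⟩ := hC.exists_norm_fderiv_le
  refine ⟨K + K, by positivity, fun x => ?_⟩
  have h : ∀ i : Fin 2, |fderiv ℝ C x (EuclideanSpace.single i 1) i| ≤ K := fun i => by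
    refine (abs_coord_le_norm _ i).trans (((fderiv ℝ C x).le_opNorm _).trans ?_)
    simpa using hK x
  rw [divergence, Fin.sum_univ_two]
  exact (abs_add_le _ _).trans (add_le_add (h 0) (h 1))

/-- Uniform first order Taylor estimate. -/
theorem taylor_uniform (hC : IsVelocityField C) {η : ℝ} (hη : 0 < η) :
    ∃ δ > 0, ∀ x y, ‖y - x‖ < δ → ‖C y - C x - fderiv ℝ C x (y - x)‖ ≤ η * ‖y - x‖ := by
  obtain ⟨δ₀, hδ₀, h0⟩ := Metric.uniformContinuous_iff.1 (hC.partial_uniformContinuous 0)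
    (η / 2) (by positivity)
  obtain ⟨δ₁, hδ₁, h1⟩ := Metric.uniformContinuous_iff.1 (hC.partial_uniformContinuous 1)
    (η / 2) (by positivity)
  refine ⟨min δ₀ δ₁, by positivity, fun x y hxy => ?_⟩
  refine Convex.norm_image_sub_le_of_norm_fderiv_le' (𝕜 := ℝ) (s := Metric.ball x (min δ₀ δ₁))
    (fun w _ => hC.contDiff.differentiable one_ne_zero w) (fun w hw => ?_) (convex_ball _ _)
    (Metric.mem_ball_self (by positivity)) (by rwa [Metric.mem_ball, dist_eq_norm])
  rw [Metric.mem_ball] at hw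
  rw [← add_halves η]
  refine norm_clm_le_of_single ?_ ?_
  · have := h0 (hw.trans_le (min_le_left _ _))
    rw [dist_eq_norm] at this
    exact this.le
  · have := h1 (hw.trans_le (min_le_right _ _))
    rw [dist_eq_norm] at this
    exact this.le

theorem exists_integralCurve (hC : IsVelocityField C) (z : Plane) :
    ∃ c : ℝ → Plane, c 0 = z ∧ ∀ s, HasDerivAt c (C (c s)) s := by
  obtain ⟨K, -, hK⟩ := hC.exists_norm_fderiv_le
  obtain ⟨M, hM⟩ := hC.bounded
  exact exists_global_integralCurve (hC.lipschitzWith hK)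
    (L := M.toNNReal) (fun x => (hM x).trans (Real.le_coe_toNNReal M)) z

theorem flow_zero (hC : IsVelocityField C) (z : Plane) : flow C 0 z = z := by
  rw [flow, dif_pos (hC.exists_integralCurve z)]
  exact (hC.exists_integralCurve z).choose_spec.1

theorem hasDerivAt_flow (hC : IsVelocityField C) (z : Plane) (t : ℝ) :
    HasDerivAt (fun s => flow C s z) (C (flow C t z)) t := by
  have h := (hC.exists_integralCurve z).choose_spec.2 t
  have h2 : (fun s => flow C s z) = (hC.exists_integralCurve z).choose := by
    funext s
    rw [flow, dif_pos (hC.exists_integralCurve z)]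
  rw [h2, flow, dif_pos (hC.exists_integralCurve z)]
  exact h

/-- ODE uniqueness removes the choice in `flow`. The group law and time reversal then follow by
exhibiting an integral curve. -/
theorem eq_flow (hC : IsVelocityField C) {c : ℝ → Plane}
    (hc : ∀ s, HasDerivAt c (C (c s)) s) (t : ℝ) : c t = flow C t (c 0) := by
  obtain ⟨K, -, hK⟩ := hC.exists_norm_fderiv_le
  have := ODE_solution_unique_univ (v := fun _ => C) (s := fun _ => Set.univ) (K := K) (t₀ := 0)
    (fun t => (hC.lipschitzWith hK).lipschitzOnWith) (fun t => ⟨hc t, trivial⟩)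
    (fun t => ⟨hC.hasDerivAt_flow (c 0) t, trivial⟩) (hC.flow_zero _).symm
  exact congrFun this t

theorem flow_add (hC : IsVelocityField C) (s t : ℝ) (z : Plane) :
    flow C (s + t) z = flow C s (flow C t z) := by
  have h := hC.eq_flow (c := fun s => flow C (s + t) z)
    (fun s => (hC.hasDerivAt_flow z (s + t)).comp_add_const s t) s
  simpa using h

theorem flow_neg (hC : IsVelocityField C) (t : ℝ) (z : Plane) :
    flow (fun x => -C x) t z = flow C (-t) z := by
  have h := hC.neg.eq_flow (c := fun s => flow C (-s) z) (fun s => by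
    have := (hC.hasDerivAt_flow z (-s)).scomp s (hasDerivAt_neg s)
    simpa [Function.comp_def] using this) t
  simpa [hC.flow_zero] using h.symm

theorem flow_neg_flow (hC : IsVelocityField C) (t : ℝ) (z : Plane) :
    flow C (-t) (flow C t z) = z := by
  rw [← hC.flow_add, neg_add_cancel, hC.flow_zero]

theorem flow_flow_neg (hC : IsVelocityField C) (t : ℝ) (z : Plane) :
    flow C t (flow C (-t) z) = z := by
  rw [← hC.flow_add, add_neg_cancel, hC.flow_zero]

theorem dist_flow_time_le (hC : IsVelocityField C) {M : ℝ} (hM : ∀ x, ‖C x‖ ≤ M) (s t : ℝ)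
    (z : Plane) : ‖flow C t z - flow C s z‖ ≤ M * |t - s| :=
  Convex.norm_image_sub_le_of_norm_hasDerivWithin_le (s := Set.univ)
    (fun r _ => (hC.hasDerivAt_flow z r).hasDerivWithinAt) (fun _ _ => hM _) convex_univ
    trivial trivial

theorem norm_flow_sub_le (hC : IsVelocityField C) {K : NNReal} (hK : ∀ x, ‖fderiv ℝ C x‖ ≤ K)
    {t : ℝ} (ht : 0 ≤ t) (x y : Plane) :
    ‖flow C t x - flow C t y‖ ≤ ‖x - y‖ * Real.exp (K * t) := by
  have := dist_le_of_trajectories_ODE (v := fun _ => C) (K := K) (a := 0) (b := t)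
    (f := fun s => flow C s x) (g := fun s => flow C s y) (δ := dist x y)
    (fun _ => hC.lipschitzWith hK)
    (fun s _ => (hC.hasDerivAt_flow x s).continuousAt.continuousWithinAt)
    (fun s _ => (hC.hasDerivAt_flow x s).hasDerivWithinAt)
    (fun s _ => (hC.hasDerivAt_flow y s).continuousAt.continuousWithinAt)
    (fun s _ => (hC.hasDerivAt_flow y s).hasDerivWithinAt)
    (by rw [hC.flow_zero, hC.flow_zero]) t ⟨ht, le_rfl⟩
  simpa [dist_eq_norm] using this

theorem norm_flow_sub_le_abs (hC : IsVelocityField C) {K : NNReal}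
    (hK : ∀ x, ‖fderiv ℝ C x‖ ≤ K) (t : ℝ) (x y : Plane) :
    ‖flow C t x - flow C t y‖ ≤ ‖x - y‖ * Real.exp (K * |t|) := by
  rcases le_total 0 t with ht | ht
  · rw [abs_of_nonneg ht]; exact hC.norm_flow_sub_le hK ht x y
  · rw [abs_of_nonpos ht]
    have := hC.neg.norm_flow_sub_le (K := K) (fun x => by simpa [fderiv_fun_neg] using hK x)
      (neg_nonneg.2 ht) x y
    simpa [hC.flow_neg] using this

theorem continuous_flow (hC : IsVelocityField C) :
    Continuous fun p : ℝ × Plane => flow C p.1 p.2 := by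
  obtain ⟨K, -, hK⟩ := hC.exists_norm_fderiv_le
  obtain ⟨M, hM⟩ := hC.bounded
  refine continuous_iff_continuousAt.2 fun ⟨s, y⟩ => ?_
  rw [ContinuousAt, tendsto_iff_norm_sub_tendsto_zero]
  have hb : Tendsto (fun p : ℝ × Plane => M * |p.1 - s| + ‖p.2 - y‖ * Real.exp (K * |s|))
      (𝓝 (s, y)) (𝓝 0) := by
    have : Tendsto (fun p : ℝ × Plane => M * |p.1 - s| + ‖p.2 - y‖ * Real.exp (K * |s|))
      (𝓝 (s, y)) (𝓝 (M * |s - s| + ‖y - y‖ * Real.exp (K * |s|))) :=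
      Continuous.tendsto (by fun_prop) (s, y)
    simpa using this
  refine squeeze_zero (fun _ => norm_nonneg _) (fun p => ?_) hb
  have h : flow C p.1 p.2 - flow C s y =
      (flow C p.1 p.2 - flow C s p.2) + (flow C s p.2 - flow C s y) := by abel
  rw [h]
  exact (norm_add_le _ _).trans
    (add_le_add (hC.dist_flow_time_le hM s p.1 p.2) (hC.norm_flow_sub_le_abs hK s p.2 y))

end IsVelocityField

end Flow

/-! ### Differentiability of the flow and Liouville's formula -/

section FlowJacobian

theorem det_clm_plane (L : Plane →L[ℝ] Plane) :
    L.det = L (EuclideanSpace.single 0 1) 0 * L (EuclideanSpace.single 1 1) 1 -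
      L (EuclideanSpace.single 1 1) 0 * L (EuclideanSpace.single 0 1) 1 := by
  have h := LinearMap.det_toMatrix (EuclideanSpace.basisFun (Fin 2) ℝ).toBasis (L : Plane →ₗ[ℝ] Plane)
  rw [ContinuousLinearMap.det, ← h, Matrix.det_fin_two]
  simp [LinearMap.toMatrix_apply]

/-- Liouville's formula: the determinant of a solution of `Φ' = A Φ`. -/
theorem hasDerivWithinAt_det {A : Plane →L[ℝ] Plane} {Φ : ℝ → Plane →L[ℝ] Plane} {s : Set ℝ}
    {t : ℝ} (h : HasDerivWithinAt Φ (A.comp (Φ t)) s t) :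
    HasDerivWithinAt (fun r => (Φ r).det)
      ((∑ i : Fin 2, A (EuclideanSpace.single i 1) i) * (Φ t).det) s t := by
  have hentry : ∀ i j : Fin 2, HasDerivWithinAt (fun r => Φ r (EuclideanSpace.single j 1) i)
      (A (Φ t (EuclideanSpace.single j 1)) i) s t := by
    intro i j
    have h1 := h.clm_apply (hasDerivWithinAt_const t s (EuclideanSpace.single j (1 : ℝ)))
    have h2 := (EuclideanSpace.proj (𝕜 := ℝ) i).hasFDerivAt.comp_hasDerivWithinAt t h1
    refine h2.congr_deriv ?_
    simp
  have hA : ∀ i j : Fin 2, A (Φ t (EuclideanSpace.single j 1)) i =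
      Φ t (EuclideanSpace.single j 1) 0 * A (EuclideanSpace.single 0 1) i +
      Φ t (EuclideanSpace.single j 1) 1 * A (EuclideanSpace.single 1 1) i := by
    intro i j
    conv_lhs => rw [plane_eq_sum (Φ t (EuclideanSpace.single j 1)), map_add, map_smul, map_smul]
    simp
  simp only [det_clm_plane]
  refine (((hentry 0 0).mul (hentry 1 1)).sub ((hentry 0 1).mul (hentry 1 0))).congr_deriv ?_
  simp only [hA, Fin.sum_univ_two]
  ring

/-- The time restriction comes from Picard–Lindelöf on the unit ball around the identity: there `‖Φ‖
≤ 2`, so the field is bounded by `2 K`, and `2 K τ ≤ 1` keeps the solution in the ball. -/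
theorem exists_linear_ode_solution {A : ℝ → Plane →L[ℝ] Plane} (hA : Continuous A) {K : NNReal}
    (hK : ∀ s, ‖A s‖ ≤ K) {τ : ℝ} (hτ : 0 ≤ τ) (hKτ : 2 * K * τ ≤ 1) :
    ∃ Φ : ℝ → Plane →L[ℝ] Plane, Φ 0 = ContinuousLinearMap.id ℝ Plane ∧
      ∀ s ∈ Set.Icc 0 τ, HasDerivWithinAt Φ ((A s).comp (Φ s)) (Set.Icc 0 τ) s := by
  have hpl : IsPicardLindelof (fun s (Φ : Plane →L[ℝ] Plane) => (A s).comp Φ)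
      (⟨0, Set.left_mem_Icc.2 hτ⟩ : Set.Icc (0 : ℝ) τ) (ContinuousLinearMap.id ℝ Plane)
      1 0 (2 * K) K := by
    refine ⟨fun s _ => ?_, fun Φ _ => by fun_prop, fun s _ Φ hΦ => ?_, ?_⟩
    · refine (LipschitzWith.of_dist_le_mul fun Φ Ψ => ?_).lipschitzOnWith
      rw [dist_eq_norm, dist_eq_norm, ← ContinuousLinearMap.comp_sub]
      exact (ContinuousLinearMap.opNorm_comp_le _ _).trans
        (mul_le_mul_of_nonneg_right (hK s) (norm_nonneg _))
    · rw [Metric.mem_closedBall, dist_eq_norm] at hΦ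
      have h1 : ‖Φ‖ ≤ 2 := by
        have h2 := norm_add_le (Φ - ContinuousLinearMap.id ℝ Plane) (ContinuousLinearMap.id ℝ Plane)
        rw [sub_add_cancel] at h2
        have h3 := ContinuousLinearMap.norm_id_le (𝕜 := ℝ) (E := Plane)
        simp only [NNReal.coe_one] at hΦ
        linarith
      refine (ContinuousLinearMap.opNorm_comp_le _ _).trans ?_
      push_cast
      rw [mul_comm]
      exact mul_le_mul h1 (hK s) (norm_nonneg _) (by norm_num)
    · simpa [hτ] using hKτ
  exact hpl.exists_eq_forall_mem_Icc_hasDerivWithinAt₀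

theorem hasDerivWithinAt_Ici_of_Icc {F : Type*} [NormedAddCommGroup F] [NormedSpace ℝ F]
    {f : ℝ → F} {f' : F} {a b t : ℝ} (h : HasDerivWithinAt f f' (Set.Icc a b) t)
    (ht : t ∈ Set.Ico a b) : HasDerivWithinAt f f' (Set.Ici t) t :=
  h.mono_of_mem_nhdsWithin (mem_of_superset (Icc_mem_nhdsGE ht.2) (Set.Icc_subset_Icc_left ht.1))

namespace IsVelocityField

variable {C : Plane → Plane}

/-- The flow is differentiable at time `t` with the Jacobian determinant given by Liouville. -/
def HasFlowJacobian (C : Plane → Plane) (t : ℝ) : Prop :=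
  ∀ x, ∃ D : Plane →L[ℝ] Plane, HasFDerivAt (flow C t) D x ∧
    D.det = Real.exp (∫ s in (0 : ℝ)..t, divergence C (flow C s x))

theorem continuous_divergence_flow (hC : IsVelocityField C) :
    Continuous fun p : ℝ × Plane => divergence C (flow C p.1 p.2) :=
  hC.continuous_divergence.comp hC.continuous_flow

theorem continuous_divergence_flow_time (hC : IsVelocityField C) (x : Plane) :
    Continuous fun s : ℝ => divergence C (flow C s x) :=
  hC.continuous_divergence_flow.comp (by fun_prop : Continuous fun s : ℝ => (s, x))

/-- The derivative is the solution `Φ` of the variational equation along the orbit. The remainder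
`flow (x + k) - flow x - Φ k` satisfies that equation up to a Taylor error that `taylor_uniform`
makes small relative to `‖k‖`, and Gronwall's inequality concludes. Liouville's formula then gives
the determinant. -/
theorem hasFlowJacobian_of_small (hC : IsVelocityField C) {K : NNReal} (hK1 : 1 ≤ K)
    (hK : ∀ x, ‖fderiv ℝ C x‖ ≤ K) {τ : ℝ} (hτ : 0 ≤ τ) (hKτ : 2 * K * τ ≤ 1) :
    HasFlowJacobian C τ := by
  intro x
  have hflx : Continuous fun s : ℝ => flow C s x :=
    hC.continuous_flow.comp (by fun_prop : Continuous fun s : ℝ => (s, x))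
  obtain ⟨Φ, hΦ0, hΦ⟩ := exists_linear_ode_solution (A := fun s => fderiv ℝ C (flow C s x))
    (hC.continuous_fderiv.comp hflx) (fun s => hK _) hτ hKτ
  have hKpos : (0 : ℝ) < K := by
    have : (1 : ℝ) ≤ K := by exact_mod_cast hK1
    linarith
  have hΦc : ContinuousOn Φ (Set.Icc 0 τ) := fun s hs => (hΦ s hs).continuousWithinAt
  refine ⟨Φ τ, ?_, ?_⟩
  · rw [hasFDerivAt_iff_isLittleO_nhds_zero, Asymptotics.isLittleO_iff]
    intro c hc
    -- `Q - 1` is the factor by which Gronwall's inequality amplifies the relative Taylor error, so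
    -- an error of `c / Q` leads to at most `c * ‖k‖`. The added 1 makes `Q` positive even when `τ =
    -- 0`.
    set Q : ℝ := Real.exp (K * τ) * ((Real.exp (K * τ) - 1) / K) + 1 with hQ
    have hexp : 1 ≤ Real.exp (K * τ) := Real.one_le_exp (by positivity)
    have hQ0 : 0 < Q := by
      have : 0 ≤ (Real.exp (K * τ) - 1) / K := div_nonneg (by linarith) hKpos.le
      positivity
    obtain ⟨δ, hδ, htay⟩ := hC.taylor_uniform (η := c / Q) (by positivity)
    have hnear : ∀ᶠ k : Plane in 𝓝 0, ‖k‖ * Real.exp (K * τ) < δ := by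
      have : Tendsto (fun k : Plane => ‖k‖ * Real.exp (K * τ)) (𝓝 0)
          (𝓝 (‖(0 : Plane)‖ * Real.exp (K * τ))) := Continuous.tendsto (by fun_prop) 0
      rw [norm_zero, zero_mul] at this
      exact this.eventually (gt_mem_nhds hδ)
    filter_upwards [hnear] with k hk
    have hΔ : ∀ s ∈ Set.Ico 0 τ, ‖flow C s (x + k) - flow C s x‖ ≤ ‖k‖ * Real.exp (K * τ) := by
      intro s hs
      have := hC.norm_flow_sub_le hK hs.1 (x + k) x
      rw [add_sub_cancel_left] at this
      refine this.trans ?_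
      have h2 := hs.2.le
      gcongr
    have hgr := norm_le_gronwallBound_of_norm_deriv_right_le
      (f := fun s => flow C s (x + k) - flow C s x - Φ s k)
      (f' := fun s => C (flow C s (x + k)) - C (flow C s x) - fderiv ℝ C (flow C s x) (Φ s k))
      (δ := 0) (K := K) (ε := c / Q * (‖k‖ * Real.exp (K * τ))) (a := 0) (b := τ)
      ?_ ?_ ?_ ?_ τ ⟨hτ, le_rfl⟩
    · rw [gronwallBound_of_K_ne_0 hKpos.ne'] at hgr
      refine hgr.trans ?_
      simp only [zero_mul, zero_add, sub_zero]
      have : c / Q * (‖k‖ * Real.exp (K * τ)) / K * (Real.exp (K * τ) - 1) =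
          c / Q * ‖k‖ * (Q - 1) := by rw [hQ]; ring
      rw [this]
      calc c / Q * ‖k‖ * (Q - 1) ≤ c / Q * ‖k‖ * Q := by gcongr; linarith
        _ = c * ‖k‖ := by field_simp
    · refine ContinuousOn.sub (Continuous.continuousOn ?_) (hΦc.clm_apply continuousOn_const)
      exact (hC.continuous_flow.comp (by fun_prop : Continuous fun s : ℝ => (s, x + k))).sub hflx
    · intro s hs
      have h1 := ((hC.hasDerivAt_flow (x + k) s).hasDerivWithinAt (s := Set.Ici s)).sub
        (hC.hasDerivAt_flow x s).hasDerivWithinAt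
      have h2 := (hasDerivWithinAt_Ici_of_Icc (hΦ s (Set.Ico_subset_Icc_self hs)) hs).clm_apply
        (hasDerivWithinAt_const s (Set.Ici s) k)
      refine (h1.sub h2).congr_deriv ?_
      simp
    · simp [hC.flow_zero, hΦ0]
    · intro s hs
      have h1 := htay (flow C s x) (flow C s (x + k)) ((hΔ s hs).trans_lt hk)
      have h2 : C (flow C s (x + k)) - C (flow C s x) - fderiv ℝ C (flow C s x) (Φ s k) =
          fderiv ℝ C (flow C s x) (flow C s (x + k) - flow C s x - Φ s k) +
          (C (flow C s (x + k)) - C (flow C s x) -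
            fderiv ℝ C (flow C s x) (flow C s (x + k) - flow C s x)) := by
        simp only [map_sub]; abel
      rw [h2]
      refine (norm_add_le _ _).trans (add_le_add ?_ (h1.trans ?_))
      · exact ((fderiv ℝ C (flow C s x)).le_opNorm _).trans
          (mul_le_mul_of_nonneg_right (hK _) (norm_nonneg _))
      · exact mul_le_mul_of_nonneg_left (hΔ s hs) (by positivity)
  · set I : ℝ → ℝ := fun t => ∫ s in (0 : ℝ)..t, divergence C (flow C s x) with hI
    have hId : ∀ t, HasDerivAt I (divergence C (flow C t x)) t := fun t =>
      ((hC.continuous_divergence_flow_time x).integral_hasStrictDerivAt 0 t).hasDerivAt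
    have hdet : ∀ s ∈ Set.Icc 0 τ, HasDerivWithinAt (fun r => (Φ r).det)
        (divergence C (flow C s x) * (Φ s).det) (Set.Icc 0 τ) s := fun s hs =>
      hasDerivWithinAt_det (hΦ s hs)
    have hconst : ∀ s ∈ Set.Icc 0 τ, HasDerivWithinAt (fun r => (Φ r).det * Real.exp (-I r))
        0 (Set.Icc 0 τ) s := by
      intro s hs
      refine ((hdet s hs).mul ((hId s).neg.exp.hasDerivWithinAt)).congr_deriv ?_
      simp only [Pi.neg_apply]
      ring
    have := constant_of_has_deriv_right_zero (f := fun r => (Φ r).det * Real.exp (-I r))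
      (fun s hs => (hconst s hs).continuousWithinAt)
      (fun s hs => hasDerivWithinAt_Ici_of_Icc (hconst s (Set.Ico_subset_Icc_self hs)) hs)
      τ ⟨hτ, le_rfl⟩
    have hdet1 : (ContinuousLinearMap.id ℝ Plane).det = 1 := by simp [det_clm_plane]
    have hI0 : I 0 = 0 := by simp [hI]
    simp only [hΦ0, hdet1, hI0, neg_zero, Real.exp_zero, mul_one, Real.exp_neg] at this
    rw [mul_inv_eq_one₀ (Real.exp_pos _).ne'] at this
    exact this

theorem HasFlowJacobian.add (hC : IsVelocityField C) {s t : ℝ} (hs : HasFlowJacobian C s)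
    (ht : HasFlowJacobian C t) : HasFlowJacobian C (s + t) := by
  intro x
  obtain ⟨D, hD, hDdet⟩ := ht x
  obtain ⟨D', hD', hDdet'⟩ := hs (flow C t x)
  refine ⟨D'.comp D, ?_, ?_⟩
  · have h := hD'.comp x hD
    have h2 : flow C (s + t) = flow C s ∘ flow C t := funext fun z => hC.flow_add s t z
    rwa [h2]
  · have h1 : (D'.comp D).det = D'.det * D.det := LinearMap.det_comp _ _
    rw [h1, hDdet, hDdet', ← Real.exp_add]
    congr 1
    simp only [← hC.flow_add]
    have h2 := intervalIntegral.integral_comp_add_right (a := 0) (b := s)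
      (fun r => divergence C (flow C r x)) t
    rw [h2, zero_add, add_comm, intervalIntegral.integral_add_adjacent_intervals]
    · exact (hC.continuous_divergence_flow_time x).intervalIntegrable _ _
    · exact (hC.continuous_divergence_flow_time x).intervalIntegrable _ _

theorem hasFlowJacobian (hC : IsVelocityField C) {t : ℝ} (ht : 0 ≤ t) : HasFlowJacobian C t := by
  obtain ⟨K, hK1, hK⟩ := hC.exists_norm_fderiv_le
  have hKpos : (0 : ℝ) < K := by
    have : (1 : ℝ) ≤ K := by exact_mod_cast hK1
    linarith
  -- Cutting `[0, t]` into `n` pieces makes each short enough for `hasFlowJacobian_of_small`;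
  -- composition along the flow reassembles them.
  obtain ⟨n, hn⟩ := exists_nat_gt (2 * K * t)
  have hn0 : (0 : ℝ) < n := lt_of_le_of_lt (by positivity) hn
  have hsmall : HasFlowJacobian C (t / n) := by
    refine hC.hasFlowJacobian_of_small hK1 hK (by positivity) ?_
    rw [← mul_div_assoc, div_le_one hn0]
    exact hn.le
  have hmul : ∀ m : ℕ, HasFlowJacobian C (m * (t / n)) := by
    intro m
    induction m with
    | zero =>
      have := hC.hasFlowJacobian_of_small hK1 hK (τ := 0) le_rfl (by simp)
      simpa using this
    | succ m ih =>
      have := HasFlowJacobian.add hC ih hsmall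
      rw [Nat.cast_succ, add_mul, one_mul]
      exact this
  have := hmul n
  rwa [mul_div_cancel₀ _ hn0.ne'] at this

end IsVelocityField

end FlowJacobian

/-! ### Operators and functionals on `L¹` of the plane -/

section L1Basics

theorem toL1_eq {f : Plane → ℝ} (hf : Integrable f volume) : toL1 f = hf.toL1 f := dif_pos hf

theorem coeFn_toL1 {f : Plane → ℝ} (hf : Integrable f volume) : toL1 f =ᵐ[volume] f := by
  rw [toL1_eq hf]; exact hf.coeFn_toL1

theorem toL1_coeFn (v : L1) : toL1 v = v := by
  rw [toL1_eq (L1.integrable_coeFn v)]; exact Integrable.toL1_coeFn v _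

theorem toL1_congr {f g : Plane → ℝ} (h : f =ᵐ[volume] g) : toL1 f = toL1 g := by
  by_cases hf : Integrable f volume
  · have hg := hf.congr h
    rw [toL1_eq hf, toL1_eq hg]
    exact (Integrable.toL1_eq_toL1_iff _ _ _ _).2 h
  · have hg : ¬ Integrable g volume := fun hg => hf (hg.congr h.symm)
    rw [toL1, toL1, dif_neg hf, dif_neg hg]

theorem toL1_add {f g : Plane → ℝ} (hf : Integrable f volume) (hg : Integrable g volume) :
    toL1 (fun x => f x + g x) = toL1 f + toL1 g := by
  rw [toL1_eq hf, toL1_eq hg]; exact toL1_eq (hf.add hg)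

theorem toL1_sub {f g : Plane → ℝ} (hf : Integrable f volume) (hg : Integrable g volume) :
    toL1 (fun x => f x - g x) = toL1 f - toL1 g := by
  rw [toL1_eq hf, toL1_eq hg]; exact toL1_eq (hf.sub hg)

theorem toL1_smul (c : ℝ) {f : Plane → ℝ} (hf : Integrable f volume) :
    toL1 (fun x => c * f x) = c • toL1 f := by
  rw [toL1_eq hf]; exact toL1_eq (hf.const_mul c)

theorem norm_toL1 {f : Plane → ℝ} (hf : Integrable f volume) : ‖toL1 f‖ = ∫ x, ‖f x‖ := by
  rw [L1.norm_eq_integral_norm]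
  exact integral_congr_ae ((coeFn_toL1 hf).mono fun x hx => by simp only [hx])

theorem norm_toL1_sub {f g : Plane → ℝ} (hf : Integrable f volume) (hg : Integrable g volume) :
    ‖toL1 f - toL1 g‖ = ∫ x, ‖f x - g x‖ := by
  rw [← toL1_sub hf hg]
  exact norm_toL1 (hf.sub hg)

theorem integral_toL1 {f : Plane → ℝ} (hf : Integrable f volume) : ∫ x, toL1 f x = ∫ x, f x :=
  integral_congr_ae (coeFn_toL1 hf)

/-- Total mass, as a bounded functional on `L¹`. -/
def mass : L1 →L[ℝ] ℝ :=
  LinearMap.mkContinuous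
    { toFun := fun v => ∫ x, v x
      map_add' := fun v w => by
        rw [← integral_add (L1.integrable_coeFn v) (L1.integrable_coeFn w)]
        exact integral_congr_ae (Lp.coeFn_add v w)
      map_smul' := fun c v => by
        rw [RingHom.id_apply, ← integral_smul]
        exact integral_congr_ae (Lp.coeFn_smul c v) } 1 fun v => by
    rw [one_mul, L1.norm_eq_integral_norm]
    exact norm_integral_le_integral_norm _

theorem mass_apply (v : L1) : mass v = ∫ x, v x := rfl

theorem abs_mass_le (v : L1) : |mass v| ≤ ‖v‖ := by
  rw [mass_apply, L1.norm_eq_integral_norm, ← Real.norm_eq_abs]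
  exact norm_integral_le_integral_norm _

theorem mass_eq_norm {v : L1} (hv : 0 ≤ v) : mass v = ‖v‖ := by
  rw [mass_apply, L1.norm_eq_integral_norm]
  refine integral_congr_ae ?_
  filter_upwards [(Lp.coeFn_nonneg v).2 hv] with x hx
  rw [Real.norm_of_nonneg hx]

/-- The function `|v| - v` is nonnegative with nonpositive integral, hence zero almost everywhere.
This turns a comparison of numbers into positivity. -/
theorem nonneg_of_norm_le_mass {v : L1} (hv : ‖v‖ ≤ mass v) : 0 ≤ v := by
  rw [mass_apply, L1.norm_eq_integral_norm, ← sub_nonpos,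
    ← integral_sub (L1.integrable_coeFn v).norm (L1.integrable_coeFn v)] at hv
  have h0 : ∀ x, 0 ≤ ‖v x‖ - v x := fun x => sub_nonneg.2 (Real.le_norm_self _)
  have h1 := le_antisymm hv (integral_nonneg h0)
  rw [integral_eq_zero_iff_of_nonneg h0
    ((L1.integrable_coeFn v).norm.sub (L1.integrable_coeFn v))] at h1
  refine (Lp.coeFn_nonneg v).1 ?_
  filter_upwards [h1] with x hx
  have h2 : ‖v x‖ - v x = 0 := hx
  rw [Pi.zero_apply, ← sub_eq_zero.1 h2]
  exact norm_nonneg _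

/-- An operation on functions that respects a.e. equality, is additive and homogeneous, and is
bounded for the `L¹` seminorm induces a bounded operator on `L¹`. -/
theorem exists_clm_of_function_operator (Φ : (Plane → ℝ) → Plane → ℝ)
    (hae : ∀ v w : Plane → ℝ, v =ᵐ[volume] w → Φ v =ᵐ[volume] Φ w)
    (hint : ∀ v, Integrable v volume → Integrable (Φ v) volume)
    (hadd : ∀ v w, Integrable v volume → Integrable w volume →
      Φ (fun x => v x + w x) =ᵐ[volume] fun x => Φ v x + Φ w x)
    (hsmul : ∀ (c : ℝ) (v), Integrable v volume →
      Φ (fun x => c * v x) =ᵐ[volume] fun x => c * Φ v x) {B : ℝ}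
    (hnorm : ∀ v, Integrable v volume → ∫ x, ‖Φ v x‖ ≤ B * ∫ x, ‖v x‖) :
    ∃ L : L1 →L[ℝ] L1, (∀ f, Integrable f volume → L (toL1 f) = toL1 (Φ f)) ∧
      (∀ v : L1, L v = toL1 (Φ v)) ∧ ∀ v, ‖L v‖ ≤ B * ‖v‖ := by
  have hb : ∀ v : L1, ‖toL1 (Φ v)‖ ≤ B * ‖v‖ := fun v => by
    rw [norm_toL1 (hint v (L1.integrable_coeFn v)), L1.norm_eq_integral_norm]
    exact hnorm v (L1.integrable_coeFn v)
  refine ⟨LinearMap.mkContinuous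
    { toFun := fun v => toL1 (Φ v)
      map_add' := fun v w => ?_
      map_smul' := fun c v => ?_ } B hb, fun f hf => ?_, fun v => rfl, hb⟩
  · have hv := L1.integrable_coeFn v
    have hw := L1.integrable_coeFn w
    rw [← toL1_add (hint v hv) (hint w hw)]
    exact toL1_congr ((hae _ _ (Lp.coeFn_add v w)).trans (hadd v w hv hw))
  · have hv := L1.integrable_coeFn v
    rw [RingHom.id_apply, ← toL1_smul c (hint v hv)]
    exact toL1_congr ((hae _ _ (Lp.coeFn_smul c v)).trans (hsmul c v hv))
  · exact toL1_congr (hae _ _ (coeFn_toL1 hf))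

/-- Multiplication by a bounded continuous function. -/
theorem exists_mul_clm {c : Plane → ℝ} (hc : Continuous c) {B : ℝ} (hB : ∀ x, |c x| ≤ B) :
    ∃ L : L1 →L[ℝ] L1, (∀ f, Integrable f volume → L (toL1 f) = toL1 fun x => c x * f x) ∧
      ∀ v, ‖L v‖ ≤ B * ‖v‖ := by
  have hint : ∀ v : Plane → ℝ, Integrable v volume → Integrable (fun x => c x * v x) volume :=
    fun v hv => hv.bdd_mul hc.aestronglyMeasurable (Eventually.of_forall hB)
  obtain ⟨L, hL, -, hLn⟩ := exists_clm_of_function_operator (fun v x => c x * v x)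
    (fun v w h => h.mono fun x hx => by simp only [hx]) hint
    (fun v w _ _ => Eventually.of_forall fun x => mul_add _ _ _)
    (fun a v _ => Eventually.of_forall fun x => mul_left_comm _ _ _) (B := B)
    (fun v hv => by
      rw [← integral_const_mul]
      refine integral_mono (hint v hv).norm (hv.norm.const_mul _) fun x => ?_
      simp only [norm_mul]
      exact mul_le_mul_of_nonneg_right (hB x) (norm_nonneg _))
  exact ⟨L, hL, hLn⟩

/-- The classes of smooth compactly supported functions are dense in `L¹`. -/
theorem dense_smooth_L1 : Dense {v : L1 | ∃ f : Plane → ℝ, Integrable f volume ∧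
    HasCompactSupport f ∧ ContDiff ℝ 1 f ∧ v = toL1 f} := by
  refine (Lp.dense_hasCompactSupport_contDiff (F := ℝ) (μ := (volume : Measure Plane))
    (p := 1) ENNReal.one_ne_top).mono ?_
  rintro v ⟨f, hvf, hf, hfc⟩
  refine ⟨f, hfc.continuous.integrable_of_hasCompactSupport hf, hf, hfc.of_le (by simp), ?_⟩
  rw [← toL1_congr hvf, toL1_coeFn]

end L1Basics

/-! ### The convection semigroup -/

section Convection

/-- The Jacobian factor of the convection semigroup. -/
def jacobianFactor (C : Plane → Plane) (t : ℝ) (x : Plane) : ℝ :=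
  Real.exp (-∫ s in (0 : ℝ)..t, divergence C (flow C (-s) x))

/-- The convection semigroup on functions. -/
def transport (C : Plane → Plane) (t : ℝ) (v : Plane → ℝ) (x : Plane) : ℝ :=
  jacobianFactor C t x * v (flow C (-t) x)

theorem jacobianFactor_pos (C : Plane → Plane) (t : ℝ) (x : Plane) : 0 < jacobianFactor C t x :=
  Real.exp_pos _

namespace IsVelocityField

variable {C : Plane → Plane}

/-- The backward flow is the forward flow of `-C`, so Liouville's formula yields precisely the
exponential factor of the semigroup. Convection is therefore a change of variables, which preserves
integrals. -/
theorem exists_hasFDerivAt_backward (hC : IsVelocityField C) {t : ℝ} (ht : 0 ≤ t) :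
    ∃ D : Plane → Plane →L[ℝ] Plane, (∀ x, HasFDerivAt (flow C (-t)) (D x) x) ∧
      ∀ x, |(D x).det| = jacobianFactor C t x := by
  choose D hD hdet using hC.neg.hasFlowJacobian ht
  have h1 : flow (fun x => -C x) t = flow C (-t) := funext fun z => hC.flow_neg t z
  rw [h1] at hD
  refine ⟨D, hD, fun x => ?_⟩
  rw [hdet, abs_of_pos (Real.exp_pos _), jacobianFactor, ← intervalIntegral.integral_neg]
  congr 1
  refine intervalIntegral.integral_congr fun s _ => ?_
  simp only [hC.flow_neg]
  simp [divergence, fderiv_fun_neg, neg_add_rev, add_comm]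

theorem injective_flow (hC : IsVelocityField C) (t : ℝ) : Function.Injective (flow C t) :=
  Function.LeftInverse.injective (hC.flow_neg_flow t)

theorem surjective_flow (hC : IsVelocityField C) (t : ℝ) : Function.Surjective (flow C t) :=
  Function.RightInverse.surjective (hC.flow_flow_neg t)

theorem integrable_transport (hC : IsVelocityField C) {t : ℝ} (ht : 0 ≤ t) {v : Plane → ℝ}
    (hv : Integrable v volume) : Integrable (transport C t v) volume := by
  obtain ⟨D, hD, hdet⟩ := hC.exists_hasFDerivAt_backward ht
  have := integrableOn_image_iff_integrableOn_abs_det_fderiv_smul volume MeasurableSet.univ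
    (fun x _ => (hD x).hasFDerivWithinAt) (hC.injective_flow (-t)).injOn v
  rw [Set.image_univ, (hC.surjective_flow (-t)).range_eq, integrableOn_univ,
    integrableOn_univ] at this
  refine (this.1 hv).congr (Eventually.of_forall fun x => ?_)
  simp only [hdet, transport, smul_eq_mul]

theorem integral_transport (hC : IsVelocityField C) {t : ℝ} (ht : 0 ≤ t) (v : Plane → ℝ) :
    ∫ x, transport C t v x = ∫ x, v x := by
  obtain ⟨D, hD, hdet⟩ := hC.exists_hasFDerivAt_backward ht
  have := integral_image_eq_integral_abs_det_fderiv_smul volume MeasurableSet.univ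
    (fun x _ => (hD x).hasFDerivWithinAt) (hC.injective_flow (-t)).injOn v
  rw [Set.image_univ, (hC.surjective_flow (-t)).range_eq, setIntegral_univ,
    setIntegral_univ] at this
  rw [this]
  simp [hdet, transport]

theorem integral_norm_transport (hC : IsVelocityField C) {t : ℝ} (ht : 0 ≤ t) (v : Plane → ℝ) :
    ∫ x, ‖transport C t v x‖ = ∫ x, ‖v x‖ := by
  rw [← hC.integral_transport ht fun x => ‖v x‖]
  refine integral_congr_ae (Eventually.of_forall fun x => ?_)
  simp only [transport, norm_mul, Real.norm_of_nonneg (jacobianFactor_pos C t x).le]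

/-- Needed for transport to be well defined on classes: the preimage of a null set under the
backward flow is its image under the differentiable forward flow, hence null. -/
theorem transport_congr (hC : IsVelocityField C) {t : ℝ} (ht : 0 ≤ t) {v w : Plane → ℝ}
    (h : v =ᵐ[volume] w) : transport C t v =ᵐ[volume] transport C t w := by
  have hnull : volume (flow C (-t) ⁻¹' {x | ¬ v x = w x}) = 0 := by
    have h1 : flow C (-t) ⁻¹' {x | ¬ v x = w x} = flow C t '' {x | ¬ v x = w x} :=
      (congrFun (Set.image_eq_preimage_of_inverse (hC.flow_neg_flow t)
        (hC.flow_flow_neg t)) _).symm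
    rw [h1]
    refine addHaar_image_eq_zero_of_differentiableOn_of_addHaar_eq_zero volume (fun x _ => ?_)
      (ae_iff.1 h)
    obtain ⟨D, hD, -⟩ := hC.hasFlowJacobian ht x
    exact hD.differentiableAt.differentiableWithinAt
  have h2 : ∀ᵐ x, v (flow C (-t) x) = w (flow C (-t) x) := ae_iff.2 hnull
  filter_upwards [h2] with x hx
  rw [transport, transport, hx]

theorem continuous_divergence_backward (hC : IsVelocityField C) :
    Continuous fun p : ℝ × Plane => divergence C (flow C (-p.1) p.2) :=
  hC.continuous_divergence_flow.comp
    (by fun_prop : Continuous fun p : ℝ × Plane => ((-p.1, p.2) : ℝ × Plane))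

theorem continuous_jacobianFactor (hC : IsVelocityField C) :
    Continuous fun p : ℝ × Plane => jacobianFactor C p.1 p.2 := by
  unfold jacobianFactor
  refine Real.continuous_exp.comp (Continuous.neg ?_)
  have h : Continuous (Function.uncurry fun (p : ℝ × Plane) (s : ℝ) =>
      divergence C (flow C (-s) p.2)) :=
    hC.continuous_divergence_backward.comp
      (by fun_prop : Continuous fun q : (ℝ × Plane) × ℝ => ((q.2, q.1.2) : ℝ × Plane))
  exact intervalIntegral.continuous_parametric_intervalIntegral_of_continuous h continuous_fst

theorem continuous_transport (hC : IsVelocityField C) {v : Plane → ℝ} (hv : Continuous v) :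
    Continuous fun p : ℝ × Plane => transport C p.1 v p.2 :=
  hC.continuous_jacobianFactor.mul (hv.comp (hC.continuous_flow.comp
    (by fun_prop : Continuous fun p : ℝ × Plane => ((-p.1, p.2) : ℝ × Plane))))

/-- The cocycle identity behind the semigroup law: the divergence integral along an orbit is
additive in time. -/
theorem jacobianFactor_add (hC : IsVelocityField C) (s t : ℝ) (x : Plane) :
    jacobianFactor C (s + t) x = jacobianFactor C s x * jacobianFactor C t (flow C (-s) x) := by
  have hc : Continuous fun r : ℝ => divergence C (flow C (-r) x) :=
    hC.continuous_divergence_backward.comp (by fun_prop : Continuous fun r : ℝ => (r, x))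
  rw [jacobianFactor, jacobianFactor, jacobianFactor, ← Real.exp_add, ← neg_add]
  congr 2
  simp only [← hC.flow_add, ← neg_add]
  have h2 := intervalIntegral.integral_comp_add_right (a := 0) (b := t)
    (fun r => divergence C (flow C (-r) x)) s
  rw [h2, zero_add, add_comm t s,
    intervalIntegral.integral_add_adjacent_intervals (hc.intervalIntegrable _ _)
      (hc.intervalIntegrable _ _)]

theorem transport_add (hC : IsVelocityField C) (s t : ℝ) (v : Plane → ℝ) :
    transport C (s + t) v = transport C s (transport C t v) := by
  funext x
  simp only [transport]
  rw [hC.jacobianFactor_add, mul_assoc, ← hC.flow_add, neg_add_rev]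

theorem transport_zero (hC : IsVelocityField C) (v : Plane → ℝ) : transport C 0 v = v := by
  funext x
  simp [transport, jacobianFactor, hC.flow_zero]

theorem tendsto_transport (hC : IsVelocityField C) {f : Plane → ℝ} (hf : HasCompactSupport f)
    (hfc : Continuous f) : Tendsto (fun t => toL1 (transport C t f)) (𝓝[>] 0) (𝓝 (toL1 f)) := by
  have hfi := hfc.integrable_of_hasCompactSupport hf (μ := volume)
  obtain ⟨M, hM⟩ := hC.bounded
  have hM0 : 0 ≤ M := (norm_nonneg _).trans (hM 0)
  obtain ⟨B, hB0, hB⟩ := hC.exists_abs_divergence_le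
  obtain ⟨F, hF⟩ := hfc.bounded_above_of_compact_support hf
  have hF0 : 0 ≤ F := (norm_nonneg _).trans (hF 0)
  obtain ⟨r, hr⟩ := hf.isCompact.isBounded.subset_closedBall (0 : Plane)
  rw [tendsto_iff_norm_sub_tendsto_zero]
  have hsmall : ∀ᶠ t : ℝ in 𝓝[>] 0, 0 < t ∧ t ≤ 1 := by
    filter_upwards [Ioc_mem_nhdsGT (zero_lt_one' ℝ)] with t ht using ht
  have hlim : Tendsto (fun t => ∫ x, ‖transport C t f x - f x‖) (𝓝[>] 0)
      (𝓝 (∫ _ : Plane, (0 : ℝ))) := by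
    -- For `t ≤ 1` the flow moves points by at most `M`, so `f` and its transport both vanish
    -- outside the ball of radius `r + M`. Inside it the Jacobian factor is at most `exp B`.
    refine tendsto_integral_filter_of_dominated_convergence
      ((Metric.closedBall (0 : Plane) (r + M)).indicator fun _ => (Real.exp B + 1) * F) ?_ ?_ ?_ ?_
    · refine Eventually.of_forall fun t => Continuous.aestronglyMeasurable ?_
      exact (((hC.continuous_transport hfc).comp
        (by fun_prop : Continuous fun x : Plane => (t, x))).sub hfc).norm
    · filter_upwards [hsmall] with t ht
      refine Eventually.of_forall fun x => ?_
      rw [norm_norm]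
      by_cases hx : x ∈ Metric.closedBall (0 : Plane) (r + M)
      · rw [Set.indicator_of_mem hx, add_mul, one_mul]
        refine (norm_sub_le _ _).trans (add_le_add ?_ (hF x))
        rw [transport, norm_mul, Real.norm_of_nonneg (jacobianFactor_pos C t x).le]
        refine mul_le_mul ?_ (hF _) (norm_nonneg _) (Real.exp_pos _).le
        refine Real.exp_le_exp.2 ((neg_le_abs _).trans ?_)
        have := intervalIntegral.norm_integral_le_of_norm_le_const (a := 0) (b := t)
          (f := fun s => divergence C (flow C (-s) x)) (C := B) (fun s _ => hB _)
        rw [sub_zero, abs_of_pos ht.1] at this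
        exact this.trans (mul_le_of_le_one_right hB0 ht.2)
      · rw [Set.indicator_of_notMem hx]
        rw [Metric.mem_closedBall, dist_zero_right, not_le] at hx
        have hz : ∀ z : Plane, r < ‖z‖ → f z = 0 := fun z hz =>
          image_eq_zero_of_notMem_tsupport fun h => by
            have := hr h
            rw [Metric.mem_closedBall, dist_zero_right] at this
            linarith
        have h1 : ‖flow C (-t) x - x‖ ≤ M := by
          have := hC.dist_flow_time_le hM 0 (-t) x
          rw [hC.flow_zero, sub_zero, abs_neg, abs_of_pos ht.1] at this
          exact this.trans (mul_le_of_le_one_right hM0 ht.2)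
        have h2 : r < ‖flow C (-t) x‖ := by
          have := norm_sub_norm_le x (flow C (-t) x)
          rw [norm_sub_rev] at this
          linarith
        rw [transport, hz x (by linarith), hz _ h2]
        simp
    · exact (integrable_indicator_iff measurableSet_closedBall).2
        (integrableOn_const (isCompact_closedBall _ _).measure_ne_top)
    · refine Eventually.of_forall fun x => ?_
      have h1 : Tendsto (fun t => transport C t f x) (𝓝 0) (𝓝 (transport C 0 f x)) :=
        ((hC.continuous_transport hfc).comp
          (by fun_prop : Continuous fun t : ℝ => (t, x))).tendsto 0
      rw [hC.transport_zero] at h1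
      simpa using ((h1.mono_left nhdsWithin_le_nhds).sub_const (f x)).norm
  rw [integral_zero] at hlim
  refine hlim.congr' ?_
  filter_upwards [hsmall] with t ht
  rw [norm_toL1_sub (hC.integrable_transport ht.1.le hfi) hfi]

/-- The convection semigroup as a strongly continuous semigroup of isometries. -/
theorem exists_convection_semigroup (hC : IsVelocityField C) :
    ∃ V : ℝ → L1 →L[ℝ] L1, IsC0Semigroup V ∧
      (∀ t, 0 ≤ t → ∀ v, V t v = convection C t v) ∧
      (∀ t, 0 ≤ t → ∀ f, Integrable f volume → V t (toL1 f) = toL1 (transport C t f)) ∧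
      (∀ t, 0 ≤ t → ∀ v, ‖V t v‖ ≤ ‖v‖) ∧ ∀ t, 0 ≤ t → ∀ v, mass (V t v) = mass v := by
  have hex : ∀ t, ∃ L : L1 →L[ℝ] L1, 0 ≤ t →
      (∀ f, Integrable f volume → L (toL1 f) = toL1 (transport C t f)) ∧
      (∀ v : L1, L v = toL1 (transport C t v)) ∧ ∀ v, ‖L v‖ ≤ 1 * ‖v‖ := by
    intro t
    by_cases ht : 0 ≤ t
    · obtain ⟨L, hL⟩ := exists_clm_of_function_operator (transport C t)
        (fun v w h => hC.transport_congr ht h) (fun v hv => hC.integrable_transport ht hv)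
        (fun v w _ _ => Eventually.of_forall fun x => mul_add _ _ _)
        (fun a v _ => Eventually.of_forall fun x => mul_left_comm _ _ _) (B := 1)
        (fun v _ => by rw [one_mul, hC.integral_norm_transport ht])
      exact ⟨L, fun _ => hL⟩
    · exact ⟨0, fun h => absurd h ht⟩
  choose V hV using hex
  refine ⟨V, ?_, fun t ht v => (hV t ht).2.1 v, fun t ht => (hV t ht).1,
    fun t ht v => by simpa using (hV t ht).2.2 v, fun t ht v => ?_⟩
  · refine isC0Semigroup_of_bounded ?_ ?_ zero_le_one (fun t ht => (hV t ht).2.2)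
      dense_smooth_L1 ?_
    · ext1 v
      rw [(hV 0 le_rfl).2.1, hC.transport_zero, toL1_coeFn]
      rfl
    · intro s t hs ht
      ext1 v
      rw [(hV (s + t) (add_nonneg hs ht)).2.1, hC.transport_add, ContinuousLinearMap.comp_apply,
        (hV t ht).2.1, (hV s hs).1 _ (hC.integrable_transport ht (L1.integrable_coeFn v))]
    · rintro v ⟨f, hfi, hfs, hfc, rfl⟩
      refine (hC.tendsto_transport hfs hfc.continuous).congr' ?_
      filter_upwards [self_mem_nhdsWithin] with t ht
      rw [(hV t (le_of_lt ht)).1 f hfi]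
  · rw [(hV t ht).2.1, mass_apply, mass_apply,
      integral_toL1 (hC.integrable_transport ht (L1.integrable_coeFn v)),
      hC.integral_transport ht]

end IsVelocityField

end Convection

/-! ### The convection generator on smooth functions -/

section ConvectionGenerator

/-- The expression `-div (g C)` for a continuously differentiable function `g`. -/
def convectionOperator (C : Plane → Plane) (g : Plane → ℝ) (x : Plane) : ℝ :=
  -(divergence C x * g x) - (C x 0 * fderiv ℝ g x (EuclideanSpace.single 0 1) +
    C x 1 * fderiv ℝ g x (EuclideanSpace.single 1 1))

namespace IsVelocityField

variable {C : Plane → Plane}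

theorem continuous_convectionOperator (hC : IsVelocityField C) {g : Plane → ℝ}
    (hg : ContDiff ℝ 1 g) : Continuous (convectionOperator C g) := by
  have h1 := hC.continuous_divergence
  have h2 := hC.contDiff.continuous
  have h3 := hg.continuous
  have h4 := hg.continuous_fderiv one_ne_zero
  unfold convectionOperator
  fun_prop

/-- The time derivative is the transport of one fixed function, so increments in time become
integrals of an orbit of the semigroup. -/
theorem hasDerivAt_transport (hC : IsVelocityField C) {g : Plane → ℝ} (hg : ContDiff ℝ 1 g)
    (x : Plane) (s : ℝ) : HasDerivAt (fun s => transport C s g x)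
      (transport C s (convectionOperator C g) x) s := by
  have hc : Continuous fun r : ℝ => divergence C (flow C (-r) x) :=
    hC.continuous_divergence_backward.comp (by fun_prop : Continuous fun r : ℝ => (r, x))
  have h1 : HasDerivAt (fun s => jacobianFactor C s x)
      (jacobianFactor C s x * -divergence C (flow C (-s) x)) s :=
    (hc.integral_hasStrictDerivAt 0 s).hasDerivAt.neg.exp
  have h2 : HasDerivAt (fun s => flow C (-s) x) (-C (flow C (-s) x)) s := by
    have := (hC.hasDerivAt_flow x (-s)).scomp s (hasDerivAt_neg s)
    simpa [Function.comp_def] using this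
  have h3 := (hg.differentiable one_ne_zero (flow C (-s) x)).hasFDerivAt.comp_hasDerivAt s h2
  refine (h1.mul h3).congr_deriv ?_
  set z := flow C (-s) x
  have h4 : fderiv ℝ g z (-C z) = -(C z 0 * fderiv ℝ g z (EuclideanSpace.single 0 1) +
      C z 1 * fderiv ℝ g z (EuclideanSpace.single 1 1)) := by
    conv_lhs => rw [plane_eq_sum (C z)]
    simp only [map_neg, map_add, map_smul, smul_eq_mul]
  rw [h4, transport, convectionOperator]
  simp only [Function.comp_apply]
  ring

theorem transport_sub_eq_integral (hC : IsVelocityField C) {g : Plane → ℝ} (hg : ContDiff ℝ 1 g)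
    (x : Plane) (h : ℝ) : transport C h g x - g x =
      ∫ s in (0 : ℝ)..h, transport C s (convectionOperator C g) x := by
  rw [intervalIntegral.integral_eq_sub_of_hasDerivAt (fun s _ => hC.hasDerivAt_transport hg x s),
    hC.transport_zero]
  exact ((hC.continuous_transport (hC.continuous_convectionOperator hg)).comp
    (by fun_prop : Continuous fun s : ℝ => (s, x))).intervalIntegrable _ _

/-- Continuously differentiable functions with integrable derivatives are in the domain of the
generator of the convection semigroup. -/
theorem mem_generatorGraph_of_contDiff (hC : IsVelocityField C) {V : ℝ → L1 →L[ℝ] L1}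
    (hV : IsC0Semigroup V)
    (hVf : ∀ t, 0 ≤ t → ∀ f, Integrable f volume → V t (toL1 f) = toL1 (transport C t f))
    {g : Plane → ℝ} (hg : ContDiff ℝ 1 g) (hgi : Integrable g volume)
    (hb : Integrable (convectionOperator C g) volume) :
    (toL1 g, toL1 (convectionOperator C g)) ∈ generatorGraph (fun t v => V t v) := by
  set b := convectionOperator C g with hbdef
  have hbc : Continuous b := hC.continuous_convectionOperator hg
  have hjoint : Continuous fun p : Plane × ℝ => transport C p.2 b p.1 - b p.1 :=
    ((hC.continuous_transport hbc).comp
      (by fun_prop : Continuous fun p : Plane × ℝ => ((p.2, p.1) : ℝ × Plane))).sub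
      (hbc.comp continuous_fst)
  -- The error `V h g - g - h b` is the integral of `V s b - b` over `0 < s ≤ h`, known pointwise in
  -- `x`. Fubini turns this into an `L¹` bound, and strong continuity at zero makes `ε` small.
  have hbound : ∀ h : ℝ, 0 < h → ∀ ε : ℝ,
      (∀ s ∈ Set.Ioc 0 h, ‖V s (toL1 b) - toL1 b‖ ≤ ε) →
      ‖V h (toL1 g) - toL1 g - h • toL1 b‖ ≤ ε * h := by
    intro h hh ε hε
    have htb : ∀ s, 0 ≤ s → Integrable (transport C s b) volume := fun s hs =>
      hC.integrable_transport hs hb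
    have hnorm : ∀ s ∈ Set.Ioc 0 h, ∫ x, ‖transport C s b x - b x‖ = ‖V s (toL1 b) - toL1 b‖ :=
      fun s hs => by rw [hVf s hs.1.le b hb, norm_toL1_sub (htb s hs.1.le) hb]
    have hprod : Integrable (fun p : Plane × ℝ => transport C p.2 b p.1 - b p.1)
        (volume.prod (volume.restrict (Set.Ioc 0 h))) := by
      refine (integrable_prod_iff' hjoint.aestronglyMeasurable).2 ⟨?_, ?_⟩
      · filter_upwards [ae_restrict_mem measurableSet_Ioc] with s hs
        exact (htb s hs.1.le).sub hb
      · have h1 : IntegrableOn (fun s => ‖V s (toL1 b) - toL1 b‖) (Set.Ioc 0 h) := by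
          refine (ContinuousOn.integrableOn_Icc ?_).mono_set Set.Ioc_subset_Icc_self
          exact (((hV.continuousOn_orbit _).mono Set.Icc_subset_Ici_self).sub
            continuousOn_const).norm
        refine Integrable.congr h1 ?_
        filter_upwards [ae_restrict_mem measurableSet_Ioc] with s hs using (hnorm s hs).symm
    have hthg := hC.integrable_transport hh.le hgi
    have h0 : V h (toL1 g) - toL1 g - h • toL1 b =
        toL1 fun x => transport C h g x - g x - h * b x := by
      have h1 : Integrable (fun x => transport C h g x - g x) volume := hthg.sub hgi
      rw [toL1_sub h1 (hb.const_mul h), toL1_sub hthg hgi, toL1_smul h hb, hVf h hh.le g hgi]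
    have hptw : ∀ x, transport C h g x - g x - h * b x =
        ∫ s in Set.Ioc 0 h, (transport C s b x - b x) := by
      intro x
      have hi : IntegrableOn (fun s => transport C s b x) (Set.Ioc 0 h) :=
        ((hC.continuous_transport hbc).comp
          (by fun_prop : Continuous fun s : ℝ => (s, x))).integrableOn_Ioc
      rw [integral_sub hi (by simp), hC.transport_sub_eq_integral hg, ← hbdef,
        intervalIntegral.integral_of_le hh.le]
      simp [hh.le]
    have hdiff : Integrable (fun x => transport C h g x - g x - h * b x) volume :=
      (hthg.sub hgi).sub (hb.const_mul h)
    rw [h0, norm_toL1 hdiff]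
    calc ∫ x, ‖transport C h g x - g x - h * b x‖
        ≤ ∫ x, ∫ s in Set.Ioc 0 h, ‖transport C s b x - b x‖ := by
          refine integral_mono hdiff.norm
            hprod.norm.integral_prod_left fun x => ?_
          simp only [hptw x]
          exact norm_integral_le_integral_norm _
      _ = ∫ s in Set.Ioc 0 h, ∫ x, ‖transport C s b x - b x‖ := integral_integral_swap hprod.norm
      _ ≤ ∫ s in Set.Ioc 0 h, ε := by
          refine setIntegral_mono_on hprod.norm.integral_prod_right (by simp) measurableSet_Ioc
            fun s hs => ?_
          exact (hnorm s hs).trans_le (hε s hs)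
      _ = ε * h := by simp [hh.le, mul_comm]
  change Tendsto (fun t : ℝ => t⁻¹ • (V t (toL1 g) - toL1 g)) (𝓝[>] 0) (𝓝 (toL1 b))
  rw [Metric.tendsto_nhdsWithin_nhds]
  intro ε hε
  obtain ⟨δ, hδ, h1⟩ := Metric.continuousOn_iff.1 (hV.continuousOn_orbit (toL1 b)) 0
    Set.self_mem_Ici (ε / 2) (by positivity)
  refine ⟨δ, hδ, fun h hh hhδ => ?_⟩
  have hh0 : (0 : ℝ) < h := hh
  rw [dist_zero_right, Real.norm_of_nonneg hh0.le] at hhδ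
  have h2 := hbound h hh0 (ε / 2) fun s hs => by
    have := h1 s hs.1.le (by
      rw [dist_zero_right, Real.norm_of_nonneg hs.1.le]; exact hs.2.trans_lt hhδ)
    rw [hV.zero_apply, dist_eq_norm] at this
    exact this.le
  have h3 : h⁻¹ • (V h (toL1 g) - toL1 g) - toL1 b =
      h⁻¹ • (V h (toL1 g) - toL1 g - h • toL1 b) := by
    rw [smul_sub h⁻¹ _ (h • toL1 b), smul_smul, inv_mul_cancel₀ hh0.ne', one_smul]
  rw [dist_eq_norm, h3, norm_smul, Real.norm_of_nonneg (inv_pos.2 hh0).le, ← div_eq_inv_mul,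
    div_lt_iff₀ hh0]
  nlinarith

end IsVelocityField

end ConvectionGenerator

/-! ### Convolution operators on `L¹` -/

section PlaneConvolution

open ContinuousLinearMap (mul)

/-- Convolution of real functions on the plane. -/
def planeConv (k v : Plane → ℝ) (x : Plane) : ℝ := ∫ z, k (x - z) * v z

theorem planeConv_eq_convolution (k v : Plane → ℝ) :
    planeConv k v = convolution k v (mul ℝ ℝ) volume := by
  funext x
  rw [planeConv, convolution_def, ← integral_sub_left_eq_self _ _ x]
  simp

/-- A bounded, continuous and integrable convolution kernel. -/
structure IsKernel (k : Plane → ℝ) : Prop where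
  continuous : Continuous k
  integrable : Integrable k volume
  bounded : ∃ B : ℝ, ∀ x, ‖k x‖ ≤ B

namespace IsKernel

variable {k l : Plane → ℝ}

theorem norm (hk : IsKernel k) : IsKernel fun x => ‖k x‖ where
  continuous := hk.continuous.norm
  integrable := hk.integrable.norm
  bounded := by simpa using hk.bounded

theorem integrable_integrand (hk : IsKernel k) {v : Plane → ℝ} (hv : Integrable v volume)
    (x : Plane) : Integrable (fun z => k (x - z) * v z) volume := by
  obtain ⟨B, hB⟩ := hk.bounded
  exact hv.bdd_mul (hk.continuous.comp (by fun_prop)).aestronglyMeasurable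
    (Eventually.of_forall fun z => hB _)

theorem convolutionExistsAt (hk : IsKernel k) {v : Plane → ℝ} (hv : Integrable v volume)
    (x : Plane) : ConvolutionExistsAt k v x (mul ℝ ℝ) volume := by
  have h := ((hk.integrable_integrand hv x).comp_sub_left x)
  simpa [ConvolutionExistsAt] using h

theorem integrable_planeConv (hk : IsKernel k) {v : Plane → ℝ} (hv : Integrable v volume) :
    Integrable (planeConv k v) volume := by
  rw [planeConv_eq_convolution]
  exact hk.integrable.integrable_convolution _ hv

theorem integral_planeConv (hk : IsKernel k) {v : Plane → ℝ} (hv : Integrable v volume) :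
    ∫ x, planeConv k v x = (∫ x, k x) * ∫ x, v x := by
  rw [planeConv_eq_convolution]
  exact integral_convolution _ hk.integrable hv

theorem integral_norm_planeConv_le (hk : IsKernel k) {v : Plane → ℝ} (hv : Integrable v volume) :
    ∫ x, ‖planeConv k v x‖ ≤ (∫ x, ‖k x‖) * ∫ x, ‖v x‖ := by
  rw [← hk.norm.integral_planeConv hv.norm]
  refine integral_mono (hk.integrable_planeConv hv).norm (hk.norm.integrable_planeConv hv.norm)
    fun x => ?_
  refine (norm_integral_le_integral_norm _).trans_eq ?_
  simp only [planeConv, norm_mul]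

theorem planeConv_planeConv (hk : IsKernel k) (hl : IsKernel l) {v : Plane → ℝ}
    (hv : Integrable v volume) :
    planeConv k (planeConv l v) = planeConv (planeConv k l) v := by
  funext x
  simp only [planeConv_eq_convolution]
  symm
  refine convolution_assoc (mul ℝ ℝ) (mul ℝ ℝ) (mul ℝ ℝ) (mul ℝ ℝ)
    (fun a b c => mul_assoc a b c) hk.continuous.aestronglyMeasurable
    hl.continuous.aestronglyMeasurable hv.aestronglyMeasurable
    (Eventually.of_forall fun y => hk.convolutionExistsAt hl.integrable y)
    (Eventually.of_forall fun y => hl.norm.convolutionExistsAt hv.norm y) ?_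
  refine hk.norm.convolutionExistsAt ?_ x
  have := hl.norm.integrable_planeConv hv.norm
  rwa [planeConv_eq_convolution] at this

theorem exists_convolution_clm (hk : IsKernel k) : ∃ L : L1 →L[ℝ] L1,
    (∀ f, Integrable f volume → L (toL1 f) = toL1 (planeConv k f)) ∧
      (∀ v : L1, L v = toL1 (planeConv k v)) ∧ ∀ v, ‖L v‖ ≤ (∫ x, ‖k x‖) * ‖v‖ :=
  exists_clm_of_function_operator (planeConv k)
    (fun v w h => Eventually.of_forall fun x =>
      integral_congr_ae (h.mono fun z hz => by simp only [hz]))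
    (fun v hv => hk.integrable_planeConv hv)
    (fun v w hv hw => Eventually.of_forall fun x => by
      simp only [planeConv, mul_add]
      exact integral_add (hk.integrable_integrand hv x) (hk.integrable_integrand hw x))
    (fun c v _ => Eventually.of_forall fun x => by
      simp only [planeConv, mul_left_comm _ c]
      exact integral_const_mul _ _)
    (fun v hv => hk.integral_norm_planeConv_le hv)

theorem hasFDerivAt_planeConv (hk : IsKernel k) {f : Plane → ℝ} (hf : HasCompactSupport f)
    (hfc : ContDiff ℝ 1 f) (x : Plane) : HasFDerivAt (planeConv k f)
      (convolution k (fderiv ℝ f) ((mul ℝ ℝ).precompR Plane) volume x) x := by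
  rw [planeConv_eq_convolution]
  exact hf.hasFDerivAt_convolution_right _ hk.integrable.locallyIntegrable hfc x

theorem contDiff_planeConv (hk : IsKernel k) {f : Plane → ℝ} (hf : HasCompactSupport f)
    (hfc : ContDiff ℝ 1 f) : ContDiff ℝ 1 (planeConv k f) := by
  rw [planeConv_eq_convolution]
  exact hf.contDiff_convolution_right _ hk.integrable.locallyIntegrable hfc

/-- With the derivative on the test function, convolution commutes with differentiation, so
first-order terms can be written through the diffusion semigroup itself. -/
theorem fderiv_planeConv_apply (hk : IsKernel k) {f : Plane → ℝ} (hf : HasCompactSupport f)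
    (hfc : ContDiff ℝ 1 f) (x e : Plane) :
    fderiv ℝ (planeConv k f) x e = planeConv k (fun z => fderiv ℝ f z e) x := by
  rw [(hk.hasFDerivAt_planeConv hf hfc x).fderiv,
    convolution_precompR_apply (mul ℝ ℝ) hk.integrable.locallyIntegrable (hf.fderiv ℝ)
      (hfc.continuous_fderiv one_ne_zero), planeConv_eq_convolution]

end IsKernel

end PlaneConvolution

/-! ### Gaussian kernels and their derivatives -/

section GaussianKernel

/-- The Gaussian density on the plane with covariance `2 a`. -/
def gaussKernel (a : ℝ) (x : Plane) : ℝ :=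
  1 / (4 * Real.pi * a) * Real.exp (-‖x‖ ^ 2 / (4 * a))

theorem heatKernel_eq (ε t : ℝ) : heatKernel ε t = gaussKernel (ε ^ 2 * t) := by
  funext x
  simp only [heatKernel, gaussKernel, mul_assoc]

theorem gaussian_eq (σ : ℝ) : gaussian σ = gaussKernel (σ ^ 2 / 2) := by
  funext x
  have h1 : 2 * Real.pi * σ ^ 2 = 4 * Real.pi * (σ ^ 2 / 2) := by ring
  have h2 : 2 * σ ^ 2 = 4 * (σ ^ 2 / 2) := by ring
  rw [gaussian, gaussKernel, h1, h2]

variable {a b : ℝ}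

theorem gaussKernel_pos (ha : 0 < a) (x : Plane) : 0 < gaussKernel a x := by
  unfold gaussKernel
  positivity

theorem integral_exp_neg_mul_sq_plane (hb : 0 < b) :
    ∫ x : Plane, Real.exp (-b * ‖x‖ ^ 2) = Real.pi / b := by
  rw [GaussianFourier.integral_rexp_neg_mul_sq_norm hb]
  simp

theorem integral_gaussKernel (ha : 0 < a) : ∫ x, gaussKernel a x = 1 := by
  simp only [gaussKernel]
  rw [integral_const_mul]
  have h : ∀ x : Plane, -‖x‖ ^ 2 / (4 * a) = -(1 / (4 * a)) * ‖x‖ ^ 2 := fun x => by ring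
  simp only [h]
  rw [integral_exp_neg_mul_sq_plane (by positivity)]
  field_simp

theorem contDiff_gaussKernel (a : ℝ) : ContDiff ℝ 1 (gaussKernel a) := by
  unfold gaussKernel
  exact contDiff_const.mul (((contDiff_norm_sq ℝ).neg.div_const _).exp)

theorem integrable_gaussKernel (ha : 0 < a) : Integrable (gaussKernel a) volume :=
  Integrable.of_integral_ne_zero (by rw [integral_gaussKernel ha]; exact one_ne_zero)

theorem gaussKernel_le (ha : 0 < a) (x : Plane) : gaussKernel a x ≤ 1 / (4 * Real.pi * a) := by
  unfold gaussKernel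
  refine mul_le_of_le_one_right (by positivity) (Real.exp_le_one_iff.2 ?_)
  rw [neg_div]
  have : 0 ≤ ‖x‖ ^ 2 / (4 * a) := by positivity
  linarith

theorem isKernel_gaussKernel (ha : 0 < a) : IsKernel (gaussKernel a) where
  continuous := (contDiff_gaussKernel a).continuous
  integrable := integrable_gaussKernel ha
  bounded := ⟨1 / (4 * Real.pi * a), fun x => by
    rw [Real.norm_of_nonneg (gaussKernel_pos ha x).le]; exact gaussKernel_le ha x⟩

theorem integral_norm_gaussKernel (ha : 0 < a) : ∫ x, ‖gaussKernel a x‖ = 1 := by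
  simp only [Real.norm_of_nonneg (gaussKernel_pos ha _).le, integral_gaussKernel ha]

/-- Gaussian densities form a convolution semigroup. -/
theorem planeConv_gaussKernel (ha : 0 < a) (hb : 0 < b) :
    planeConv (gaussKernel a) (gaussKernel b) = gaussKernel (a + b) := by
  funext x
  have h1 : ∀ z : Plane, gaussKernel a (x - z) * gaussKernel b z =
      (1 / (4 * Real.pi * a) * (1 / (4 * Real.pi * b)) * Real.exp (-‖x‖ ^ 2 / (4 * (a + b)))) *
        Real.exp (-((a + b) / (4 * a * b)) * ‖z - (b / (a + b)) • x‖ ^ 2) := by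
    intro z
    -- Completing the square in `z` leaves a Gaussian centred at `(b / (a + b)) • x`, integrated by
    -- translation invariance.
    have h2 : -‖x - z‖ ^ 2 / (4 * a) + -‖z‖ ^ 2 / (4 * b) =
        -‖x‖ ^ 2 / (4 * (a + b)) + -((a + b) / (4 * a * b)) * ‖z - (b / (a + b)) • x‖ ^ 2 := by
      rw [norm_sub_sq_real, norm_sub_sq_real, inner_smul_right, norm_smul, real_inner_comm x z,
        Real.norm_of_nonneg (by positivity)]
      field_simp
      ring
    rw [gaussKernel, gaussKernel, mul_mul_mul_comm, ← Real.exp_add, h2, Real.exp_add, ← mul_assoc]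
  rw [planeConv]
  simp only [h1]
  rw [integral_const_mul,
    integral_sub_right_eq_self (fun z : Plane => Real.exp (-((a + b) / (4 * a * b)) * ‖z‖ ^ 2)),
    integral_exp_neg_mul_sq_plane (by positivity), gaussKernel]
  field_simp

/-- Doubling the parameter frees a factor `exp (‖x‖² / (8 a))` that absorbs `‖x‖`: with `r = √(2a)`,
the inequality `s ≤ r (1 + s² / (8 a))` is the square `(r - s / 2)² ≥ 0`. The constant 2 compensates
the normalisation. Moment and gradient bounds thus reduce to the integral of a Gaussian. -/
theorem norm_mul_gaussKernel_le (ha : 0 < a) (x : Plane) :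
    ‖x‖ * gaussKernel a x ≤ 2 * √(2 * a) * gaussKernel (2 * a) x := by
  set s := ‖x‖ with hs
  set r := √(2 * a) with hr
  have hr0 : 0 < r := Real.sqrt_pos.2 (by positivity)
  have hr2 : r ^ 2 = 2 * a := Real.sq_sqrt (by positivity)
  have h1 : s ≤ r * Real.exp (s ^ 2 / (8 * a)) := by
    have h2 := Real.add_one_le_exp (s ^ 2 / (8 * a))
    have h3 : s ≤ r * (s ^ 2 / (8 * a) + 1) := by
      have h4 : 8 * a = 4 * r ^ 2 := by rw [hr2]; ring
      rw [h4]
      have h5 : r * (s ^ 2 / (4 * r ^ 2) + 1) = s + (r - s / 2) ^ 2 / r := by field_simp; ring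
      rw [h5]
      have : 0 ≤ (r - s / 2) ^ 2 / r := by positivity
      linarith
    exact h3.trans (mul_le_mul_of_nonneg_left h2 hr0.le)
  have h6 : Real.exp (-s ^ 2 / (4 * (2 * a))) =
      Real.exp (s ^ 2 / (8 * a)) * Real.exp (-s ^ 2 / (4 * a)) := by
    rw [← Real.exp_add]; congr 1; field_simp; ring
  rw [gaussKernel, gaussKernel, ← hs, h6]
  have h7 : 2 * r * (1 / (4 * Real.pi * (2 * a)) *
      (Real.exp (s ^ 2 / (8 * a)) * Real.exp (-s ^ 2 / (4 * a)))) =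
      (r * Real.exp (s ^ 2 / (8 * a))) * (1 / (4 * Real.pi * a) * Real.exp (-s ^ 2 / (4 * a))) := by
    field_simp
  rw [h7]
  exact mul_le_mul_of_nonneg_right h1 (by positivity)

theorem fderiv_gaussKernel_apply (ha : 0 < a) (x e : Plane) :
    fderiv ℝ (gaussKernel a) x e = -(inner ℝ x e / (2 * a)) * gaussKernel a x := by
  have h1 : HasFDerivAt (fun x : Plane => ‖x‖ ^ 2) (2 • innerSL ℝ x) x :=
    (hasStrictFDerivAt_norm_sq x).hasFDerivAt
  have h2 : HasFDerivAt (fun x : Plane => -‖x‖ ^ 2 / (4 * a))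
      ((-(4 * a)⁻¹) • (2 • innerSL ℝ x)) x := by
    refine (h1.const_mul (-(4 * a)⁻¹)).congr_of_eventuallyEq (Eventually.of_forall fun z => ?_)
    simp only
    ring
  have h3 := h2.exp.const_mul (1 / (4 * Real.pi * a))
  have h4 : HasFDerivAt (gaussKernel a) _ x := h3
  rw [h4.fderiv, gaussKernel]
  simp only [smul_apply, innerSL_apply_apply, smul_eq_mul, nsmul_eq_mul]
  field_simp
  ring

theorem norm_fderiv_gaussKernel_le (ha : 0 < a) (x : Plane) (i : Fin 2) :
    ‖fderiv ℝ (gaussKernel a) x (EuclideanSpace.single i 1)‖ ≤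
      √(2 * a) / a * gaussKernel (2 * a) x := by
  rw [fderiv_gaussKernel_apply ha, norm_mul, norm_neg, norm_div,
    Real.norm_of_nonneg (gaussKernel_pos ha x).le, Real.norm_of_nonneg (show 0 ≤ 2 * a by positivity)]
  have h1 : ‖inner ℝ x (EuclideanSpace.single i (1 : ℝ))‖ ≤ ‖x‖ := by
    refine (norm_inner_le_norm x _).trans ?_
    simp
  have h2 := norm_mul_gaussKernel_le ha x
  calc ‖inner ℝ x (EuclideanSpace.single i (1 : ℝ))‖ / (2 * a) * gaussKernel a x
      ≤ ‖x‖ / (2 * a) * gaussKernel a x := by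
        have := (gaussKernel_pos ha x).le
        gcongr
    _ = (‖x‖ * gaussKernel a x) / (2 * a) := by ring
    _ ≤ (2 * √(2 * a) * gaussKernel (2 * a) x) / (2 * a) := by gcongr
    _ = √(2 * a) / a * gaussKernel (2 * a) x := by field_simp

theorem isKernel_fderiv_gaussKernel (ha : 0 < a) (i : Fin 2) :
    IsKernel fun x => fderiv ℝ (gaussKernel a) x (EuclideanSpace.single i 1) where
  continuous := by
    have := (contDiff_gaussKernel a).continuous_fderiv one_ne_zero
    fun_prop
  integrable := by
    refine Integrable.mono' ((integrable_gaussKernel (a := 2 * a) (by positivity)).const_mul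
      (√(2 * a) / a)) ?_ (Eventually.of_forall fun x => norm_fderiv_gaussKernel_le ha x i)
    have := (contDiff_gaussKernel a).continuous_fderiv one_ne_zero
    exact Continuous.aestronglyMeasurable (by fun_prop)
  bounded := ⟨√(2 * a) / a * (1 / (4 * Real.pi * (2 * a))), fun x =>
    (norm_fderiv_gaussKernel_le ha x i).trans
      (mul_le_mul_of_nonneg_left (gaussKernel_le (by positivity) x) (by positivity))⟩

theorem integral_norm_fderiv_gaussKernel_le (ha : 0 < a) (i : Fin 2) :
    ∫ x, ‖fderiv ℝ (gaussKernel a) x (EuclideanSpace.single i 1)‖ ≤ √(2 * a) / a := by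
  have h2a : 0 < 2 * a := by positivity
  refine (integral_mono (isKernel_fderiv_gaussKernel ha i).integrable.norm
    ((integrable_gaussKernel h2a).const_mul _) fun x => norm_fderiv_gaussKernel_le ha x i).trans_eq ?_
  rw [integral_const_mul, integral_gaussKernel h2a, mul_one]

/-- A derivative may be moved from a test function to the Gaussian kernel. -/
theorem planeConv_gaussKernel_fderiv (ha : 0 < a) {f : Plane → ℝ} (hf : HasCompactSupport f)
    (hfc : ContDiff ℝ 1 f) (i : Fin 2) :
    planeConv (gaussKernel a) (fun z => fderiv ℝ f z (EuclideanSpace.single i 1)) =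
      planeConv (fun z => fderiv ℝ (gaussKernel a) z (EuclideanSpace.single i 1)) f := by
  funext x
  have hk := isKernel_gaussKernel ha
  have hfi := hfc.continuous.integrable_of_hasCompactSupport hf (μ := volume)
  have hdfi : Integrable (fun z => fderiv ℝ f z (EuclideanSpace.single i 1)) volume := by
    have h1 := hfc.continuous_fderiv one_ne_zero
    refine Continuous.integrable_of_hasCompactSupport (by fun_prop) ?_
    exact (hf.fderiv ℝ).comp_left (g := fun L : Plane →L[ℝ] ℝ => L (EuclideanSpace.single i 1)) rfl
  have hd : ∀ z, HasFDerivAt (fun z => gaussKernel a (x - z))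
      (-(fderiv ℝ (gaussKernel a) (x - z))) z := by
    intro z
    have h1 := ((contDiff_gaussKernel a).differentiable one_ne_zero (x - z)).hasFDerivAt
    have h2 := h1.comp z ((hasFDerivAt_id z).const_sub x)
    refine h2.congr_fderiv ?_
    ext v
    simp
  have h := integral_mul_fderiv_eq_neg_fderiv_mul_of_integrable (μ := (volume : Measure Plane))
    (f := fun z => gaussKernel a (x - z)) (g := f) (v := EuclideanSpace.single i (1 : ℝ))
    ?_ ?_ ?_ (fun z _ => (hd z).differentiableAt)
    (fun z _ => hfc.differentiable one_ne_zero z)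
  · rw [planeConv, planeConv, h, ← integral_neg]
    refine integral_congr_ae (Eventually.of_forall fun z => ?_)
    simp [(hd z).fderiv]
  · have := ((isKernel_fderiv_gaussKernel ha i).integrable_integrand hfi x).neg
    refine this.congr (Eventually.of_forall fun z => ?_)
    simp [(hd z).fderiv]
  · exact hk.integrable_integrand hdfi x
  · exact hk.integrable_integrand hfi x

end GaussianKernel

/-! ### The diffusion semigroup -/

section Diffusion

variable {a : ℝ}

theorem isKernel_norm_mul_gaussKernel (ha : 0 < a) : IsKernel fun x => ‖x‖ * gaussKernel a x where
  continuous := continuous_norm.mul (contDiff_gaussKernel a).continuous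
  integrable := by
    have h2a : 0 < 2 * a := by positivity
    refine Integrable.mono' ((integrable_gaussKernel h2a).const_mul (2 * √(2 * a)))
      (continuous_norm.mul (contDiff_gaussKernel a).continuous).aestronglyMeasurable
      (Eventually.of_forall fun x => ?_)
    rw [Real.norm_of_nonneg (mul_nonneg (norm_nonneg _) (gaussKernel_pos ha x).le)]
    exact norm_mul_gaussKernel_le ha x
  bounded := ⟨2 * √(2 * a) * (1 / (4 * Real.pi * (2 * a))), fun x => by
    rw [Real.norm_of_nonneg (mul_nonneg (norm_nonneg _) (gaussKernel_pos ha x).le)]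
    exact (norm_mul_gaussKernel_le ha x).trans
      (mul_le_mul_of_nonneg_left (gaussKernel_le (by positivity) x) (by positivity))⟩

theorem integral_norm_mul_gaussKernel_le (ha : 0 < a) :
    ∫ x, ‖x‖ * gaussKernel a x ≤ 2 * √(2 * a) := by
  have h2a : 0 < 2 * a := by positivity
  refine (integral_mono (isKernel_norm_mul_gaussKernel ha).integrable
    ((integrable_gaussKernel h2a).const_mul _) fun x => norm_mul_gaussKernel_le ha x).trans_eq ?_
  rw [integral_const_mul, integral_gaussKernel h2a, mul_one]

/-- Gaussian convolution of a test function converges in `L¹` with rate `√a`. -/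
theorem exists_integral_norm_planeConv_sub_le {f : Plane → ℝ} (hf : HasCompactSupport f)
    (hfc : ContDiff ℝ 1 f) :
    ∃ c : ℝ, ∀ a, 0 < a → ∫ x, ‖planeConv (gaussKernel a) f x - f x‖ ≤ c * √(2 * a) := by
  obtain ⟨Λ, hΛ⟩ := hfc.lipschitzWith_of_hasCompactSupport hf one_ne_zero
  have hfi := hfc.continuous.integrable_of_hasCompactSupport hf (μ := volume)
  set χ : Plane → ℝ := (tsupport f).indicator fun _ => 1 with hχ
  have hχi : Integrable χ volume :=
    (integrable_indicator_iff (isClosed_tsupport f).measurableSet).2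
      (integrableOn_const hf.isCompact.measure_ne_top)
  have hχ0 : ∀ x, 0 ≤ χ x := fun x => Set.indicator_nonneg (fun _ _ => zero_le_one) x
  have hχ1 : ∀ x, f x ≠ 0 → χ x = 1 := fun x hx =>
    Set.indicator_of_mem (subset_tsupport f hx) _
  -- The Lipschitz bound alone is not integrable in both variables. The indicator `χ` of the support
  -- localises it, as the difference vanishes unless one of the points lies in the support.
  have hdiff : ∀ x z, ‖f z - f x‖ ≤ Λ * (‖x - z‖ * (χ z + χ x)) := by
    intro x z
    by_cases h : f z = 0 ∧ f x = 0
    · rw [h.1, h.2, sub_zero, norm_zero]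
      have h1 := hχ0 x
      have h2 := hχ0 z
      positivity
    · have h1 : 1 ≤ χ z + χ x := by
        by_cases hz : f z = 0
        · rw [hχ1 x fun hx => h ⟨hz, hx⟩]; linarith [hχ0 z]
        · rw [hχ1 z hz]; linarith [hχ0 x]
      have h2 := hΛ.dist_le_mul z x
      rw [dist_eq_norm, dist_eq_norm, norm_sub_rev z x] at h2
      refine h2.trans (mul_le_mul_of_nonneg_left ?_ Λ.2)
      exact le_mul_of_one_le_right (norm_nonneg _) h1
  set I : ℝ := ∫ x, χ x with hI
  have hI0 : 0 ≤ I := integral_nonneg hχ0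
  refine ⟨4 * Λ * I, fun a ha => ?_⟩
  have hk := isKernel_gaussKernel ha
  have hk' := isKernel_norm_mul_gaussKernel ha
  set k' : Plane → ℝ := fun x => ‖x‖ * gaussKernel a x with hk'def
  set m : ℝ := ∫ x, k' x with hm
  have hpt : ∀ x, ‖planeConv (gaussKernel a) f x - f x‖ ≤
      Λ * (planeConv k' χ x + m * χ x) := by
    intro x
    have hone : Integrable (fun z => gaussKernel a (x - z)) volume :=
      hk.integrable.comp_sub_left x
    have h1 : planeConv (gaussKernel a) f x - f x =
        ∫ z, gaussKernel a (x - z) * (f z - f x) := by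
      simp only [mul_sub]
      rw [integral_sub (hk.integrable_integrand hfi x) (hone.mul_const _), integral_mul_const,
        integral_sub_left_eq_self (gaussKernel a) volume x, integral_gaussKernel ha, one_mul,
        planeConv]
    have hk'x : Integrable (fun z => k' (x - z)) volume := hk'.integrable.comp_sub_left x
    have h2 : Integrable (fun z => k' (x - z) * χ z + k' (x - z) * χ x) volume :=
      (hk'.integrable_integrand hχi x).add (hk'x.mul_const _)
    rw [h1]
    refine (norm_integral_le_of_norm_le (h2.const_mul Λ) (Eventually.of_forall fun z => ?_)).trans_eq
      ?_
    · rw [norm_mul, Real.norm_of_nonneg (gaussKernel_pos ha _).le]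
      refine (mul_le_mul_of_nonneg_left (hdiff x z) (gaussKernel_pos ha _).le).trans_eq ?_
      simp only [hk'def]
      ring
    · rw [integral_const_mul, integral_add (hk'.integrable_integrand hχi x) (hk'x.mul_const _),
        integral_mul_const, integral_sub_left_eq_self k' volume x]
      rfl
  have hb1 := hk'.integrable_planeConv hχi
  have hb2 : Integrable (fun x => m * χ x) volume := hχi.const_mul m
  have hb : Integrable (fun x => Λ * (planeConv k' χ x + m * χ x)) volume :=
    (hb1.add hb2).const_mul Λ
  have hl : Integrable (fun x => planeConv (gaussKernel a) f x - f x) volume :=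
    (hk.integrable_planeConv hfi).sub hfi
  refine (integral_mono hl.norm hb hpt).trans ?_
  rw [integral_const_mul, integral_add hb1 hb2, hk'.integral_planeConv hχi, integral_const_mul]
  have h3 : m ≤ 2 * √(2 * a) := integral_norm_mul_gaussKernel_le ha
  have h4 : (Λ : ℝ) * (m * I + m * I) = 2 * Λ * I * m := by ring
  have h5 : 4 * Λ * I * √(2 * a) = 2 * Λ * I * (2 * √(2 * a)) := by ring
  change (Λ : ℝ) * (m * I + m * I) ≤ _
  rw [h4, h5]
  exact mul_le_mul_of_nonneg_left h3 (by positivity)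

/-- The diffusion semigroup as a strongly continuous contraction semigroup. -/
theorem exists_diffusion_semigroup {ε : ℝ} (hε : 0 < ε ^ 2) :
    ∃ S : ℝ → L1 →L[ℝ] L1, IsC0Semigroup S ∧
      (∀ t, 0 ≤ t → ∀ v, S t v = diffusion ε t v) ∧
      (∀ t, 0 < t → ∀ f, Integrable f volume →
        S t (toL1 f) = toL1 (planeConv (gaussKernel (ε ^ 2 * t)) f)) ∧
      (∀ t, 0 ≤ t → ∀ v, ‖S t v‖ ≤ ‖v‖) ∧ ∀ t, 0 ≤ t → ∀ v, mass (S t v) = mass v := by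
  have hex : ∀ t, ∃ L : L1 →L[ℝ] L1, (t = 0 → L = ContinuousLinearMap.id ℝ L1) ∧ (0 < t →
      (∀ f, Integrable f volume → L (toL1 f) = toL1 (planeConv (gaussKernel (ε ^ 2 * t)) f)) ∧
      (∀ v : L1, L v = toL1 (planeConv (gaussKernel (ε ^ 2 * t)) v)) ∧ ∀ v, ‖L v‖ ≤ 1 * ‖v‖) := by
    intro t
    by_cases ht : 0 < t
    · have ha : 0 < ε ^ 2 * t := mul_pos hε ht
      obtain ⟨L, hL⟩ := (isKernel_gaussKernel ha).exists_convolution_clm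
      rw [integral_norm_gaussKernel ha] at hL
      exact ⟨L, fun h => absurd h ht.ne', fun _ => hL⟩
    · exact ⟨ContinuousLinearMap.id ℝ L1, fun _ => rfl, fun h => absurd h ht⟩
  choose S hS0 hS using hex
  have hcontr : ∀ t, 0 ≤ t → ∀ v, ‖S t v‖ ≤ 1 * ‖v‖ := by
    intro t ht v
    rcases ht.eq_or_lt with rfl | ht
    · rw [hS0 0 rfl, one_mul]; rfl
    · exact (hS t ht).2.2 v
  refine ⟨S, ?_, fun t ht v => ?_, fun t ht => (hS t ht).1,
    fun t ht v => by simpa using hcontr t ht v, fun t ht v => ?_⟩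
  · refine isC0Semigroup_of_bounded (hS0 0 rfl) ?_ zero_le_one hcontr dense_smooth_L1 ?_
    · intro s t hs ht
      rcases hs.eq_or_lt with rfl | hs
      · rw [hS0 0 rfl, zero_add, ContinuousLinearMap.id_comp]
      rcases ht.eq_or_lt with rfl | ht
      · rw [hS0 0 rfl, add_zero, ContinuousLinearMap.comp_id]
      ext1 v
      have hs' : 0 < ε ^ 2 * s := mul_pos hε hs
      have ht' : 0 < ε ^ 2 * t := mul_pos hε ht
      have hv := L1.integrable_coeFn v
      rw [(hS (s + t) (add_pos hs ht)).2.1, ContinuousLinearMap.comp_apply, (hS t ht).2.1,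
        (hS s hs).1 _ ((isKernel_gaussKernel ht').integrable_planeConv hv),
        (isKernel_gaussKernel hs').planeConv_planeConv (isKernel_gaussKernel ht') hv,
        planeConv_gaussKernel hs' ht', mul_add]
    · rintro v ⟨f, hfi, hfs, hfc, rfl⟩
      obtain ⟨c, hc⟩ := exists_integral_norm_planeConv_sub_le hfs hfc
      rw [tendsto_iff_norm_sub_tendsto_zero]
      have hlim : Tendsto (fun t : ℝ => c * √(2 * (ε ^ 2 * t))) (𝓝[>] 0) (𝓝 0) := by
        have : Tendsto (fun t : ℝ => c * √(2 * (ε ^ 2 * t))) (𝓝 0)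
            (𝓝 (c * √(2 * (ε ^ 2 * 0)))) := Continuous.tendsto (by fun_prop) 0
        simp only [mul_zero, Real.sqrt_zero] at this
        exact this.mono_left nhdsWithin_le_nhds
      refine squeeze_zero' (Eventually.of_forall fun _ => norm_nonneg _) ?_ hlim
      filter_upwards [self_mem_nhdsWithin] with t ht
      have ht' : 0 < ε ^ 2 * t := mul_pos hε ht
      rw [(hS t ht).1 f hfi,
        norm_toL1_sub ((isKernel_gaussKernel ht').integrable_planeConv hfi) hfi]
      exact hc _ ht'
  · rcases ht.eq_or_lt with rfl | ht
    · rw [hS0 0 rfl, diffusion, if_pos rfl]; rfl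
    · rw [(hS t ht).2.1, diffusion, if_neg ht.ne', heatKernel_eq]; rfl
  · rcases ht.eq_or_lt with rfl | ht
    · rw [hS0 0 rfl]; rfl
    · have ht' : 0 < ε ^ 2 * t := mul_pos hε ht
      have hv := L1.integrable_coeFn v
      rw [(hS t ht).2.1, mass_apply, mass_apply,
        integral_toL1 ((isKernel_gaussKernel ht').integrable_planeConv hv),
        (isKernel_gaussKernel ht').integral_planeConv hv, integral_gaussKernel ht', one_mul]

end Diffusion

/-! ### Convection as a small perturbation of diffusion -/

section RelativeBound

/-- A closed subspace is complete, so the integral can be formed inside it. Applied to a closed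
graph, this moves an unbounded operator through a Laplace integral. -/
theorem integral_mem_of_isClosed {F α : Type*} [NormedAddCommGroup F] [NormedSpace ℝ F]
    [CompleteSpace F] [MeasurableSpace α] {μ : Measure α} {G : Submodule ℝ F}
    (hG : IsClosed (G : Set F)) {φ : α → F} (hφ : Integrable φ μ) (h : ∀ᵐ t ∂μ, φ t ∈ G) :
    ∫ t, φ t ∂μ ∈ G := by
  classical
  have : CompleteSpace G := hG.completeSpace_coe
  set ψ : α → G := fun t => if ht : φ t ∈ G then ⟨φ t, ht⟩ else 0 with hψ
  have hψφ : (fun t => (ψ t : F)) =ᵐ[μ] φ := by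
    filter_upwards [h] with t ht
    simp [hψ, ht]
  have hmeas : AEStronglyMeasurable ψ μ :=
    (Topology.IsEmbedding.subtypeVal.aestronglyMeasurable_comp_iff).1
      (hφ.aestronglyMeasurable.congr hψφ.symm)
  have hψi : Integrable ψ μ := hφ.norm.mono' hmeas (hψφ.mono fun t ht => by
    rw [← ht]; exact le_rfl)
  have h2 := G.subtypeL.integral_comp_comm hψi
  rw [← integral_congr_ae hψφ]
  change ∫ t, G.subtypeL (ψ t) ∂μ ∈ G
  rw [h2]
  exact (∫ t, ψ t ∂μ).2

/-- The generator of a semigroup as a linear relation. -/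
def generatorSubmodule {F : Type*} [NormedAddCommGroup F] [NormedSpace ℝ F] (T : ℝ → F →L[ℝ] F) :
    Submodule ℝ (F × F) where
  carrier := generatorGraph (fun t v => T t v)
  add_mem' := fun hp hq => generatorGraph_add_mem hp hq
  zero_mem' := by
    have : Tendsto (fun _ : ℝ => (0 : F)) (𝓝[>] 0) (𝓝 0) := tendsto_const_nhds
    exact this.congr fun t => by simp
  smul_mem' := fun c _ hp => generatorGraph_smul_mem c hp

theorem integral_first_order_mem {F α : Type*} [NormedAddCommGroup F] [NormedSpace ℝ F]
    [CompleteSpace F] [MeasurableSpace α] {μ : Measure α} {G : Submodule ℝ (F × F)}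
    (hG : IsClosed (G : Set (F × F))) (Md M0 M1 : F →L[ℝ] F) {x y z : α → F}
    (hx : Integrable x μ) (hy : Integrable y μ) (hz : Integrable z μ)
    (h : ∀ᵐ t ∂μ, (x t, -Md (x t) - (M0 (y t) + M1 (z t))) ∈ G) :
    (∫ t, x t ∂μ, -Md (∫ t, x t ∂μ) - (M0 (∫ t, y t ∂μ) + M1 (∫ t, z t ∂μ))) ∈ G := by
  have h1 : Integrable (fun t => -Md (x t)) μ := (Md.integrable_comp hx).neg
  have h2 : Integrable (fun t => M0 (y t) + M1 (z t)) μ :=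
    (M0.integrable_comp hy).add (M1.integrable_comp hz)
  have h3 := integral_mem_of_isClosed hG (hx.prodMk (h1.sub h2)) h
  rw [integral_pair hx (h1.sub h2)] at h3
  simp only [Pi.sub_apply] at h3
  rwa [integral_sub h1 h2, integral_neg,
    integral_add (M0.integrable_comp hy) (M1.integrable_comp hz), Md.integral_comp_comm hx,
    M0.integral_comp_comm hy, M1.integral_comp_comm hz] at h3

/-- A closed operator `B` with `‖B R f‖ ≤ q ‖f‖` for `f` in a dense set is defined on the range
of `R`, with the same bound. -/
theorem exists_bound_of_dense {F : Type*} [NormedAddCommGroup F] [NormedSpace ℝ F]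
    [CompleteSpace F] {G : Set (F × F)} (hG : IsClosed G)
    (hsub : ∀ p ∈ G, ∀ p' ∈ G, p - p' ∈ G) (huniq : ∀ x y z, (x, y) ∈ G → (x, z) ∈ G → y = z)
    (R : F →L[ℝ] F) {q : ℝ} (hq : 0 ≤ q) {D : Set F} (hD : Dense D)
    (hDsub : ∀ f ∈ D, ∀ g ∈ D, f - g ∈ D) (h : ∀ f ∈ D, ∃ b, (R f, b) ∈ G ∧ ‖b‖ ≤ q * ‖f‖) (f : F) :
    ∃ b, (R f, b) ∈ G ∧ ‖b‖ ≤ q * ‖f‖ := by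
  obtain ⟨u, huD, hu⟩ := mem_closure_iff_seq_limit.1 (hD f)
  choose b hbG hb using fun n => h (u n) (huD n)
  -- The `b n` are chosen independently; single-valuedness of `G` identifies their differences with
  -- the bounded value attached to `u n - u m`.
  have hdiff : ∀ n m, ‖b n - b m‖ ≤ q * ‖u n - u m‖ := by
    intro n m
    obtain ⟨b', hb'G, hb'⟩ := h (u n - u m) (hDsub _ (huD n) _ (huD m))
    have h1 := hsub _ (hbG n) _ (hbG m)
    rw [Prod.mk_sub_mk, ← map_sub] at h1
    rwa [huniq _ _ _ h1 hb'G]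
  have hcauchy : CauchySeq b := by
    rw [Metric.cauchySeq_iff']
    intro ε hε
    obtain ⟨N, hN⟩ := Metric.cauchySeq_iff'.1 hu.cauchySeq (ε / (q + 1)) (by positivity)
    refine ⟨N, fun n hn => ?_⟩
    have h1 := hN n hn
    rw [dist_eq_norm, lt_div_iff₀ (by positivity)] at h1
    rw [dist_eq_norm]
    refine (hdiff n N).trans_lt ?_
    linarith [norm_nonneg (u n - u N)]
  obtain ⟨b₀, hb₀⟩ := cauchySeq_tendsto_of_complete hcauchy
  refine ⟨b₀, hG.mem_of_tendsto (((R.continuous.tendsto f).comp hu).prodMk_nhds hb₀)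
    (Eventually.of_forall hbG), ?_⟩
  exact le_of_tendsto_of_tendsto hb₀.norm (hu.norm.const_mul q) (Eventually.of_forall hb)

theorem smul_first_order_mem {F : Type*} [NormedAddCommGroup F] [NormedSpace ℝ F]
    (G : Submodule ℝ (F × F)) (Md M0 M1 : F →L[ℝ] F) {x y z : F}
    (h : (x, -Md x - (M0 y + M1 z)) ∈ G) (c : ℝ) :
    (c • x, -Md (c • x) - (M0 (c • y) + M1 (c • z))) ∈ G := by
  have h1 := G.smul_mem c h
  rwa [Prod.smul_mk, smul_sub, smul_neg, smul_add, ← map_smul Md, ← map_smul M0,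
    ← map_smul M1] at h1

theorem integrable_fderiv_apply {f : Plane → ℝ} (hf : HasCompactSupport f) (hfc : ContDiff ℝ 1 f)
    (e : Plane) : Integrable (fun z => fderiv ℝ f z e) volume := by
  have h1 := hfc.continuous_fderiv one_ne_zero
  refine Continuous.integrable_of_hasCompactSupport (by fun_prop) ?_
  exact (hf.fderiv ℝ).comp_left (g := fun L : Plane →L[ℝ] ℝ => L e) rfl

variable {C : Plane → Plane}

/-- The smoothing estimate: moving the derivative to the kernel costs a factor `t^(-1/2)`,
integrable at zero, and its Laplace transform is `Γ(1/2) l^(-1/2)`. The bound involves only the `L¹`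
norm of `f`, not its derivatives. -/
theorem norm_laplace_fderiv_le {ε : ℝ} (hε : 0 < ε ^ 2) {S : ℝ → L1 →L[ℝ] L1}
    (hS : ∀ t, 0 < t → ∀ f, Integrable f volume →
        S t (toL1 f) = toL1 (planeConv (gaussKernel (ε ^ 2 * t)) f))
    {f : Plane → ℝ} (hf : HasCompactSupport f) (hfc : ContDiff ℝ 1 f) (i : Fin 2) {l : ℝ}
    (hl : 0 < l) :
    ‖∫ t in Set.Ioi (0 : ℝ), Real.exp (-(l * t)) •
        S t (toL1 fun z => fderiv ℝ f z (EuclideanSpace.single i 1))‖ ≤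
      √(2 * ε ^ 2) / ε ^ 2 * Real.Gamma (1 / 2) * (1 / l) ^ (1 / 2 : ℝ) * ‖toL1 f‖ := by
  have hfi := hfc.continuous.integrable_of_hasCompactSupport hf (μ := volume)
  have hbound : ∀ t, 0 < t → ‖S t (toL1 fun z => fderiv ℝ f z (EuclideanSpace.single i 1))‖ ≤
      √(2 * ε ^ 2) / ε ^ 2 * t ^ ((1 / 2 : ℝ) - 1) * ‖toL1 f‖ := by
    intro t ht
    have ha : 0 < ε ^ 2 * t := mul_pos hε ht
    have hk := isKernel_fderiv_gaussKernel ha i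
    rw [hS t ht _ (integrable_fderiv_apply hf hfc _), planeConv_gaussKernel_fderiv ha hf hfc,
      norm_toL1 (hk.integrable_planeConv hfi), norm_toL1 hfi]
    refine (hk.integral_norm_planeConv_le hfi).trans
      (mul_le_mul_of_nonneg_right ?_ (integral_nonneg fun _ => norm_nonneg _))
    refine (integral_norm_fderiv_gaussKernel_le ha i).trans_eq ?_
    have h1 : t ^ ((1 / 2 : ℝ) - 1) = √t / t := by
      rw [Real.rpow_sub ht, Real.rpow_one, Real.sqrt_eq_rpow]
    rw [h1, ← mul_assoc, Real.sqrt_mul (by positivity)]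
    field_simp
  have hint : IntegrableOn (fun t : ℝ => t ^ ((1 / 2 : ℝ) - 1) * Real.exp (-(l * t)))
      (Set.Ioi 0) := by
    refine Integrable.of_integral_ne_zero ?_
    rw [Real.integral_rpow_mul_exp_neg_mul_Ioi (by norm_num) hl]
    have := Real.Gamma_pos_of_pos (show (0 : ℝ) < 1 / 2 by norm_num)
    positivity
  refine (norm_integral_le_of_norm_le
    ((hint.const_mul (√(2 * ε ^ 2) / ε ^ 2)).mul_const ‖toL1 f‖) ?_).trans_eq ?_
  · filter_upwards [ae_restrict_mem measurableSet_Ioi] with t ht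
    rw [norm_smul, Real.norm_of_nonneg (Real.exp_pos _).le]
    refine (mul_le_mul_of_nonneg_left (hbound t ht) (Real.exp_pos _).le).trans_eq ?_
    ring
  · rw [integral_mul_const, integral_const_mul,
      Real.integral_rpow_mul_exp_neg_mul_Ioi (by norm_num) hl]
    ring

theorem IsVelocityField.diffusion_mem_generatorGraph (hC : IsVelocityField C)
    {V : ℝ → L1 →L[ℝ] L1} (hV : IsC0Semigroup V)
    (hVf : ∀ t, 0 ≤ t → ∀ f, Integrable f volume → V t (toL1 f) = toL1 (transport C t f))
    {Md M0 M1 : L1 →L[ℝ] L1}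
    (hMd : ∀ f, Integrable f volume → Md (toL1 f) = toL1 fun x => divergence C x * f x)
    (hM0 : ∀ f, Integrable f volume → M0 (toL1 f) = toL1 fun x => C x 0 * f x)
    (hM1 : ∀ f, Integrable f volume → M1 (toL1 f) = toL1 fun x => C x 1 * f x)
    {f : Plane → ℝ} (hf : HasCompactSupport f) (hfc : ContDiff ℝ 1 f) {a : ℝ} (ha : 0 < a) :
    (toL1 (planeConv (gaussKernel a) f),
      -Md (toL1 (planeConv (gaussKernel a) f)) -
        (M0 (toL1 (planeConv (gaussKernel a) fun z => fderiv ℝ f z (EuclideanSpace.single 0 1))) +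
        M1 (toL1 (planeConv (gaussKernel a) fun z => fderiv ℝ f z (EuclideanSpace.single 1 1)))))
      ∈ generatorGraph (fun t v => V t v) := by
  have hk := isKernel_gaussKernel ha
  have hfi := hfc.continuous.integrable_of_hasCompactSupport hf (μ := volume)
  obtain ⟨B, -, hB⟩ := hC.exists_abs_divergence_le
  obtain ⟨M, hM⟩ := hC.bounded
  have hCc := hC.contDiff.continuous
  set g := planeConv (gaussKernel a) f with hg
  set g0 := planeConv (gaussKernel a) fun z => fderiv ℝ f z (EuclideanSpace.single 0 1) with hg0
  set g1 := planeConv (gaussKernel a) fun z => fderiv ℝ f z (EuclideanSpace.single 1 1) with hg1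
  have hgi : Integrable g volume := hk.integrable_planeConv hfi
  have hg0i : Integrable g0 volume := hk.integrable_planeConv (integrable_fderiv_apply hf hfc _)
  have hg1i : Integrable g1 volume := hk.integrable_planeConv (integrable_fderiv_apply hf hfc _)
  have hconv : convectionOperator C g =
      fun x => (-1) * (divergence C x * g x) - (C x 0 * g0 x + C x 1 * g1 x) := by
    funext x
    rw [convectionOperator, hg, hk.fderiv_planeConv_apply hf hfc, hk.fderiv_planeConv_apply hf hfc,
      neg_one_mul]
  have i1 : Integrable (fun x => divergence C x * g x) volume :=
    hgi.bdd_mul hC.continuous_divergence.aestronglyMeasurable (Eventually.of_forall hB)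
  have i2 : Integrable (fun x => C x 0 * g0 x) volume :=
    hg0i.bdd_mul (Continuous.aestronglyMeasurable (by fun_prop))
      (Eventually.of_forall fun x => (abs_coord_le_norm (C x) 0).trans (hM x))
  have i3 : Integrable (fun x => C x 1 * g1 x) volume :=
    hg1i.bdd_mul (Continuous.aestronglyMeasurable (by fun_prop))
      (Eventually.of_forall fun x => (abs_coord_le_norm (C x) 1).trans (hM x))
  have i23 : Integrable (fun x => C x 0 * g0 x + C x 1 * g1 x) volume := i2.add i3
  have hci : Integrable (convectionOperator C g) volume := by
    rw [hconv]; exact (i1.const_mul (-1)).sub i23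
  have h1 := hC.mem_generatorGraph_of_contDiff hV hVf (hk.contDiff_planeConv hf hfc) hgi hci
  have h2 : toL1 (convectionOperator C g) =
      -Md (toL1 g) - (M0 (toL1 g0) + M1 (toL1 g1)) := by
    rw [hconv, toL1_sub (i1.const_mul (-1)) i23, toL1_add i2 i3, toL1_smul (-1) i1, hMd g hgi,
      hM0 g0 hg0i, hM1 g1 hg1i, neg_one_smul]
  rwa [h2] at h1

/-- Closedness of the convection generator carries the formula `-div(C) g - C · ∇g` from each
heat-smoothed `g` to the resolvent. The derivatives stay on `f`, where `norm_laplace_fderiv_le`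
controls them. -/
theorem IsVelocityField.laplace_mem_generatorGraph (hC : IsVelocityField C) {ε : ℝ}
    (hε : 0 < ε ^ 2) {S V : ℝ → L1 →L[ℝ] L1} (hS : IsC0Semigroup S) (hV : IsC0Semigroup V)
    (hSf : ∀ t, 0 < t → ∀ f, Integrable f volume →
        S t (toL1 f) = toL1 (planeConv (gaussKernel (ε ^ 2 * t)) f))
    (hVf : ∀ t, 0 ≤ t → ∀ f, Integrable f volume → V t (toL1 f) = toL1 (transport C t f))
    (hSle : ∀ t, 0 ≤ t → ∀ v, ‖S t v‖ ≤ ‖v‖) (hVle : ∀ t, 0 ≤ t → ∀ v, ‖V t v‖ ≤ ‖v‖)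
    {Md M0 M1 : L1 →L[ℝ] L1}
    (hMd : ∀ f, Integrable f volume → Md (toL1 f) = toL1 fun x => divergence C x * f x)
    (hM0 : ∀ f, Integrable f volume → M0 (toL1 f) = toL1 fun x => C x 0 * f x)
    (hM1 : ∀ f, Integrable f volume → M1 (toL1 f) = toL1 fun x => C x 1 * f x)
    {l : ℝ} (hl : 0 < l) {R : L1 →L[ℝ] L1}
    (hR : ∀ f, R f = ∫ t in Set.Ioi (0 : ℝ), Real.exp (-(l * t)) • S t f)
    {f : Plane → ℝ} (hfi : Integrable f volume) (hfs : HasCompactSupport f)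
    (hfc : ContDiff ℝ 1 f) :
    (R (toL1 f), -Md (R (toL1 f)) -
      (M0 (R (toL1 fun z => fderiv ℝ f z (EuclideanSpace.single 0 1))) +
        M1 (R (toL1 fun z => fderiv ℝ f z (EuclideanSpace.single 1 1))))) ∈
      generatorSubmodule V := by
  have hGclosed : IsClosed (generatorSubmodule V : Set (L1 × L1)) :=
    hV.isClosed_generatorGraph (M := 1) fun t ht x => by simpa using hVle t ht x
  rw [hR, hR, hR]
  refine integral_first_order_mem hGclosed Md M0 M1 (hS.resolvent_integrableOn hSle hl _)
    (hS.resolvent_integrableOn hSle hl _) (hS.resolvent_integrableOn hSle hl _) ?_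
  filter_upwards [ae_restrict_mem measurableSet_Ioi] with t ht
  have h2 := hC.diffusion_mem_generatorGraph hV hVf hMd hM0 hM1 hfs hfc (mul_pos hε ht)
  rw [← hSf t ht f hfi, ← hSf t ht _ (integrable_fderiv_apply hfs hfc _),
    ← hSf t ht _ (integrable_fderiv_apply hfs hfc _)] at h2
  exact smul_first_order_mem (generatorSubmodule V) Md M0 M1 h2 (Real.exp (-(l * t)))

set_option maxHeartbeats 1000000 in
/-- The generator of the convection semigroup is bounded relative to the generator of the
diffusion semigroup, with relative bound zero. -/
theorem IsVelocityField.exists_relative_bound (hC : IsVelocityField C) {ε : ℝ} (hε : 0 < ε ^ 2)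
    {S V : ℝ → L1 →L[ℝ] L1} (hS : IsC0Semigroup S) (hV : IsC0Semigroup V)
    (hSf : ∀ t, 0 < t → ∀ f, Integrable f volume →
        S t (toL1 f) = toL1 (planeConv (gaussKernel (ε ^ 2 * t)) f))
    (hVf : ∀ t, 0 ≤ t → ∀ f, Integrable f volume → V t (toL1 f) = toL1 (transport C t f))
    (hSle : ∀ t, 0 ≤ t → ∀ v, ‖S t v‖ ≤ ‖v‖) (hVle : ∀ t, 0 ≤ t → ∀ v, ‖V t v‖ ≤ ‖v‖) :
    ∃ q : ℝ → ℝ, Tendsto q atTop (𝓝 0) ∧ ∀ l, 0 < l → 0 ≤ q l ∧ ∀ R : L1 →L[ℝ] L1,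
      (∀ f, R f = ∫ t in Set.Ioi (0 : ℝ), Real.exp (-(l * t)) • S t f) →
      ∀ f, ∃ b, (R f, b) ∈ generatorGraph (fun t v => V t v) ∧ ‖b‖ ≤ q l * ‖f‖ := by
  obtain ⟨B, hB0, hB⟩ := hC.exists_abs_divergence_le
  obtain ⟨M, hM⟩ := hC.bounded
  have hMnn : 0 ≤ M := (norm_nonneg _).trans (hM 0)
  have hCc := hC.contDiff.continuous
  obtain ⟨Md, hMd, hMdn⟩ := exists_mul_clm hC.continuous_divergence hB
  obtain ⟨M0, hM0, hM0n⟩ := exists_mul_clm (c := fun x => C x 0) (by fun_prop)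
    fun x => (abs_coord_le_norm (C x) 0).trans (hM x)
  obtain ⟨M1, hM1, hM1n⟩ := exists_mul_clm (c := fun x => C x 1) (by fun_prop)
    fun x => (abs_coord_le_norm (C x) 1).trans (hM x)
  set κ : ℝ := √(2 * ε ^ 2) / ε ^ 2 * Real.Gamma (1 / 2) with hκ
  have hκ0 : 0 ≤ κ := mul_nonneg (by positivity) (Real.Gamma_pos_of_pos (by norm_num)).le
  set G := generatorSubmodule V
  have hGclosed : IsClosed (G : Set (L1 × L1)) :=
    hV.isClosed_generatorGraph (M := 1) fun t ht x => by simpa using hVle t ht x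
  -- The first term comes from the divergence and the resolvent bound `1 / l`, the second from the
  -- two components of `C`, each at most `M`, times a derivative of the resolvent.
  refine ⟨fun l => B * l⁻¹ + 2 * M * κ * (1 / l) ^ (1 / 2 : ℝ), ?_, fun l hl => ⟨by positivity,
    fun R hR f => ?_⟩⟩
  · have h1 : Tendsto (fun l : ℝ => (1 / l) ^ (1 / 2 : ℝ)) atTop (𝓝 0) := by
      have h2 := tendsto_inv_atTop_zero (𝕜 := ℝ)
      have h3 := h2.rpow_const (p := (1 / 2 : ℝ)) (Or.inr (by norm_num))
      rw [Real.zero_rpow (by norm_num)] at h3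
      simpa using h3
    have h4 := (tendsto_inv_atTop_zero.const_mul B).add (h1.const_mul (2 * M * κ))
    simpa using h4
  refine exists_bound_of_dense hGclosed (fun p hp p' hp' => G.sub_mem hp hp')
    (fun x y z hy hz => generatorGraph_unique hy hz) R (by positivity) dense_smooth_L1 ?_ ?_ f
  · rintro _ ⟨f, hfi, hfs, hfc, rfl⟩ _ ⟨g, hgi, hgs, hgc, rfl⟩
    refine ⟨fun x => f x - g x, hfi.sub hgi, hfs.sub hgs, hfc.sub hgc, (toL1_sub hfi hgi).symm⟩
  rintro _ ⟨f, hfi, hfs, hfc, rfl⟩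
  have hmem := hC.laplace_mem_generatorGraph hε hS hV hSf hVf hSle hVle hMd hM0 hM1 hl hR hfi hfs
    hfc
  have b2 := norm_laplace_fderiv_le hε hSf hfs hfc 0 hl
  have b3 := norm_laplace_fderiv_le hε hSf hfs hfc 1 hl
  rw [← hR, ← hκ] at b2 b3
  generalize R (toL1 fun z => fderiv ℝ f z (EuclideanSpace.single 0 1)) = F0 at hmem b2
  generalize R (toL1 fun z => fderiv ℝ f z (EuclideanSpace.single 1 1)) = F1 at hmem b3
  refine ⟨_, hmem, ?_⟩
  have b1 : ‖R (toL1 f)‖ ≤ l⁻¹ * ‖toL1 f‖ := by rw [hR]; exact IsC0Semigroup.norm_laplace_le hSle hl _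
  calc ‖-Md (R (toL1 f)) - (M0 F0 + M1 F1)‖
      ≤ ‖Md (R (toL1 f))‖ + (‖M0 F0‖ + ‖M1 F1‖) := by
        refine (norm_sub_le _ _).trans ?_
        rw [norm_neg]
        exact add_le_add le_rfl (norm_add_le _ _)
    _ ≤ B * (l⁻¹ * ‖toL1 f‖) + (M * (κ * (1 / l) ^ (1 / 2 : ℝ) * ‖toL1 f‖) +
        M * (κ * (1 / l) ^ (1 / 2 : ℝ) * ‖toL1 f‖)) := by
        refine add_le_add ((hMdn _).trans ?_) (add_le_add ((hM0n _).trans ?_) ((hM1n _).trans ?_))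
        · exact mul_le_mul_of_nonneg_left b1 hB0
        · exact mul_le_mul_of_nonneg_left b2 hMnn
        · exact mul_le_mul_of_nonneg_left b3 hMnn
    _ = _ := by ring

end RelativeBound

/-! ### The coupled operator: dissipativity, range and mass -/

section Coupled

variable {E : Type*} [NormedAddCommGroup E] [NormedSpace ℝ E]

/-- A norming functional of `v` is nonpositive on the generator of a contraction semigroup
at `v`. -/
theorem norming_functional_generator_nonpos {S : ℝ → E →L[ℝ] E}
    (hle : ∀ t, 0 ≤ t → ∀ v, ‖S t v‖ ≤ ‖v‖) {v a : E}
    (h : (v, a) ∈ generatorGraph (fun t v => S t v)) {ψ : StrongDual ℝ E} (hψ : ‖ψ‖ ≤ 1)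
    (hψv : ψ v = ‖v‖) : ψ a ≤ 0 := by
  have h1 : Tendsto (fun t : ℝ => ψ (t⁻¹ • (S t v - v))) (𝓝[>] 0) (𝓝 (ψ a)) :=
    (ψ.continuous.tendsto a).comp h
  refine le_of_tendsto h1 ?_
  filter_upwards [self_mem_nhdsWithin] with t ht
  have ht : 0 < t := ht
  rw [map_smul, map_sub, hψv, smul_eq_mul]
  refine mul_nonpos_of_nonneg_of_nonpos (inv_nonneg.2 ht.le) (sub_nonpos.2 ?_)
  refine (Real.le_norm_self _).trans ((ψ.le_opNorm _).trans ?_)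
  nlinarith [hle t ht.le v, norm_nonneg (S t v)]

theorem functional_generator_eq_zero {S : ℝ → E →L[ℝ] E} {m : StrongDual ℝ E}
    (hm : ∀ t, 0 ≤ t → ∀ v, m (S t v) = m v) {v a : E}
    (h : (v, a) ∈ generatorGraph (fun t v => S t v)) : m a = 0 := by
  have h1 : Tendsto (fun t : ℝ => m (t⁻¹ • (S t v - v))) (𝓝[>] 0) (𝓝 (m a)) :=
    (m.continuous.tendsto a).comp h
  refine tendsto_nhds_unique h1 (tendsto_const_nhds.congr' ?_)
  filter_upwards [self_mem_nhdsWithin] with t ht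
  rw [map_smul, map_sub, hm t (le_of_lt ht), sub_self, smul_zero]

/-- The graph of `(u, v, w) ↦ (-γ u + χ m(w), (A + B) v - α v + γ u g, α v - χ w)`, where `A` and
`B` generate `S` and `V`. -/
def coupledGraph (S V : ℝ → E →L[ℝ] E) (m : StrongDual ℝ E) (g : E) (α γ χ : ℝ) :
    Set ((ℝ × E × E) × (ℝ × E × E)) :=
  {p | ∃ a b : E, (p.1.2.1, a) ∈ generatorGraph (fun t v => S t v) ∧
    (p.1.2.1, b) ∈ generatorGraph (fun t v => V t v) ∧
    p.2 = (-γ * p.1.1 + χ * m p.1.2.2, a + b - α • p.1.2.1 + (γ * p.1.1) • g,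
      α • p.1.2.1 - χ • p.1.2.2)}

variable {S V : ℝ → E →L[ℝ] E} {m : StrongDual ℝ E} {g : E} {α γ χ : ℝ}

theorem mem_coupledGraph {u : ℝ} {v w : E} {z : ℝ × E × E} :
    ((u, v, w), z) ∈ coupledGraph S V m g α γ χ ↔
      ∃ a b : E, (v, a) ∈ generatorGraph (fun t v => S t v) ∧
        (v, b) ∈ generatorGraph (fun t v => V t v) ∧
        z = (-γ * u + χ * m w, a + b - α • v + (γ * u) • g, α • v - χ • w) := Iff.rfl

theorem coupledGraph_add_mem {p q : (ℝ × E × E) × (ℝ × E × E)}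
    (hp : p ∈ coupledGraph S V m g α γ χ) (hq : q ∈ coupledGraph S V m g α γ χ) :
    p + q ∈ coupledGraph S V m g α γ χ := by
  obtain ⟨a, b, ha, hb, h⟩ := hp
  obtain ⟨a', b', ha', hb', h'⟩ := hq
  refine ⟨a + a', b + b', generatorGraph_add_mem ha ha', generatorGraph_add_mem hb hb', ?_⟩
  rw [Prod.snd_add, h, h']
  simp only [Prod.fst_add, Prod.snd_add, map_add, Prod.mk_add_mk, Prod.mk.injEq]
  refine ⟨by ring, by module, by module⟩

theorem coupledGraph_smul_mem (c : ℝ) {p : (ℝ × E × E) × (ℝ × E × E)}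
    (hp : p ∈ coupledGraph S V m g α γ χ) : c • p ∈ coupledGraph S V m g α γ χ := by
  obtain ⟨a, b, ha, hb, h⟩ := hp
  refine ⟨c • a, c • b, generatorGraph_smul_mem c ha, generatorGraph_smul_mem c hb, ?_⟩
  rw [Prod.smul_snd, h]
  simp only [Prod.smul_fst, Prod.smul_snd, map_smul, Prod.smul_mk, Prod.mk.injEq, smul_eq_mul]
  refine ⟨by ring, by module, by module⟩

/-- The sum norm on `ℝ × E × E`. -/
def sumNorm (E : Type*) [NormedAddCommGroup E] [NormedSpace ℝ E] : Seminorm ℝ (ℝ × E × E) :=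
  Seminorm.of (fun x => |x.1| + ‖x.2.1‖ + ‖x.2.2‖)
    (fun x y => by
      have h1 := abs_add_le x.1 y.1
      have h2 := norm_add_le x.2.1 y.2.1
      have h3 := norm_add_le x.2.2 y.2.2
      simp only [Prod.fst_add, Prod.snd_add]
      linarith)
    (fun c x => by
      simp only [Prod.smul_fst, Prod.smul_snd, norm_smul, smul_eq_mul, abs_mul, Real.norm_eq_abs]
      ring)

theorem sumNorm_apply (x : ℝ × E × E) : sumNorm E x = |x.1| + ‖x.2.1‖ + ‖x.2.2‖ := rfl

theorem norm_le_sumNorm (x : ℝ × E × E) : ‖x‖ ≤ sumNorm E x := by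
  rw [sumNorm_apply, Prod.norm_def, Prod.norm_def, Real.norm_eq_abs]
  have := abs_nonneg x.1
  have := norm_nonneg x.2.1
  have := norm_nonneg x.2.2
  refine max_le (by linarith) (max_le (by linarith) (by linarith))

theorem sumNorm_le (x : ℝ × E × E) : sumNorm E x ≤ 3 * ‖x‖ := by
  rw [sumNorm_apply]
  have h1 : |x.1| ≤ ‖x‖ := norm_fst_le x
  have h2 := norm_snd_le x
  have h3 := norm_fst_le x.2
  have h4 := norm_snd_le x.2
  linarith

/-- The total amount `u + m(v) + m(w)`. -/
def totalMass (m : StrongDual ℝ E) : StrongDual ℝ (ℝ × E × E) :=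
  ContinuousLinearMap.fst ℝ ℝ (E × E) +
    (m ∘L ContinuousLinearMap.fst ℝ E E ∘L ContinuousLinearMap.snd ℝ ℝ (E × E) +
      m ∘L ContinuousLinearMap.snd ℝ E E ∘L ContinuousLinearMap.snd ℝ ℝ (E × E))

theorem totalMass_apply (m : StrongDual ℝ E) (x : ℝ × E × E) :
    totalMass m x = x.1 + (m x.2.1 + m x.2.2) := rfl

/-- Both generators produce zero mass because their semigroups conserve it, and the exchange terms
cancel in pairs; `m g = 1` is needed for the `γ` terms. -/
theorem totalMass_coupledGraph (hmS : ∀ t, 0 ≤ t → ∀ v, m (S t v) = m v)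
    (hmV : ∀ t, 0 ≤ t → ∀ v, m (V t v) = m v) (hg : m g = 1) {x z : ℝ × E × E}
    (h : (x, z) ∈ coupledGraph S V m g α γ χ) : totalMass m z = 0 := by
  obtain ⟨u, v, w⟩ := x
  obtain ⟨a, b, ha, hb, rfl⟩ := mem_coupledGraph.1 h
  rw [totalMass_apply]
  simp only [map_add, map_sub, map_smul, smul_eq_mul, hg, functional_generator_eq_zero hmS ha,
    functional_generator_eq_zero hmV hb]
  ring

/-- Each component of `x - h • z` is tested against a norming functional of the same component of
`x`. The generators contribute with a favourable sign, and the losses `γ |u|`, `α ‖v‖`, `χ ‖w‖`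
dominate the gains because `‖g‖ ≤ 1` and `|m w| ≤ ‖w‖`. -/
theorem sumNorm_dissipative (hSle : ∀ t, 0 ≤ t → ∀ v, ‖S t v‖ ≤ ‖v‖)
    (hVle : ∀ t, 0 ≤ t → ∀ v, ‖V t v‖ ≤ ‖v‖) (hm : ∀ v, |m v| ≤ ‖v‖) (hg : ‖g‖ ≤ 1)
    (hα : 0 ≤ α) (hγ : 0 ≤ γ) (hχ : 0 ≤ χ) {x z : ℝ × E × E}
    (hxz : (x, z) ∈ coupledGraph S V m g α γ χ) {h : ℝ} (hh : 0 < h) :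
    sumNorm E x ≤ sumNorm E (x - h • z) := by
  obtain ⟨u, v, w⟩ := x
  obtain ⟨a, b, ha, hb, rfl⟩ := mem_coupledGraph.1 hxz
  obtain ⟨s, hs, hsu⟩ : ∃ s : ℝ, |s| ≤ 1 ∧ s * u = |u| := by
    rcases le_total 0 u with hu | hu
    · exact ⟨1, by simp, by rw [abs_of_nonneg hu, one_mul]⟩
    · exact ⟨-1, by simp, by rw [abs_of_nonpos hu]; ring⟩
  obtain ⟨ψ, hψ, hψv⟩ := exists_dual_vector'' ℝ v
  obtain ⟨φ, hφ, hφw⟩ := exists_dual_vector'' ℝ w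
  simp only [RCLike.ofReal_real_eq_id, id_eq] at hψv hφw
  have e1 := norming_functional_generator_nonpos hSle ha hψ hψv
  have e2 := norming_functional_generator_nonpos hVle hb hψ hψv
  have bound : ∀ {θ : StrongDual ℝ E}, ‖θ‖ ≤ 1 → ∀ y, θ y ≤ ‖y‖ := fun {θ} hθ y =>
    (Real.le_norm_self _).trans ((θ.le_opNorm y).trans (mul_le_of_le_one_left (norm_nonneg _) hθ))
  have habs : ∀ r : ℝ, s * r ≤ |r| := fun r => by
    refine (le_abs_self _).trans ?_
    rw [abs_mul]
    exact mul_le_of_le_one_left (abs_nonneg r) hs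
  simp only [sumNorm_apply, Prod.smul_mk, Prod.mk_sub_mk, smul_eq_mul]
  have f1 := habs (u - h * (-γ * u + χ * m w))
  have f2 := bound hψ (v - h • (a + b - α • v + (γ * u) • g))
  have f3 := bound hφ (w - h • (α • v - χ • w))
  simp only [map_sub, map_add, map_smul, smul_eq_mul, hψv, hφw] at f2 f3
  have k1 : s * m w ≤ ‖w‖ := (habs _).trans (hm w)
  have k2 : u * ψ g ≤ |u| := by
    refine (le_abs_self _).trans ?_
    rw [abs_mul]
    refine mul_le_of_le_one_right (abs_nonneg u) ?_
    exact (ψ.le_opNorm g).trans (mul_le_one₀ hψ (norm_nonneg _) hg)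
  have k3 := bound hφ v
  have j1 : h * χ * (s * m w) ≤ h * χ * ‖w‖ := mul_le_mul_of_nonneg_left k1 (by positivity)
  have j2 : h * γ * (u * ψ g) ≤ h * γ * |u| := mul_le_mul_of_nonneg_left k2 (by positivity)
  have j3 : h * α * φ v ≤ h * α * ‖v‖ := mul_le_mul_of_nonneg_left k3 (by positivity)
  have j4 : h * ψ a ≤ 0 := mul_nonpos_of_nonneg_of_nonpos hh.le e1
  have j5 : h * ψ b ≤ 0 := mul_nonpos_of_nonneg_of_nonpos hh.le e2
  have f1' : |u| + h * γ * |u| - h * χ * (s * m w) ≤ |u - h * (-γ * u + χ * m w)| := by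
    refine le_trans (le_of_eq ?_) f1
    rw [← hsu]; ring
  linarith

/-- The range of `l - G` is everything, once `V`'s generator is sufficiently small relative to the
resolvent of `S`. -/
theorem coupledGraph_range [CompleteSpace E] (hm : ∀ v, |m v| ≤ ‖v‖) (hg : ‖g‖ ≤ 1)
    (hα : 0 ≤ α) (hγ : 0 ≤ γ) (hχ : 0 ≤ χ) {l : ℝ} (hl : 0 < l) {R : E →L[ℝ] E}
    (hR : ∀ f, (R f, l • R f - f) ∈ generatorGraph (fun t v => S t v))
    (hRn : ∀ f, ‖R f‖ ≤ l⁻¹ * ‖f‖) {q : ℝ} (hq0 : 0 ≤ q)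
    (hQ : ∀ f, ∃ b, (R f, b) ∈ generatorGraph (fun t v => V t v) ∧ ‖b‖ ≤ q * ‖f‖)
    (hq : q + (α + γ + χ) * l⁻¹ < 1) (F : ℝ × E × E) :
    ∃ x z, (x, z) ∈ coupledGraph S V m g α γ χ ∧ l • x - z = F := by
  choose b hb hbn using hQ
  let Q : E →L[ℝ] E := LinearMap.mkContinuous
    { toFun := b
      map_add' := fun f f' => by
        have h1 := generatorGraph_add_mem (hb f) (hb f')
        rw [Prod.mk_add_mk, ← map_add] at h1
        exact generatorGraph_unique (hb _) h1
      map_smul' := fun c f => by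
        have h1 := generatorGraph_smul_mem c (hb f)
        rw [Prod.smul_mk, ← map_smul] at h1
        exact generatorGraph_unique (hb _) h1 } q hbn
  have hQb : ∀ f, Q f = b f := fun _ => rfl
  -- With `x = (y₁ / l, R y₂, y₃ / l)` one has `(l - G) x = Y - P Y`, so inverting `1 - P` by a
  -- Neumann series solves the resolvent equation. The operator `Q` is the generator of `V` composed
  -- with `R`.
  let P : (ℝ × E × E) →L[ℝ] (ℝ × E × E) :=
    ((-(γ * l⁻¹)) • ContinuousLinearMap.fst ℝ ℝ (E × E) +
      (χ * l⁻¹) • (m ∘L ContinuousLinearMap.snd ℝ E E ∘L ContinuousLinearMap.snd ℝ ℝ (E × E))).prod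
    (((Q - α • R) ∘L ContinuousLinearMap.fst ℝ E E ∘L ContinuousLinearMap.snd ℝ ℝ (E × E) +
      (γ * l⁻¹) • (ContinuousLinearMap.fst ℝ ℝ (E × E)).smulRight g).prod
    (α • (R ∘L ContinuousLinearMap.fst ℝ E E ∘L ContinuousLinearMap.snd ℝ ℝ (E × E)) -
      (χ * l⁻¹) • (ContinuousLinearMap.snd ℝ E E ∘L ContinuousLinearMap.snd ℝ ℝ (E × E))))
  have hP : ∀ Y, P Y = (-(γ * l⁻¹) * Y.1 + (χ * l⁻¹) * m Y.2.2,
      Q Y.2.1 - α • R Y.2.1 + (γ * l⁻¹) • (Y.1 • g),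
      α • R Y.2.1 - (χ * l⁻¹) • Y.2.2) := fun _ => rfl
  have hli : 0 < l⁻¹ := inv_pos.2 hl
  have hPn : ‖P‖ < 1 := by
    refine lt_of_le_of_lt (P.opNorm_le_bound (by positivity) fun Y => ?_) hq
    have h1 : |Y.1| ≤ ‖Y‖ := norm_fst_le Y
    have h2 : ‖Y.2.1‖ ≤ ‖Y‖ := (norm_fst_le Y.2).trans (norm_snd_le Y)
    have h3 : ‖Y.2.2‖ ≤ ‖Y‖ := (norm_snd_le Y.2).trans (norm_snd_le Y)
    have hY := norm_nonneg Y
    have k0 : q * ‖Y.2.1‖ ≤ q * ‖Y‖ := mul_le_mul_of_nonneg_left h2 hq0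
    have kα : ‖α • R Y.2.1‖ ≤ α * l⁻¹ * ‖Y‖ := by
      rw [norm_smul, Real.norm_of_nonneg hα, mul_assoc]
      exact mul_le_mul_of_nonneg_left
        ((hRn _).trans (mul_le_mul_of_nonneg_left h2 hli.le)) hα
    have nq : 0 ≤ q * ‖Y‖ := by positivity
    have nα : 0 ≤ α * l⁻¹ * ‖Y‖ := by positivity
    have nγ : 0 ≤ γ * l⁻¹ * ‖Y‖ := by positivity
    have nχ : 0 ≤ χ * l⁻¹ * ‖Y‖ := by positivity
    have hsum : (q + (α + γ + χ) * l⁻¹) * ‖Y‖ =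
      q * ‖Y‖ + α * l⁻¹ * ‖Y‖ + γ * l⁻¹ * ‖Y‖ + χ * l⁻¹ * ‖Y‖ := by ring
    rw [hP, hsum]
    refine max_le ?_ (max_le ?_ ?_)
    · refine (norm_add_le _ _).trans ?_
      rw [norm_mul, norm_mul, norm_neg, Real.norm_of_nonneg (show 0 ≤ γ * l⁻¹ by positivity),
        Real.norm_of_nonneg (show 0 ≤ χ * l⁻¹ by positivity), Real.norm_eq_abs, Real.norm_eq_abs]
      have a1 : γ * l⁻¹ * |Y.1| ≤ γ * l⁻¹ * ‖Y‖ := by gcongr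
      have a2 : χ * l⁻¹ * |m Y.2.2| ≤ χ * l⁻¹ * ‖Y‖ := by
        gcongr; exact (hm _).trans h3
      linarith
    · refine (norm_add_le _ _).trans ?_
      have a1 := norm_sub_le (Q Y.2.1) (α • R Y.2.1)
      have a2 : ‖Q Y.2.1‖ ≤ q * ‖Y.2.1‖ := hbn _
      have a3 : ‖(γ * l⁻¹) • (Y.1 • g)‖ ≤ γ * l⁻¹ * ‖Y‖ := by
        rw [norm_smul, norm_smul, Real.norm_of_nonneg (show 0 ≤ γ * l⁻¹ by positivity)]
        refine mul_le_mul_of_nonneg_left ?_ (by positivity)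
        exact (mul_le_of_le_one_right (norm_nonneg _) hg).trans h1
      linarith
    · refine (norm_sub_le _ _).trans ?_
      have a1 : ‖(χ * l⁻¹) • Y.2.2‖ ≤ χ * l⁻¹ * ‖Y‖ := by
        rw [norm_smul, Real.norm_of_nonneg (show 0 ≤ χ * l⁻¹ by positivity)]
        gcongr
      linarith
  obtain ⟨U, hU⟩ := isUnit_one_sub_of_norm_lt_one hPn
  set Y := (U⁻¹).val F with hY
  have hYF : Y - P Y = F := by
    have h1 : (U.val * (U⁻¹).val) F = F := by rw [U.mul_inv]; rfl
    rw [hU] at h1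
    exact h1
  obtain ⟨y₁, y₂, y₃⟩ := Y
  refine ⟨(l⁻¹ * y₁, R y₂, l⁻¹ • y₃), _, mem_coupledGraph.2 ⟨_, _, hR y₂, hb y₂, rfl⟩, ?_⟩
  rw [← hYF, hP, hQb]
  simp only [Prod.smul_mk, Prod.mk_sub_mk, Prod.mk.injEq, smul_eq_mul, map_smul]
  have hll : l * l⁻¹ = 1 := mul_inv_cancel₀ hl.ne'
  refine ⟨?_, ?_, ?_⟩
  · linear_combination y₁ * hll
  · module
  · rw [smul_smul, hll]; module

/-- The defect `d` satisfies `A d = l d` for the generator `A` of `S`, which a norming functional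
excludes unless `d = 0`. Hence every vector of the domain of `A` is a value of `R`. -/
theorem resolvent_apply_eq (hSle : ∀ t, 0 ≤ t → ∀ v, ‖S t v‖ ≤ ‖v‖) {l : ℝ} (hl : 0 < l)
    {R : E →L[ℝ] E} (hR : ∀ f, (R f, l • R f - f) ∈ generatorGraph (fun t v => S t v)) {v a : E}
    (h : (v, a) ∈ generatorGraph (fun t v => S t v)) : R (l • v - a) = v := by
  set d := v - R (l • v - a) with hd
  have h1 : (d, l • d) ∈ generatorGraph (fun t v => S t v) := by
    have h2 := generatorGraph_add_mem h (generatorGraph_smul_mem (-1) (hR (l • v - a)))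
    convert h2 using 1
    rw [Prod.smul_mk, Prod.mk_add_mk, hd]
    refine Prod.ext ?_ ?_
    · module
    · module
  obtain ⟨ψ, hψ, hψd⟩ := exists_dual_vector'' ℝ d
  simp only [RCLike.ofReal_real_eq_id, id_eq] at hψd
  have h3 := norming_functional_generator_nonpos hSle h1 hψ hψd
  rw [map_smul, hψd, smul_eq_mul] at h3
  have h4 : ‖d‖ ≤ 0 := by
    by_contra hlt
    exact absurd h3 (not_le.2 (mul_pos hl (not_le.1 hlt)))
  exact (sub_eq_zero.1 (norm_le_zero_iff.1 h4)).symm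

/-- The range of `R` is the domain of the generator of `S` and lies in that of `V`, so the coupled
domain contains the dense set `ℝ × D(A) × E`. -/
theorem coupledGraph_domain_dense [CompleteSpace E] (hS : IsC0Semigroup S)
    (hSle : ∀ t, 0 ≤ t → ∀ v, ‖S t v‖ ≤ ‖v‖) {l : ℝ} (hl : 0 < l) {R : E →L[ℝ] E}
    (hR : ∀ f, (R f, l • R f - f) ∈ generatorGraph (fun t v => S t v))
    (hQ : ∀ f, ∃ b, (R f, b) ∈ generatorGraph (fun t v => V t v)) :
    Dense {x | ∃ z, (x, z) ∈ coupledGraph S V m g α γ χ} := by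
  have h1 : Dense {v : E | ∃ a, (v, a) ∈ generatorGraph (fun t v => S t v)} := hS.dense_domain hSle
  have h2 := (dense_univ (X := ℝ)).prod (h1.prod (dense_univ (X := E)))
  refine h2.mono ?_
  rintro ⟨u, v, w⟩ ⟨-, ⟨a, ha⟩, -⟩
  obtain ⟨b, hb⟩ := hQ (l • v - a)
  rw [resolvent_apply_eq hSle hl hR ha] at hb
  exact ⟨_, mem_coupledGraph.2 ⟨a, b, ha, hb, rfl⟩⟩

/-- A semigroup generated by the coupled operator preserves the set of states whose sum norm is at
most their total mass. -/
theorem sumNorm_le_totalMass_of_generator {T : ℝ → (ℝ × E × E) →L[ℝ] (ℝ × E × E)}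
    (hT : IsC0Semigroup T)
    (hG : generatorGraph (fun t x => T t x) = coupledGraph S V m g α γ χ)
    (hSle : ∀ t, 0 ≤ t → ∀ v, ‖S t v‖ ≤ ‖v‖) (hVle : ∀ t, 0 ≤ t → ∀ v, ‖V t v‖ ≤ ‖v‖)
    (hmS : ∀ t, 0 ≤ t → ∀ v, m (S t v) = m v) (hmV : ∀ t, 0 ≤ t → ∀ v, m (V t v) = m v)
    (hm : ∀ v, |m v| ≤ ‖v‖) (hg : ‖g‖ ≤ 1) (hmg : m g = 1)
    (hα : 0 ≤ α) (hγ : 0 ≤ γ) (hχ : 0 ≤ χ)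
    (hD : Dense {x | ∃ z, (x, z) ∈ coupledGraph S V m g α γ χ}) {t : ℝ} (ht : 0 ≤ t)
    {x : ℝ × E × E} (hx : sumNorm E x ≤ totalMass m x) :
    sumNorm E (T t x) ≤ totalMass m (T t x) := by
  -- As the mass vanishes on the range of the operator, `p` inherits the dissipativity of the sum
  -- norm and so does not increase along orbits starting in the domain. Continuity and density cover
  -- all other orbits.
  set p : ℝ × E × E → ℝ := fun x => sumNorm E x - totalMass m x with hp
  have hlip : ∀ x y, p x ≤ p y + (3 + ‖totalMass m‖) * ‖x - y‖ := by
    intro x y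
    have h1 : sumNorm E x ≤ sumNorm E y + sumNorm E (x - y) := by
      simpa using map_add_le_add (sumNorm E) y (x - y)
    have h2 := sumNorm_le (x - y)
    have h3 : |totalMass m (x - y)| ≤ _ := (totalMass m).le_opNorm (x - y)
    rw [map_sub] at h3
    have h4 := (abs_le.1 h3).1
    simp only [hp]
    linarith
  have hpc : Continuous p := continuous_of_le_add_mul_norm hlip
  have hdom : ∀ x ∈ {x | ∃ z, (x, z) ∈ coupledGraph S V m g α γ χ}, p (T t x) ≤ p x := by
    rintro x ⟨z, hz⟩
    rw [← hG] at hz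
    have h1 := functional_le_of_dissipative_path hlip (u := fun s => T s x) (u' := fun s => T s z)
      (hT.continuousOn_orbit x) (fun s hs => hT.hasDerivWithinAt_orbit hz hs)
      (fun s hs => (hT.continuousOn_orbit z s hs).mono (Set.Ici_subset_Ici.2 hs)) ?_ ht
    · simpa only [hT.zero_apply] using h1
    · intro s hs h hh
      have h2 := hT.apply_mem_generatorGraph hz hs
      rw [hG] at h2
      have h3 := sumNorm_dissipative hSle hVle hm hg hα hγ hχ h2 hh
      simp only [hp]
      rw [map_sub (totalMass m), map_smul (totalMass m), totalMass_coupledGraph hmS hmV hmg h2,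
        smul_zero, sub_zero]
      linarith
  have hcl : IsClosed {x | p (T t x) ≤ p x} :=
    isClosed_le (hpc.comp (T t).continuous) hpc
  have hall : p (T t x) ≤ p x :=
    hcl.closure_subset_iff.2 hdom (hD x)
  simp only [hp] at hall
  linarith

end Coupled

/-! ### The return-to-home system as a coupled operator -/

section FullSystem

theorem returnHomeGraph_eq_coupledGraph {ε σ α γ χ : ℝ} {y : Plane} {C : Plane → Plane}
    {S V : ℝ → L1 →L[ℝ] L1} (hS : ∀ t, 0 ≤ t → ∀ v, S t v = diffusion ε t v)
    (hV : ∀ t, 0 ≤ t → ∀ v, V t v = convection C t v) :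
    returnHomeGraph ε σ α γ χ y C =
      coupledGraph S V mass (toL1 fun x => gaussian σ (x - y)) α γ χ := by
  have hS' : generatorGraph (fun t v => S t v) = generatorGraph (diffusion ε) :=
    generatorGraph_congr fun t ht => funext (hS t ht.le)
  have hV' : generatorGraph (fun t v => V t v) = generatorGraph (convection C) :=
    generatorGraph_congr fun t ht => funext (hV t ht.le)
  ext ⟨⟨u, v, w⟩, z⟩
  rw [mem_coupledGraph, hS', hV']
  constructor
  · rintro ⟨q, ⟨f, ⟨a, b, ha, hb, hf⟩, hq⟩, hz⟩
    refine ⟨a, b, ha, hb, ?_⟩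
    obtain rfl : f = a + b := hf
    simp only at hq hz
    rw [hz, hq]
    simp only [coupling, Prod.mk_add_mk, add_zero, mass_apply]
  · rintro ⟨a, b, ha, hb, rfl⟩
    refine ⟨(-γ * u, a + b - α • v, α • v - χ • w), ⟨a + b, ⟨a, b, ha, hb, rfl⟩, rfl⟩, ?_⟩
    simp only [coupling, Prod.mk_add_mk, add_zero, mass_apply]

/-- In each component the mass is at most the norm, so one inequality between the sums forces
equality in all three components. -/
theorem mem_positiveCone_iff (x : State) : x ∈ positiveCone ↔ sumNorm L1 x ≤ totalMass mass x := by
  rw [sumNorm_apply, totalMass_apply]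
  constructor
  · rintro ⟨h1, h2, h3⟩
    rw [abs_of_nonneg h1, mass_eq_norm h2, mass_eq_norm h3, add_assoc]
  · intro h
    have h1 := le_abs_self x.1
    have h2 := (le_abs_self _).trans (abs_mass_le x.2.1)
    have h3 := (le_abs_self _).trans (abs_mass_le x.2.2)
    exact ⟨abs_nonneg x.1 |>.trans (by linarith), nonneg_of_norm_le_mass (by linarith),
      nonneg_of_norm_le_mass (by linarith)⟩

theorem integrable_gaussian_sub {σ : ℝ} (hσ : 0 < σ) (y : Plane) :
    Integrable (fun x => gaussian σ (x - y)) volume := by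
  rw [gaussian_eq]
  exact (integrable_gaussKernel (by positivity)).comp_sub_right y

theorem mass_gaussian_sub {σ : ℝ} (hσ : 0 < σ) (y : Plane) :
    mass (toL1 fun x => gaussian σ (x - y)) = 1 := by
  rw [mass_apply, integral_toL1 (integrable_gaussian_sub hσ y), gaussian_eq,
    integral_sub_right_eq_self (gaussKernel (σ ^ 2 / 2)) y, integral_gaussKernel (by positivity)]

theorem norm_gaussian_sub {σ : ℝ} (hσ : 0 < σ) (y : Plane) :
    ‖toL1 fun x => gaussian σ (x - y)‖ = 1 := by
  rw [norm_toL1 (integrable_gaussian_sub hσ y), gaussian_eq,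
    integral_sub_right_eq_self (fun x => ‖gaussKernel (σ ^ 2 / 2) x‖) y,
    integral_norm_gaussKernel (by positivity)]

end FullSystem

end ReturnHome

end

/-! ### Generation and positivity -/

theorem theorem4p2 (ε σ α γ χ : ℝ) (hε : 0 < ε ^ 2) (hσ : 0 < σ)
    (hα : 0 ≤ α) (hγ : 0 ≤ γ) (hχ : 0 ≤ χ)
    (y : ReturnHome.Plane) (C : ReturnHome.Plane → ReturnHome.Plane)
    (hC : ReturnHome.IsVelocityField C) :
    (∃ T : ℝ → ReturnHome.State →L[ℝ] ReturnHome.State,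
      ReturnHome.IsC0Semigroup T ∧
      ReturnHome.generatorGraph (fun t p => T t p) =
        ReturnHome.returnHomeGraph ε σ α γ χ y C) ∧
    ∀ T : ℝ → ReturnHome.State →L[ℝ] ReturnHome.State,
      ReturnHome.IsC0Semigroup T →
      ReturnHome.generatorGraph (fun t p => T t p) =
        ReturnHome.returnHomeGraph ε σ α γ χ y C →
      ∀ t : ℝ, 0 ≤ t → ∀ p ∈ ReturnHome.positiveCone, T t p ∈ ReturnHome.positiveCone := by
  open ReturnHome in
  obtain ⟨S, hS, hSd, hSf, hSle, hSm⟩ := exists_diffusion_semigroup hε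
  obtain ⟨V, hV, hVc, hVf, hVle, hVm⟩ := hC.exists_convection_semigroup
  rw [returnHomeGraph_eq_coupledGraph hSd hVc]
  have hg := (norm_gaussian_sub hσ y).le
  have hmg := mass_gaussian_sub hσ y
  generalize (toL1 fun x => gaussian σ (x - y)) = g at hg hmg
  obtain ⟨q, hq, hqR⟩ := hC.exists_relative_bound hε hS hV hSf hVf hSle hVle
  -- This is the Neumann series condition of `coupledGraph_range`; the relative bound zero of
  -- convection makes it hold for all large `l`.
  have hsmall : ∀ᶠ l in atTop, 0 < l ∧ q l + (α + γ + χ) * l⁻¹ < 1 := by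
    have h1 := hq.add (tendsto_inv_atTop_zero.const_mul (α + γ + χ))
    rw [mul_zero, add_zero] at h1
    exact (eventually_gt_atTop 0).and (h1.eventually_lt_const one_pos)
  obtain ⟨l₀, hl₀⟩ := eventually_atTop.1 hsmall
  have hl₀pos := (hl₀ l₀ le_rfl).1
  have hdense : Dense {x | ∃ z, (x, z) ∈ coupledGraph S V mass g α γ χ} := by
    obtain ⟨R, hR, hRg, -⟩ := hS.exists_resolvent hSle hl₀pos
    exact coupledGraph_domain_dense hS hSle hl₀pos hRg fun f =>
      ((hqR l₀ hl₀pos).2 R hR f).imp fun _ h => h.1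
  refine ⟨exists_semigroup_of_dissipative (fun p hp p' hp' => coupledGraph_add_mem hp hp')
    (fun c p hp => coupledGraph_smul_mem c hp) one_pos
    (fun x => (one_mul ‖x‖).trans_le (norm_le_sumNorm x)) sumNorm_le
    (fun x z hxz h hh => sumNorm_dissipative hSle hVle abs_mass_le hg hα hγ hχ hxz hh) hl₀pos
    (fun l hl F => ?_) hdense, fun T hT hG t ht p hp => ?_⟩
  · obtain ⟨hlpos, hlq⟩ := hl₀ l hl
    obtain ⟨R, hR, hRg, hRn⟩ := hS.exists_resolvent hSle hlpos
    exact coupledGraph_range abs_mass_le hg hα hγ hχ hlpos hRg hRn (hqR l hlpos).1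
      ((hqR l hlpos).2 R hR) hlq F
  · rw [mem_positiveCone_iff] at hp ⊢
    exact sumNorm_le_totalMass_of_generator hT hG hSle hVle hSm hVm abs_mass_le hg hmg hα hγ hχ
      hdense ht hp
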